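/- **Conventions.** All C*-algebras and $*$-homomorphisms are unital and $\otimes$ between C*-algebras is the minimal tensor product. A compact quantum group $\mathbb{G}$ is a nonzero C*-algebra $C(\mathbb{G})$ with a coassociative $*$-homomorphism $\Delta_{\mathbb{G}}: C(\mathbb{G})\to C(\mathbb{G})\otimes C(\mathbb{G})$ such that the spans of $\Delta_{\mathbb{G}}(C(\mathbb{G}))(1\otimes C(\mathbb{G}))$ and $\Delta_{\mathbb{G}}(C(\mathbb{G}))(C(\mathbb{G})\otimes 1)$ are dense. A compact quantum subgroup $\mathbb{H}$ of $\mathbb{G}$ is given by a surjective $*$-homomorphism $\pi: C(\mathbb{G})\to C(\mathbb{H})$ with $\Delta_{\mathbb{H}}\circ\pi=(\pi\otimes\pi)\circ\Delta_{\mathbb{G}}$. An action of $\mathbb{G}$ on a C*-algebra $B$ is a $*$-homomorphism $\alpha: B\to B\otimes C(\mathbb{G})$ such that $(\alpha\otimes\mathrm{id})\circ\alpha=(\mathrm{id}\otimes\Delta_{\mathbb{G}})\circ\alpha$ and the span of $(1\otimes C(\mathbb{G}))\alpha(B)$ is dense in $B\otimes C(\mathbb{G})$. It is ergodic if $B\neq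 0$ and $\{b\in B: \alpha(b)=b\otimes 1\}=\mathbb{C}1$. $\mathrm{Rep}(\mathbb{G})$ is the monoidal $*$-category of finite-dimensional unitary representations, that is, unitaries $u\in B(H_u)\otimes C(\mathbb{G})$ with $(\mathrm{id}\otimes\Delta_{\mathbb{G}})(u)=u_{12}u_{13}$; put $\delta_u(\xi)=u(\xi\otimes 1)\in H_u\otimes C(\mathbb{G})$. Its morphism spaces are $\mathrm{Mor}_{\mathbb{G}}(u,v)=\{V: H_u\to H_v \text{ linear}: \delta_v\circ V=(V\otimes\mathrm{id})\circ\delta_u\}$, its tensor product is $u\boxtimes v=u_{13}v_{23}$ and its unit is the trivial representation on $\mathbb{C}$. The restriction functor $\mathrm{Res}^{\mathbb{G}}_{\mathbb{H}}:\mathrm{Rep}(\mathbb{G})\to\mathrm{Rep}(\mathbb{H})$ sends $u$ to $(\mathrm{id}\otimes\pi)(u)$ and is the identity on morphisms. For an action $\alpha$ of $\mathbb{G}$ on $B$ and $u\in \mathrm{Rep}(\mathbb{G})$ let $$\mathrm{Mor}_{\mathbb{G}}(u,\alpha)=\{T: H_u\to B\text{ linear}:\ \alpha\circ T=(T\otimes\mathrm{id})\circ\delta_u\},\qquad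 \langle T,R\rangle_B=\sum_i T(e_i)R(e_i)^*\in B,$$ where $(e_i)$ is any orthonormal basis of $H_u$. For $V\in\mathrm{Mor}_{\mathbb{G}}(u,v)$ put $\varphi_\alpha(V)T=T\circ V^*\in \mathrm{Mor}_{\mathbb{G}}(v,\alpha)$, and for $T\in \mathrm{Mor}_{\mathbb{G}}(u,\alpha)$ and $R\in \mathrm{Mor}_{\mathbb{G}}(v,\alpha)$ let $T\cdot R\in\mathrm{Mor}_{\mathbb{G}}(u\boxtimes v,\alpha)$ be the map $\xi\otimes\eta\mapsto T(\xi)R(\eta)$. If $\alpha$ is ergodic, then $\langle T,R\rangle_B$ is a scalar multiple $\langle T,R\rangle 1$ of the unit. In that case the spectral functor $\varphi_\alpha$ is the weak unitary tensor functor $u\mapsto\mathrm{Mor}_{\mathbb{G}}(u,\alpha)$, $V\mapsto\varphi_\alpha(V)$, with the inner product $\langle\cdot,\cdot\rangle$ and the complex conjugate of the usual multiplication by scalars (so that $V\mapsto\varphi_\alpha(V)$ is linear), with the isometries $\varphi_\alpha(u)\otimes\varphi_\alpha(v)\to\varphi_\alpha(u\boxtimes v)$, $T\otimes R\mapsto T\cdot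 R$, and with the identification $\mathbb{C}=\varphi_\alpha(1)$ sending $1$ to $z\mapsto z1_B$. A natural unitary monoidal isomorphism between two weak unitary tensor functors $\varphi,\varphi'$ on $\mathrm{Rep}(\mathbb{G})$ is a family of unitaries $\varphi(u)\to\varphi'(u)$ that is natural in $u$ and intertwines the isometries $\varphi(u)\otimes\varphi(v)\to\varphi(u\boxtimes v)$ and $\varphi'(u)\otimes\varphi'(v)\to\varphi'(u\boxtimes v)$ and the identifications $\mathbb{C}=\varphi(1)$, $\mathbb{C}=\varphi'(1)$. Let $\mathbb{H}$ be a compact quantum subgroup of $\mathbb{G}$ and $\alpha$ an action of $\mathbb{H}$ on $B$. The induced action $\mathrm{Ind}^{\mathbb{G}}_{\mathbb{H}}(\alpha)$ is the restriction of $\mathrm{id}\otimes\Delta_{\mathbb{G}}$ to the C*-algebra $$\mathrm{Ind}^{\mathbb{G}}_{\mathbb{H}}(B)=\{x\in B\otimes C(\mathbb{G}):\ (\alpha\otimes\mathrm{id})(x)=(\mathrm{id}\otimes\pi\otimes\mathrm{id})(\mathrm{id}\otimes\Delta_{\mathbb{G}})(x)\}.$$ In forming its fixed points and its spaces $\mathrm{Mor}_{\mathbb{G}}(u,\mathrm{Ind}^{\mathbb{G}}_{\mathbb{H}}(\alpha))$,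 the algebra $\mathrm{Ind}^{\mathbb{G}}_{\mathbb{H}}(B)\otimes C(\mathbb{G})$ is regarded as a subalgebra of $B\otimes C(\mathbb{G})\otimes C(\mathbb{G})$. **Theorem.** Let $\mathbb{H}$ be a compact quantum subgroup of a compact quantum group $\mathbb{G}$ and let $\alpha$ be an action of $\mathbb{H}$ on a C*-algebra $B$. Then there are linear bijections $$\psi_u:\ \mathrm{Mor}_{\mathbb{H}}(\mathrm{Res}^{\mathbb{G}}_{\mathbb{H}}(u),\alpha)\longrightarrow\mathrm{Mor}_{\mathbb{G}}(u,\mathrm{Ind}^{\mathbb{G}}_{\mathbb{H}}(\alpha)),\qquad u\in\mathrm{Rep}(\mathbb{G}),$$ with the following properties for all $u,v\in\mathrm{Rep}(\mathbb{G})$, $T,R\in \mathrm{Mor}_{\mathbb{H}}(\mathrm{Res}^{\mathbb{G}}_{\mathbb{H}}(u),\alpha)$ and $R'\in \mathrm{Mor}_{\mathbb{H}}(\mathrm{Res}^{\mathbb{G}}_{\mathbb{H}}(v),\alpha)$. 1. (naturality) $\psi_v(T\circ V^*)=\psi_u(T)\circ V^*$ for every $V\in\mathrm{Mor}_{\mathbb{G}}(u,v)$;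 2. (monoidality) $\psi_{u\boxtimes v}(T\cdot R')=\psi_u(T)\cdot\psi_v(R')$, where $\mathrm{Res}(u)\boxtimes\mathrm{Res}(v)$ is identified with $\mathrm{Res}(u\boxtimes v)$, and $\psi_1(z\mapsto zc1_B)=(z\mapsto zc\,1_{\mathrm{Ind}(B)})$ for $c\in\mathbb{C}$; 3. (unitarity) $\langle\psi_u(T),\psi_u(R)\rangle_{\mathrm{Ind}(B)}=\langle T,R\rangle_B\otimes 1$ in $B\otimes C(\mathbb{G})$. Moreover, if $\alpha$ is ergodic, then $\mathrm{Ind}^{\mathbb{G}}_{\mathbb{H}}(\alpha)$ is ergodic, and $\psi=\{\psi_u\}_{u\in\mathrm{Rep}(\mathbb{G})}$ is a natural unitary monoidal isomorphism between the weak unitary tensor functors $\varphi_\alpha\circ\mathrm{Res}^{\mathbb{G}}_{\mathbb{H}}$ and $\varphi_{\mathrm{Ind}^{\mathbb{G}}_{\mathbb{H}}(\alpha)}$ on $\mathrm{Rep}(\mathbb{G})$. -/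

import Mathlib

set_option linter.unusedSectionVars false
set_option linter.overlappingInstances false

open scoped TensorProduct InnerProductSpace

universe u v

noncomputable section

namespace QG

section TensorStar
variable {X : Type*} {Y : Type*} [Ring X] [StarRing X] [Algebra ℂ X] [StarModule ℂ X]
  [Ring Y] [StarRing Y] [Algebra ℂ Y] [StarModule ℂ Y]

instance tensorStarRing : StarRing (X ⊗[ℂ] Y) where
  star_mul a b := by
    induction a using TensorProduct.induction_on with
    | zero => simp
    | add x y hx hy => simp only [add_mul, star_add, hx, hy, mul_add]
    | tmul x y =>
      induction b using TensorProduct.induction_on with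
      | zero => simp
      | add x y hx hy => simp only [mul_add, star_add, hx, hy, add_mul]
      | tmul x' y' => simp [Algebra.TensorProduct.tmul_mul_tmul]
  star_add := star_add

/-- Two commuting `*`-homomorphisms into one `*`-algebra give a `*`-homomorphism on the algebraic
tensor product, `x ⊗ y ↦ f x * g y`. -/
def starLift {Z : Type*} [Ring Z] [StarRing Z] [Algebra ℂ Z] [StarModule ℂ Z] (f : X →⋆ₐ[ℂ] Z)
    (g : Y →⋆ₐ[ℂ] Z) (h : ∀ x y, Commute (f x) (g y)) : X ⊗[ℂ] Y →⋆ₐ[ℂ] Z where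
  __ := Algebra.TensorProduct.lift f.toAlgHom g.toAlgHom h
  map_star' a := by
    induction a using TensorProduct.induction_on with
    | zero => simp
    | add x y hx hy =>
      simp only [AlgHom.toRingHom_eq_coe, RingHom.toMonoidHom_eq_coe, OneHom.toFun_eq_coe,
        MonoidHom.toOneHom_coe, MonoidHom.coe_coe, RingHom.coe_coe, star_add, map_add] at hx hy ⊢
      rw [hx, hy]
    | tmul x y =>
      simp only [AlgHom.toRingHom_eq_coe, RingHom.toMonoidHom_eq_coe, OneHom.toFun_eq_coe,
        MonoidHom.toOneHom_coe, MonoidHom.coe_coe, RingHom.coe_coe, TensorProduct.star_tmul,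
        Algebra.TensorProduct.lift_tmul, StarAlgHom.coe_toAlgHom, map_star, star_mul]
      exact ((h x y).star_star).eq

@[simp] lemma starLift_tmul {Z : Type*} [Ring Z] [StarRing Z] [Algebra ℂ Z] [StarModule ℂ Z]
    (f : X →⋆ₐ[ℂ] Z) (g : Y →⋆ₐ[ℂ] Z) (h : ∀ x y, Commute (f x) (g y)) (x : X) (y : Y) :
    starLift f g h (x ⊗ₜ y) = f x * g y :=
  Algebra.TensorProduct.lift_tmul f.toAlgHom g.toAlgHom h x y

/-- `x ↦ x ⊗ 1` -/
def inclL (X Y : Type*) [Ring X] [StarRing X] [Algebra ℂ X] [StarModule ℂ X]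
  [Ring Y] [StarRing Y] [Algebra ℂ Y] [StarModule ℂ Y] : X →⋆ₐ[ℂ] X ⊗[ℂ] Y where
  __ := Algebra.TensorProduct.includeLeft
  map_star' x := by simp

/-- `y ↦ 1 ⊗ y` -/
def inclR (X Y : Type*) [Ring X] [StarRing X] [Algebra ℂ X] [StarModule ℂ X]
  [Ring Y] [StarRing Y] [Algebra ℂ Y] [StarModule ℂ Y] : Y →⋆ₐ[ℂ] X ⊗[ℂ] Y where
  __ := Algebra.TensorProduct.includeRight
  map_star' x := by simp

@[simp] lemma inclL_apply (x : X) : inclL X Y x = x ⊗ₜ 1 := rfl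
@[simp] lemma inclR_apply (y : Y) : inclR X Y y = 1 ⊗ₜ y := rfl

/-- `f ⊗ g` on algebraic tensor products. -/
def starMap {X' Y' : Type*} [Ring X'] [StarRing X'] [Algebra ℂ X'] [StarModule ℂ X']
  [Ring Y'] [StarRing Y'] [Algebra ℂ Y'] [StarModule ℂ Y'] (f : X →⋆ₐ[ℂ] X') (g : Y →⋆ₐ[ℂ] Y') :
    X ⊗[ℂ] Y →⋆ₐ[ℂ] X' ⊗[ℂ] Y' :=
  starLift ((inclL X' Y').comp f) ((inclR X' Y').comp g) fun x y => by
    simp [Commute, SemiconjBy]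

@[simp] lemma starMap_tmul {X' Y' : Type*} [Ring X'] [StarRing X'] [Algebra ℂ X'] [StarModule ℂ X']
  [Ring Y'] [StarRing Y'] [Algebra ℂ Y'] [StarModule ℂ Y'] (f : X →⋆ₐ[ℂ] X') (g : Y →⋆ₐ[ℂ] Y')
  (x : X) (y : Y) : starMap f g (x ⊗ₜ y) = f x ⊗ₜ g y :=
  (starLift_tmul _ _ _ x y).trans (by simp)

lemma starHom_ext {Z : Type*} [Ring Z] [StarRing Z] [Algebra ℂ Z]
    {f g : X ⊗[ℂ] Y →⋆ₐ[ℂ] Z} (h : ∀ x y, f (x ⊗ₜ y) = g (x ⊗ₜ y)) : f = g := by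
  ext a
  induction a using TensorProduct.induction_on with
  | zero => simp
  | add x y hx hy => simp [hx, hy]
  | tmul x y => exact h x y

end TensorStar

section Hilbert

/-- The Hilbert space tensor product. -/
def HTensor (H K : Type*) [NormedAddCommGroup H] [InnerProductSpace ℂ H]
    [NormedAddCommGroup K] [InnerProductSpace ℂ K] : Type _ :=
  UniformSpace.Completion (H ⊗[ℂ] K)

section
variable (H K : Type*) [NormedAddCommGroup H] [InnerProductSpace ℂ H]
    [NormedAddCommGroup K] [InnerProductSpace ℂ K]

instance : NormedAddCommGroup (HTensor H K) :=
  inferInstanceAs (NormedAddCommGroup (UniformSpace.Completion (H ⊗[ℂ] K)))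
instance : InnerProductSpace ℂ (HTensor H K) :=
  inferInstanceAs (InnerProductSpace ℂ (UniformSpace.Completion (H ⊗[ℂ] K)))
instance : CompleteSpace (HTensor H K) :=
  inferInstanceAs (CompleteSpace (UniformSpace.Completion (H ⊗[ℂ] K)))

/-- The algebraic tensor product inside the Hilbert space tensor product. -/
def HTensor.mk : H ⊗[ℂ] K →ₗᵢ[ℂ] HTensor H K := UniformSpace.Completion.toComplₗᵢ

lemma HTensor.denseRange_mk : DenseRange (HTensor.mk H K) :=
  UniformSpace.Completion.denseRange_coe

variable {H K}

/-- The extension of an operator on the algebraic tensor product. -/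
def HTensor.ext (S : (H ⊗[ℂ] K) →L[ℂ] (H ⊗[ℂ] K)) : HTensor H K →L[ℂ] HTensor H K :=
  S.completion

@[simp] lemma HTensor.ext_mk (S : (H ⊗[ℂ] K) →L[ℂ] (H ⊗[ℂ] K)) (x : H ⊗[ℂ] K) :
    HTensor.ext S (HTensor.mk H K x) = HTensor.mk H K (S x) :=
  ContinuousLinearMap.completion_apply_coe S x

lemma HTensor.clm_ext {W : Type*} [NormedAddCommGroup W] [NormedSpace ℂ W]
    {f g : HTensor H K →L[ℂ] W} (h : ∀ x, f (HTensor.mk H K x) = g (HTensor.mk H K x)) :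
    f = g := by
  ext x
  exact (HTensor.denseRange_mk H K).induction_on (p := fun x => f x = g x) x
    (isClosed_eq f.continuous g.continuous) h

lemma HTensor.clm_ext' {W : Type*} [NormedAddCommGroup W] [NormedSpace ℂ W]
    {f g : HTensor H K →L[ℂ] W}
    (h : ∀ x y, f (HTensor.mk H K (x ⊗ₜ y)) = g (HTensor.mk H K (x ⊗ₜ y))) : f = g := by
  refine HTensor.clm_ext fun x => ?_
  induction x using TensorProduct.induction_on with
  | zero => simp
  | add a b ha hb => simp only [map_add, ha, hb]
  | tmul a b => exact h a b

lemma HTensor.adjoint_eq {S T : HTensor H K →L[ℂ] HTensor H K}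
    (h : ∀ x y x' y', inner ℂ (S (HTensor.mk H K (x ⊗ₜ y))) (HTensor.mk H K (x' ⊗ₜ y'))
      = inner ℂ (HTensor.mk H K (x ⊗ₜ y)) (T (HTensor.mk H K (x' ⊗ₜ y')))) :
    S = star T := by
  rw [ContinuousLinearMap.star_eq_adjoint, ContinuousLinearMap.eq_adjoint_iff]
  intro x y
  refine (HTensor.denseRange_mk H K).induction_on₂
    (p := fun x y => inner ℂ (S x) y = inner ℂ x (T y)) ?_ ?_ x y
  · apply isClosed_eq <;> fun_prop
  intro x y
  induction x using TensorProduct.induction_on with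
  | zero => simp
  | add a b ha hb => simp only [map_add, inner_add_left, ha, hb]
  | tmul a b =>
    induction y using TensorProduct.induction_on with
    | zero => simp
    | add a b ha hb => simp only [map_add, inner_add_right, ha, hb]
    | tmul c d => exact h a b c d

end

/-- The operator `S ⊗ 1` on the Hilbert space tensor product. -/
def ampL (H K : Type*) [NormedAddCommGroup H] [InnerProductSpace ℂ H] [CompleteSpace H]
    [NormedAddCommGroup K] [InnerProductSpace ℂ K] :
    (H →L[ℂ] H) →⋆ₐ[ℂ] (HTensor H K →L[ℂ] HTensor H K) where
  toFun S := HTensor.ext (S.rTensor K)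
  map_one' := HTensor.clm_ext fun x => by simp
  map_mul' S T := HTensor.clm_ext fun x => by simp [ContinuousLinearMap.rTensor_mul]
  map_zero' := HTensor.clm_ext fun x => by simp
  map_add' S T := HTensor.clm_ext fun x => by simp [ContinuousLinearMap.rTensor_add]
  commutes' r := HTensor.clm_ext fun x => by
    simp [Algebra.algebraMap_eq_smul_one, ContinuousLinearMap.rTensor_smul]
  map_star' S := HTensor.adjoint_eq fun x y x' y' => by
    simp [ContinuousLinearMap.star_eq_adjoint, ContinuousLinearMap.adjoint_inner_left]

/-- The operator `1 ⊗ T` on the Hilbert space tensor product. -/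
def ampR (H K : Type*) [NormedAddCommGroup H] [InnerProductSpace ℂ H]
    [NormedAddCommGroup K] [InnerProductSpace ℂ K] [CompleteSpace K] :
    (K →L[ℂ] K) →⋆ₐ[ℂ] (HTensor H K →L[ℂ] HTensor H K) where
  toFun S := HTensor.ext (S.lTensor H)
  map_one' := HTensor.clm_ext fun x => by simp
  map_mul' S T := HTensor.clm_ext fun x => by simp [ContinuousLinearMap.lTensor_mul]
  map_zero' := HTensor.clm_ext fun x => by simp
  map_add' S T := HTensor.clm_ext fun x => by simp [ContinuousLinearMap.lTensor_add]
  commutes' r := HTensor.clm_ext fun x => by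
    simp [Algebra.algebraMap_eq_smul_one, ContinuousLinearMap.lTensor_smul]
  map_star' S := HTensor.adjoint_eq fun x y x' y' => by
    simp [ContinuousLinearMap.star_eq_adjoint, ContinuousLinearMap.adjoint_inner_left]

section
variable {H K : Type*} [NormedAddCommGroup H] [InnerProductSpace ℂ H] [CompleteSpace H]
    [NormedAddCommGroup K] [InnerProductSpace ℂ K] [CompleteSpace K]

@[simp] lemma ampL_mk (S : H →L[ℂ] H) (x : H) (y : K) :
    ampL H K S (HTensor.mk H K (x ⊗ₜ y)) = HTensor.mk H K (S x ⊗ₜ y) :=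
  HTensor.ext_mk (S.rTensor K) (x ⊗ₜ y)

@[simp] lemma ampR_mk (S : K →L[ℂ] K) (x : H) (y : K) :
    ampR H K S (HTensor.mk H K (x ⊗ₜ y)) = HTensor.mk H K (x ⊗ₜ S y) :=
  HTensor.ext_mk (S.lTensor H) (x ⊗ₜ y)

lemma amp_commute (S : H →L[ℂ] H) (T : K →L[ℂ] K) : Commute (ampL H K S) (ampR H K T) :=
  HTensor.clm_ext' fun x y => by simp

variable {X Y : Type*} [Ring X] [StarRing X] [Algebra ℂ X] [StarModule ℂ X]
  [Ring Y] [StarRing Y] [Algebra ℂ Y] [StarModule ℂ Y]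

/-- The representation `ρ ⊗ σ` of `X ⊗ Y` on the Hilbert space tensor product. -/
def tensorRep (ρ : X →⋆ₐ[ℂ] (H →L[ℂ] H)) (σ : Y →⋆ₐ[ℂ] (K →L[ℂ] K)) :
    X ⊗[ℂ] Y →⋆ₐ[ℂ] (HTensor H K →L[ℂ] HTensor H K) :=
  starLift (Z := HTensor H K →L[ℂ] HTensor H K) ((ampL H K).comp ρ) ((ampR H K).comp σ)
    (by intro x y; rw [StarAlgHom.comp_apply, StarAlgHom.comp_apply]; exact amp_commute _ _)

end

end Hilbert

/-! ### Completion of a `*`-algebra with respect to a family of Hilbert space representations -/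

/-- A family of unital `*`-representations of `X` on Hilbert spaces, bounded at each element. -/
structure RepFamily (X : Type u) [Ring X] [StarRing X] [Algebra ℂ X] [StarModule ℂ X] where
  I : Type (u + 1)
  H : I → Type u
  [normed : ∀ i, NormedAddCommGroup (H i)]
  [inner : ∀ i, InnerProductSpace ℂ (H i)]
  [complete : ∀ i, CompleteSpace (H i)]
  rep : ∀ i, X →⋆ₐ[ℂ] (H i →L[ℂ] H i)
  bdd : ∀ x, BddAbove (Set.range fun i => ‖rep i x‖)

attribute [instance] RepFamily.normed RepFamily.inner RepFamily.complete

namespace RepFamily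

section Basic

variable {X : Type u} [Ring X] [StarRing X] [Algebra ℂ X] [StarModule ℂ X] (F : RepFamily X)

/-- `‖x‖ = sup ‖ρ(x)‖` over the representations `ρ` of the family. -/
def nrm (x : X) : ℝ := ⨆ i, ‖F.rep i x‖

lemma le_nrm (i : F.I) (x : X) : ‖F.rep i x‖ ≤ F.nrm x := le_ciSup (F.bdd x) i

lemma nrm_le {x : X} {M : ℝ} (hM : 0 ≤ M) (h : ∀ i, ‖F.rep i x‖ ≤ M) : F.nrm x ≤ M :=
  Real.iSup_le h hM

lemma nrm_nonneg (x : X) : 0 ≤ F.nrm x := Real.iSup_nonneg fun _ => norm_nonneg _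

lemma nrm_add (x y : X) : F.nrm (x + y) ≤ F.nrm x + F.nrm y :=
  F.nrm_le (add_nonneg (F.nrm_nonneg x) (F.nrm_nonneg y)) fun i => by
    rw [map_add]
    exact (norm_add_le _ _).trans (add_le_add (F.le_nrm i x) (F.le_nrm i y))

lemma nrm_mul (x y : X) : F.nrm (x * y) ≤ F.nrm x * F.nrm y :=
  F.nrm_le (mul_nonneg (F.nrm_nonneg x) (F.nrm_nonneg y)) fun i => by
    rw [map_mul]
    exact (norm_mul_le _ _).trans
      (mul_le_mul (F.le_nrm i x) (F.le_nrm i y) (norm_nonneg _) (F.nrm_nonneg x))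

lemma nrm_neg (x : X) : F.nrm (-x) = F.nrm x := by simp [nrm]

lemma nrm_star (x : X) : F.nrm (star x) = F.nrm x := by simp [nrm, map_star]

lemma nrm_zero : F.nrm 0 = 0 := by simp [nrm]

lemma nrm_smul (c : ℂ) (x : X) : F.nrm (c • x) = ‖c‖ * F.nrm x := by
  simp only [nrm, map_smul, norm_smul]
  exact (Real.mul_iSup_of_nonneg (norm_nonneg c) _).symm

lemma nrm_mul_self_le (x : X) : F.nrm x * F.nrm x ≤ F.nrm (star x * x) := by
  have h : F.nrm x ≤ Real.sqrt (F.nrm (star x * x)) :=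
    F.nrm_le (Real.sqrt_nonneg _) fun i => by
      refine Real.le_sqrt_of_sq_le ?_
      have := F.le_nrm i (star x * x)
      rwa [map_mul, map_star, CStarRing.norm_star_mul_self, ← sq] at this
  calc F.nrm x * F.nrm x ≤ Real.sqrt (F.nrm (star x * x)) * Real.sqrt (F.nrm (star x * x)) :=
        mul_le_mul h h (F.nrm_nonneg x) (Real.sqrt_nonneg _)
    _ = _ := Real.mul_self_sqrt (F.nrm_nonneg _)

/-- `X` with the seminorm `F.nrm`. -/
def Pre (_F : RepFamily X) : Type u := X

instance : Ring F.Pre := inferInstanceAs (Ring X)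
instance : StarRing F.Pre := inferInstanceAs (StarRing X)
instance : Algebra ℂ F.Pre := inferInstanceAs (Algebra ℂ X)
instance : StarModule ℂ F.Pre := inferInstanceAs (StarModule ℂ X)

instance : SeminormedAddCommGroup F.Pre :=
  AddGroupSeminorm.toSeminormedAddCommGroup
    { toFun := F.nrm
      map_zero' := F.nrm_zero
      add_le' := F.nrm_add
      neg' := F.nrm_neg }

lemma norm_pre (x : F.Pre) : ‖x‖ = F.nrm x := rfl

instance : SeminormedRing F.Pre :=
  { (inferInstance : SeminormedAddCommGroup F.Pre), (inferInstance : Ring F.Pre) with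
    norm_mul_le := F.nrm_mul }

instance : NormedAlgebra ℂ F.Pre where
  norm_smul_le c x := (F.nrm_smul c x).le

instance : NormedStarGroup F.Pre where
  norm_star_le x := (F.nrm_star x).le

/-- The C*-algebra obtained by separation and completion. -/
def Cstar : Type u := UniformSpace.Completion F.Pre

instance : NormedRing F.Cstar := inferInstanceAs (NormedRing (UniformSpace.Completion F.Pre))
instance : CompleteSpace F.Cstar :=
  inferInstanceAs (CompleteSpace (UniformSpace.Completion F.Pre))
instance : NormedSpace ℂ F.Cstar :=
  inferInstanceAs (NormedSpace ℂ (UniformSpace.Completion F.Pre))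
instance : Algebra ℂ F.Cstar := inferInstanceAs (Algebra ℂ (UniformSpace.Completion F.Pre))
instance : NormedAlgebra ℂ F.Cstar where
  norm_smul_le c x := norm_smul_le (α := ℂ) (β := UniformSpace.Completion F.Pre) c x

/-- The canonical map as a plain function. -/
def coe (x : X) : F.Cstar := UniformSpace.Completion.coe' (α := F.Pre) x

lemma coe_add (x y : X) : F.coe (x + y) = F.coe x + F.coe y :=
  UniformSpace.Completion.coe_add (α := F.Pre) x y
lemma coe_mul (x y : X) : F.coe (x * y) = F.coe x * F.coe y :=
  UniformSpace.Completion.coe_mul (α := F.Pre) x y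
lemma coe_one : F.coe 1 = 1 := UniformSpace.Completion.coe_one F.Pre
lemma coe_zero : F.coe 0 = 0 := UniformSpace.Completion.coe_zero (α := F.Pre)
lemma coe_smul (c : ℂ) (x : X) : F.coe (c • x) = c • F.coe x :=
  UniformSpace.Completion.coe_smul (M := ℂ) (X := F.Pre) c x
lemma norm_coe (x : X) : ‖F.coe x‖ = F.nrm x := UniformSpace.Completion.norm_coe (E := F.Pre) x
lemma denseRange_coe : DenseRange F.coe := UniformSpace.Completion.denseRange_coe (α := F.Pre)

instance : Star F.Cstar where
  star := UniformSpace.Completion.map (star : F.Pre → F.Pre)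

lemma star_coe (x : X) : star (F.coe x) = F.coe (star x) :=
  UniformSpace.Completion.map_coe (α := F.Pre) (β := F.Pre)
    (AddMonoidHomClass.uniformContinuous_of_bound (starAddEquiv : F.Pre ≃+ F.Pre) 1
      fun x => by simp) x

lemma continuous_star_cstar : Continuous (star : F.Cstar → F.Cstar) :=
  UniformSpace.Completion.continuous_map

lemma cstar_induction (p : F.Cstar → Prop) (x : F.Cstar) (hc : IsClosed {x | p x})
    (h : ∀ x, p (F.coe x)) : p x :=
  UniformSpace.Completion.induction_on (α := F.Pre) x hc h

lemma cstar_induction₂ (p : F.Cstar → F.Cstar → Prop) (x y : F.Cstar)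
    (hc : IsClosed {x : F.Cstar × F.Cstar | p x.1 x.2})
    (h : ∀ x y, p (F.coe x) (F.coe y)) : p x y :=
  UniformSpace.Completion.induction_on₂ (α := F.Pre) (β := F.Pre) x y hc h

instance : StarRing F.Cstar where
  star_involutive x := by
    refine F.cstar_induction (fun x => star (star x) = x) x (isClosed_eq
      (F.continuous_star_cstar.comp F.continuous_star_cstar) continuous_id) fun x => ?_
    rw [star_coe, star_coe, star_star]
  star_mul x y := by
    refine F.cstar_induction₂ (fun x y => star (x * y) = star y * star x) x y (isClosed_eq
      (F.continuous_star_cstar.comp (continuous_fst.mul continuous_snd))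
      ((F.continuous_star_cstar.comp continuous_snd).mul
        (F.continuous_star_cstar.comp continuous_fst))) fun x y => ?_
    rw [← coe_mul, star_coe, star_coe, star_coe, star_mul, coe_mul]
  star_add x y := by
    refine F.cstar_induction₂ (fun x y => star (x + y) = star x + star y) x y (isClosed_eq
      (F.continuous_star_cstar.comp (continuous_fst.add continuous_snd))
      ((F.continuous_star_cstar.comp continuous_fst).add
        (F.continuous_star_cstar.comp continuous_snd))) fun x y => ?_
    rw [← coe_add, star_coe, star_coe, star_coe, star_add, coe_add]

instance : StarModule ℂ F.Cstar where
  star_smul c x := by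
    refine F.cstar_induction (fun x => star (c • x) = star c • star x) x (isClosed_eq
      (F.continuous_star_cstar.comp (continuous_const_smul c))
      (F.continuous_star_cstar.const_smul (star c))) fun x => ?_
    rw [← coe_smul, star_coe, star_coe, star_smul, coe_smul]

instance : CStarRing F.Cstar where
  norm_mul_self_le x := by
    refine F.cstar_induction (fun x => ‖x‖ * ‖x‖ ≤ ‖star x * x‖) x (isClosed_le (continuous_norm.mul continuous_norm)
      (continuous_norm.comp (F.continuous_star_cstar.mul continuous_id))) fun x => ?_
    rw [star_coe, ← coe_mul, norm_coe, norm_coe]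
    exact F.nrm_mul_self_le x

instance : CStarAlgebra F.Cstar where

/-- The canonical `*`-homomorphism, with dense range, into the completion. -/
def of : X →⋆ₐ[ℂ] F.Cstar where
  toFun := F.coe
  map_one' := F.coe_one
  map_mul' := F.coe_mul
  map_zero' := F.coe_zero
  map_add' := F.coe_add
  commutes' r := by
    rw [Algebra.algebraMap_eq_smul_one, Algebra.algebraMap_eq_smul_one, coe_smul, coe_one]
  map_star' x := (F.star_coe x).symm

lemma norm_of (x : X) : ‖F.of x‖ = F.nrm x := F.norm_coe x
lemma denseRange_of : DenseRange F.of := F.denseRange_coe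

lemma induction (p : F.Cstar → Prop) (x : F.Cstar) (hc : IsClosed {x | p x})
    (h : ∀ x, p (F.of x)) : p x := F.cstar_induction p x hc h

lemma induction₂ (p : F.Cstar → F.Cstar → Prop) (x y : F.Cstar)
    (hc : IsClosed {x : F.Cstar × F.Cstar | p x.1 x.2})
    (h : ∀ x y, p (F.of x) (F.of y)) : p x y := F.cstar_induction₂ p x y hc h

variable {E : Type*} [CStarAlgebra E]

lemma continuous_starHom {D : Type*} [CStarAlgebra D] (f : D →⋆ₐ[ℂ] E) : Continuous f :=
  AddMonoidHomClass.continuous_of_bound f 1 fun x => by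
    simpa using NonUnitalStarAlgHom.norm_apply_le f x

/-- Underlying ring homomorphism of `f`, on `X` with the seminorm. -/
def preHom (f : X →⋆ₐ[ℂ] E) : F.Pre →+* E := f.toAlgHom.toRingHom

lemma continuous_preHom (f : X →⋆ₐ[ℂ] E) (hf : ∀ x, ‖f x‖ ≤ F.nrm x) :
    Continuous (F.preHom f) :=
  AddMonoidHomClass.continuous_of_bound (F.preHom f) 1 fun x => by
    rw [one_mul]; exact hf x

/-- The extension to the completion as a ring homomorphism. -/
def liftRing (f : X →⋆ₐ[ℂ] E) (hf : ∀ x, ‖f x‖ ≤ F.nrm x) : F.Cstar →+* E :=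
  UniformSpace.Completion.extensionHom (F.preHom f) (F.continuous_preHom f hf)

lemma liftRing_coe (f : X →⋆ₐ[ℂ] E) (hf : ∀ x, ‖f x‖ ≤ F.nrm x) (x : X) :
    F.liftRing f hf (F.coe x) = f x :=
  UniformSpace.Completion.extensionHom_coe (F.preHom f) (F.continuous_preHom f hf) x

lemma continuous_liftRing (f : X →⋆ₐ[ℂ] E) (hf : ∀ x, ‖f x‖ ≤ F.nrm x) :
    Continuous (F.liftRing f hf) :=
  UniformSpace.Completion.continuous_extension (α := F.Pre)

/-- A `*`-homomorphism `X → E` dominated by the seminorm extends to the completion. -/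
def lift (f : X →⋆ₐ[ℂ] E) (hf : ∀ x, ‖f x‖ ≤ F.nrm x) : F.Cstar →⋆ₐ[ℂ] E :=
  { F.liftRing f hf with
    commutes' := fun r => by
      have h : algebraMap ℂ F.Cstar r = F.coe (algebraMap ℂ X r) := (F.of.commutes r).symm
      rw [h]
      exact (F.liftRing_coe f hf _).trans (AlgHomClass.commutes f r)
    map_star' := fun x => by
      refine F.cstar_induction
        (fun x => F.liftRing f hf (star x) = star (F.liftRing f hf x)) x
        (isClosed_eq ((F.continuous_liftRing f hf).comp F.continuous_star_cstar)
        ((F.continuous_liftRing f hf).star)) fun x => ?_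
      rw [star_coe, liftRing_coe, liftRing_coe, map_star] }

@[simp] lemma lift_of (f : X →⋆ₐ[ℂ] E) (hf : ∀ x, ‖f x‖ ≤ F.nrm x) (x : X) :
    F.lift f hf (F.of x) = f x := F.liftRing_coe f hf x

lemma hom_ext {f g : F.Cstar →⋆ₐ[ℂ] E} (h : ∀ x, f (F.of x) = g (F.of x)) : f = g :=
  StarAlgHom.ext fun x => F.induction (fun x => f x = g x) x
    (isClosed_eq (continuous_starHom f) (continuous_starHom g)) h

/-- The extension of a representation of the family to the completion. -/
def ext (i : F.I) : F.Cstar →⋆ₐ[ℂ] (F.H i →L[ℂ] F.H i) := F.lift (F.rep i) (F.le_nrm i)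

lemma ext_of (i : F.I) (x : X) : F.ext i (F.of x) = F.rep i x := F.lift_of _ _ _

lemma norm_le {x : F.Cstar} {M : ℝ} (hM : 0 ≤ M) (h : ∀ i, ‖F.ext i x‖ ≤ M) : ‖x‖ ≤ M := by
  refine le_of_forall_pos_le_add fun ε hε => ?_
  obtain ⟨y, hy⟩ := F.denseRange_of.exists_dist_lt x (half_pos hε)
  rw [dist_eq_norm] at hy
  have h1 : F.nrm y ≤ M + ε / 2 := F.nrm_le (by positivity) fun i => by
    rw [← ext_of]
    have h2 : ‖F.ext i (x - F.of y)‖ ≤ ‖x - F.of y‖ := NonUnitalStarAlgHom.norm_apply_le _ _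
    calc ‖F.ext i (F.of y)‖ = ‖F.ext i x - F.ext i (x - F.of y)‖ := by rw [map_sub]; simp
      _ ≤ ‖F.ext i x‖ + ‖F.ext i (x - F.of y)‖ := norm_sub_le _ _
      _ ≤ M + ε / 2 := add_le_add (h i) (h2.trans hy.le)
  calc ‖x‖ = ‖(x - F.of y) + F.of y‖ := by simp
    _ ≤ ‖x - F.of y‖ + ‖F.of y‖ := norm_add_le _ _
    _ ≤ ε / 2 + (M + ε / 2) := add_le_add hy.le (by rw [norm_of]; exact h1)
    _ = M + ε := by ring

end Basic
end RepFamily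

section MinTensor

/-- A unital `*`-representation of a C*-algebra on a Hilbert space. -/
structure Repn (A : Type u) [CStarAlgebra A] where
  H : Type u
  [normed : NormedAddCommGroup H]
  [inner : InnerProductSpace ℂ H]
  [complete : CompleteSpace H]
  rep : A →⋆ₐ[ℂ] (H →L[ℂ] H)

attribute [instance] Repn.normed Repn.inner Repn.complete

lemma Repn.norm_rep_le {A : Type u} [CStarAlgebra A] (i : Repn A) (x : A) : ‖i.rep x‖ ≤ ‖x‖ :=
  NonUnitalStarAlgHom.norm_apply_le i.rep x

/-- All representations of a C*-algebra. -/
def allReps (A : Type u) [CStarAlgebra A] : RepFamily A where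
  I := Repn A
  H i := i.H
  rep i := i.rep
  bdd x := ⟨‖x‖, by
    rintro _ ⟨i, rfl⟩
    exact Repn.norm_rep_le (i : Repn A) x⟩

lemma nrm_allReps_le {A : Type u} [CStarAlgebra A] (x : A) : (allReps A).nrm x ≤ ‖x‖ :=
  (allReps A).nrm_le (norm_nonneg _) fun i => Repn.norm_rep_le (i : Repn A) x

lemma norm_ampL_le {H K : Type*} [NormedAddCommGroup H] [InnerProductSpace ℂ H] [CompleteSpace H]
    [NormedAddCommGroup K] [InnerProductSpace ℂ K] [CompleteSpace K] (S : H →L[ℂ] H) :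
    ‖ampL H K S‖ ≤ ‖S‖ := NonUnitalStarAlgHom.norm_apply_le (ampL H K) S

lemma norm_ampR_le {H K : Type*} [NormedAddCommGroup H] [InnerProductSpace ℂ H] [CompleteSpace H]
    [NormedAddCommGroup K] [InnerProductSpace ℂ K] [CompleteSpace K] (S : K →L[ℂ] K) :
    ‖ampR H K S‖ ≤ ‖S‖ := NonUnitalStarAlgHom.norm_apply_le (ampR H K) S

section
variable {H K : Type*} [NormedAddCommGroup H] [InnerProductSpace ℂ H] [CompleteSpace H]
    [NormedAddCommGroup K] [InnerProductSpace ℂ K] [CompleteSpace K]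
  {X Y : Type*} [Ring X] [StarRing X] [Algebra ℂ X] [StarModule ℂ X]
  [Ring Y] [StarRing Y] [Algebra ℂ Y] [StarModule ℂ Y]

lemma tensorRep_tmul (ρ : X →⋆ₐ[ℂ] (H →L[ℂ] H)) (σ : Y →⋆ₐ[ℂ] (K →L[ℂ] K)) (x : X) (y : Y) :
    tensorRep ρ σ (x ⊗ₜ y) = ampL H K (ρ x) * ampR H K (σ y) := starLift_tmul _ _ _ x y

lemma norm_tensorRep_tmul_le (ρ : X →⋆ₐ[ℂ] (H →L[ℂ] H)) (σ : Y →⋆ₐ[ℂ] (K →L[ℂ] K))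
    (x : X) (y : Y) : ‖tensorRep ρ σ (x ⊗ₜ y)‖ ≤ ‖ρ x‖ * ‖σ y‖ := by
  rw [tensorRep_tmul]
  exact (norm_mul_le (ampL H K (ρ x)) (ampR H K (σ y))).trans
    (mul_le_mul (norm_ampL_le (K := K) (ρ x)) (norm_ampR_le (H := H) (σ y))
      (norm_nonneg (ampR H K (σ y))) (norm_nonneg (ρ x)))
end

section
variable {H K : Type*} [NormedAddCommGroup H] [InnerProductSpace ℂ H] [CompleteSpace H]
    [NormedAddCommGroup K] [InnerProductSpace ℂ K] [CompleteSpace K]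
  {X Y X' Y' : Type*} [Ring X] [StarRing X] [Algebra ℂ X] [StarModule ℂ X]
  [Ring Y] [StarRing Y] [Algebra ℂ Y] [StarModule ℂ Y]
  [Ring X'] [StarRing X'] [Algebra ℂ X'] [StarModule ℂ X']
  [Ring Y'] [StarRing Y'] [Algebra ℂ Y'] [StarModule ℂ Y']

lemma tensorRep_starMap (ρ : X' →⋆ₐ[ℂ] (H →L[ℂ] H)) (σ : Y' →⋆ₐ[ℂ] (K →L[ℂ] K))
    (f : X →⋆ₐ[ℂ] X') (g : Y →⋆ₐ[ℂ] Y') (z : X ⊗[ℂ] Y) :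
    tensorRep ρ σ (starMap f g z) = tensorRep (ρ.comp f) (σ.comp g) z := by
  induction z using TensorProduct.induction_on with
  | zero => simp only [map_zero]
  | add x y hx hy => simp only [map_add, hx, hy]
  | tmul x y =>
    rw [starMap_tmul, tensorRep_tmul, tensorRep_tmul, StarAlgHom.comp_apply, StarAlgHom.comp_apply]
end

/-- The family of all `ρ ⊗ σ`, with `ρ` in `F` and `σ` in `G`. -/
def RepFamily.tensor {X Y : Type u} [Ring X] [StarRing X] [Algebra ℂ X] [StarModule ℂ X]
    [Ring Y] [StarRing Y] [Algebra ℂ Y] [StarModule ℂ Y] (F : RepFamily X) (G : RepFamily Y) :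
    RepFamily (X ⊗[ℂ] Y) where
  I := F.I × G.I
  H i := HTensor (F.H i.1) (G.H i.2)
  rep i := tensorRep (F.rep i.1) (G.rep i.2)
  bdd x := by
    induction x using TensorProduct.induction_on with
    | zero => exact ⟨0, by rintro _ ⟨i, rfl⟩; simp⟩
    | add x y hx hy =>
      obtain ⟨M, hM⟩ := hx
      obtain ⟨N, hN⟩ := hy
      refine ⟨M + N, ?_⟩
      rintro _ ⟨i, rfl⟩
      simp only [map_add]
      exact (norm_add_le _ _).trans (add_le_add (hM ⟨i, rfl⟩) (hN ⟨i, rfl⟩))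
    | tmul x y =>
      refine ⟨F.nrm x * G.nrm y, ?_⟩
      rintro _ ⟨i, rfl⟩
      exact (norm_tensorRep_tmul_le _ _ x y).trans
        (mul_le_mul (F.le_nrm _ _) (G.le_nrm _ _) (norm_nonneg _) (F.nrm_nonneg _))

/-- The spatial family on `A ⊗ B`: all `ρ ⊗ σ`. -/
def spatial (A B : Type u) [CStarAlgebra A] [CStarAlgebra B] : RepFamily (A ⊗[ℂ] B) :=
  (allReps A).tensor (allReps B)

/-- The spatial family on `A ⊗ B ⊗ C`: all `ρ ⊗ σ ⊗ τ`. -/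
def spatial₃ (A B C : Type u) [CStarAlgebra A] [CStarAlgebra B] [CStarAlgebra C] :
    RepFamily ((A ⊗[ℂ] B) ⊗[ℂ] C) :=
  (spatial A B).tensor (allReps C)

/-- The minimal (spatial) C*-tensor product of two unital C*-algebras: the completion of the
algebraic tensor product for `‖x‖ = sup ‖(ρ ⊗ σ)(x)‖`, the supremum being over all
representations `ρ` of `A` and `σ` of `B` on Hilbert spaces. -/
def MinTensor (A B : Type u) [CStarAlgebra A] [CStarAlgebra B] : Type u := (spatial A B).Cstar

instance (A B : Type u) [CStarAlgebra A] [CStarAlgebra B] : CStarAlgebra (MinTensor A B) :=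
  inferInstanceAs (CStarAlgebra (spatial A B).Cstar)

/-- The minimal (spatial) C*-tensor product of three unital C*-algebras. -/
def MinTensor₃ (A B C : Type u) [CStarAlgebra A] [CStarAlgebra B] [CStarAlgebra C] : Type u :=
  (spatial₃ A B C).Cstar

instance (A B C : Type u) [CStarAlgebra A] [CStarAlgebra B] [CStarAlgebra C] :
    CStarAlgebra (MinTensor₃ A B C) :=
  inferInstanceAs (CStarAlgebra (spatial₃ A B C).Cstar)

variable {A B C A' B' C' : Type u} [CStarAlgebra A] [CStarAlgebra B] [CStarAlgebra C]
  [CStarAlgebra A'] [CStarAlgebra B'] [CStarAlgebra C']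

namespace MinTensor

/-- The canonical map `A ⊗ B → A ⊗_min B`. -/
def of (A B : Type u) [CStarAlgebra A] [CStarAlgebra B] : A ⊗[ℂ] B →⋆ₐ[ℂ] MinTensor A B :=
  (spatial A B).of

/-- `a ↦ a ⊗ 1` -/
def left (A B : Type u) [CStarAlgebra A] [CStarAlgebra B] : A →⋆ₐ[ℂ] MinTensor A B :=
  (of A B).comp (inclL A B)

/-- `b ↦ 1 ⊗ b` -/
def right (A B : Type u) [CStarAlgebra A] [CStarAlgebra B] : B →⋆ₐ[ℂ] MinTensor A B :=
  (of A B).comp (inclR A B)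

lemma norm_of (x : A ⊗[ℂ] B) : ‖of A B x‖ = (spatial A B).nrm x := (spatial A B).norm_of x

lemma hom_ext {E : Type*} [CStarAlgebra E] {f g : MinTensor A B →⋆ₐ[ℂ] E}
    (h : ∀ a b, f (of A B (a ⊗ₜ b)) = g (of A B (a ⊗ₜ b))) : f = g := by
  refine (spatial A B).hom_ext fun x => ?_
  have : f.comp (of A B) = g.comp (of A B) := starHom_ext h
  exact DFunLike.congr_fun this x

lemma nrm_le {x : A ⊗[ℂ] B} {M : ℝ} (hM : 0 ≤ M)
    (h : ∀ (i : Repn A) (j : Repn B), ‖tensorRep i.rep j.rep x‖ ≤ M) : (spatial A B).nrm x ≤ M :=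
  (spatial A B).nrm_le hM fun i => h i.1 i.2

lemma le_nrm (x : A ⊗[ℂ] B) (i : Repn A) (j : Repn B) :
    ‖tensorRep i.rep j.rep x‖ ≤ (spatial A B).nrm x :=
  (spatial A B).le_nrm (i, j) x

lemma nrm_starMap_le (f : A →⋆ₐ[ℂ] A') (g : B →⋆ₐ[ℂ] B') (x : A ⊗[ℂ] B) :
    (spatial A' B').nrm (starMap f g x) ≤ (spatial A B).nrm x := by
  refine nrm_le ((spatial A B).nrm_nonneg x) fun i j => ?_
  rw [tensorRep_starMap]
  exact le_nrm x ⟨i.H, i.rep.comp f⟩ ⟨j.H, j.rep.comp g⟩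

/-- The tensor product `ρ ⊗ σ` of two representations, on `A ⊗_min B`. -/
def rep (i : Repn A) (j : Repn B) :
    MinTensor A B →⋆ₐ[ℂ] (HTensor i.H j.H →L[ℂ] HTensor i.H j.H) :=
  (spatial A B).ext (i, j)

lemma rep_of (i : Repn A) (j : Repn B) (x : A ⊗[ℂ] B) :
    rep i j (of A B x) = tensorRep i.rep j.rep x :=
  (spatial A B).ext_of (i, j) x

/-- The tensor product of two representations as a representation. -/
def repn (i : Repn A) (j : Repn B) : Repn (MinTensor A B) := ⟨HTensor i.H j.H, rep i j⟩

/-- `f ⊗ g` on minimal tensor products. -/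
def map (f : A →⋆ₐ[ℂ] A') (g : B →⋆ₐ[ℂ] B') : MinTensor A B →⋆ₐ[ℂ] MinTensor A' B' :=
  (spatial A B).lift ((of A' B').comp (starMap f g)) fun x => by
    rw [StarAlgHom.comp_apply, norm_of]
    exact nrm_starMap_le f g x

@[simp] lemma map_of (f : A →⋆ₐ[ℂ] A') (g : B →⋆ₐ[ℂ] B') (x : A ⊗[ℂ] B) :
    map f g (of A B x) = of A' B' (starMap f g x) :=
  (spatial A B).lift_of _ _ x

end MinTensor

namespace MinTensor₃

/-- The canonical map `A ⊗ B ⊗ C → A ⊗_min B ⊗_min C`. -/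
def of (A B C : Type u) [CStarAlgebra A] [CStarAlgebra B] [CStarAlgebra C] :
    (A ⊗[ℂ] B) ⊗[ℂ] C →⋆ₐ[ℂ] MinTensor₃ A B C :=
  (spatial₃ A B C).of

/-- The tensor product `ρ ⊗ σ ⊗ τ` of three representations, on `A ⊗_min B ⊗_min C`. -/
def rep (i : Repn A) (j : Repn B) (k : Repn C) :
    MinTensor₃ A B C →⋆ₐ[ℂ] (HTensor (HTensor i.H j.H) k.H →L[ℂ] HTensor (HTensor i.H j.H) k.H) :=
  (spatial₃ A B C).ext ((i, j), k)

lemma rep_of (i : Repn A) (j : Repn B) (k : Repn C) (x : (A ⊗[ℂ] B) ⊗[ℂ] C) :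
    rep i j k (of A B C x) = tensorRep (tensorRep i.rep j.rep) k.rep x :=
  (spatial₃ A B C).ext_of ((i, j), k) x

lemma norm_le {x : MinTensor₃ A B C} {M : ℝ} (hM : 0 ≤ M)
    (h : ∀ (i : Repn A) (j : Repn B) (k : Repn C), ‖rep i j k x‖ ≤ M) : ‖x‖ ≤ M :=
  (spatial₃ A B C).norm_le hM fun i => h i.1.1 i.1.2 i.2

lemma nrm_tmul_le {X Y : Type u} [Ring X] [StarRing X] [Algebra ℂ X] [StarModule ℂ X]
    [Ring Y] [StarRing Y] [Algebra ℂ Y] [StarModule ℂ Y] (F : RepFamily X) (G : RepFamily Y)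
    (x : X) (y : Y) : (F.tensor G).nrm (x ⊗ₜ y) ≤ F.nrm x * G.nrm y :=
  (F.tensor G).nrm_le (mul_nonneg (F.nrm_nonneg x) (G.nrm_nonneg y)) fun _ =>
    (norm_tensorRep_tmul_le _ _ x y).trans
      (mul_le_mul (F.le_nrm _ _) (G.le_nrm _ _) (norm_nonneg _) (F.nrm_nonneg _))

lemma nrm_one_le {X : Type u} [Ring X] [StarRing X] [Algebra ℂ X] [StarModule ℂ X]
    (F : RepFamily X) : F.nrm 1 ≤ 1 :=
  F.nrm_le zero_le_one fun i => by rw [map_one]; exact ContinuousLinearMap.norm_id_le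

/-- `x ↦ x ⊗ 1`, from `A ⊗_min B` to `A ⊗_min B ⊗_min C` -/
def leg12 (A B C : Type u) [CStarAlgebra A] [CStarAlgebra B] [CStarAlgebra C] :
    MinTensor A B →⋆ₐ[ℂ] MinTensor₃ A B C :=
  (spatial A B).lift ((of A B C).comp (inclL (A ⊗[ℂ] B) C)) fun x => by
    refine ((spatial₃ A B C).norm_of _).le.trans ?_
    refine (nrm_tmul_le (spatial A B) (allReps C) x 1).trans ?_
    exact (mul_le_mul_of_nonneg_left (nrm_one_le _) ((spatial A B).nrm_nonneg x)).trans
      (mul_one _).le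

/-- `c ↦ 1 ⊗ 1 ⊗ c` -/
def leg3 (A B C : Type u) [CStarAlgebra A] [CStarAlgebra B] [CStarAlgebra C] :
    C →⋆ₐ[ℂ] MinTensor₃ A B C :=
  (of A B C).comp (inclR (A ⊗[ℂ] B) C)

/-- `a ↦ a ⊗ 1 ⊗ 1` -/
def leg1 (A B C : Type u) [CStarAlgebra A] [CStarAlgebra B] [CStarAlgebra C] :
    A →⋆ₐ[ℂ] MinTensor₃ A B C :=
  (of A B C).comp ((inclL (A ⊗[ℂ] B) C).comp (inclL A B))

lemma nrm_le {x : (A ⊗[ℂ] B) ⊗[ℂ] C} {M : ℝ} (hM : 0 ≤ M)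
    (h : ∀ (i : Repn A) (j : Repn B) (k : Repn C),
      ‖tensorRep (tensorRep i.rep j.rep) k.rep x‖ ≤ M) : (spatial₃ A B C).nrm x ≤ M :=
  (spatial₃ A B C).nrm_le hM fun i => h i.1.1 i.1.2 i.2

lemma starMap_inclR_le (x : B ⊗[ℂ] C) :
    (spatial₃ A B C).nrm (starMap (inclR A B) (StarAlgHom.id ℂ C) x) ≤ (spatial B C).nrm x := by
  refine nrm_le ((spatial B C).nrm_nonneg x) fun i j k => ?_
  rw [tensorRep_starMap]
  exact MinTensor.le_nrm x ⟨HTensor i.H j.H, (tensorRep i.rep j.rep).comp (inclR A B)⟩ k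

/-- `x ↦ 1 ⊗ x`, from `B ⊗_min C` to `A ⊗_min B ⊗_min C` -/
def leg23 (A B C : Type u) [CStarAlgebra A] [CStarAlgebra B] [CStarAlgebra C] :
    MinTensor B C →⋆ₐ[ℂ] MinTensor₃ A B C :=
  (spatial B C).lift ((of A B C).comp (starMap (inclR A B) (StarAlgHom.id ℂ C))) fun x => by
    refine ((spatial₃ A B C).norm_of _).le.trans ?_
    exact starMap_inclR_le x


lemma leg12_of (x : A ⊗[ℂ] B) : leg12 A B C (MinTensor.of A B x) = of A B C (x ⊗ₜ 1) :=
  (spatial A B).lift_of _ _ x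

lemma leg23_of (b : B) (c : C) :
    leg23 A B C (MinTensor.of B C (b ⊗ₜ c)) = of A B C ((1 ⊗ₜ b) ⊗ₜ c) :=
  ((spatial B C).lift_of _ _ (b ⊗ₜ c)).trans (by
    rw [StarAlgHom.comp_apply, starMap_tmul]; rfl)

lemma leg3_apply (c : C) : leg3 A B C c = of A B C (1 ⊗ₜ c) := rfl
lemma leg1_apply (a : A) : leg1 A B C a = of A B C ((a ⊗ₜ 1) ⊗ₜ 1) := rfl

lemma commute_leg12_leg3 (x : MinTensor A B) (c : C) :
    Commute (leg12 A B C x) (leg3 A B C c) := by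
  refine (spatial A B).induction
    (fun x => leg12 A B C x * leg3 A B C c = leg3 A B C c * leg12 A B C x) x
    (isClosed_eq ?_ ?_) fun x => ?_
  · exact (RepFamily.continuous_starHom (leg12 A B C)).mul continuous_const
  · exact continuous_const.mul (RepFamily.continuous_starHom (leg12 A B C))
  · change leg12 A B C (MinTensor.of A B x) * _ = _ * leg12 A B C (MinTensor.of A B x)
    rw [leg12_of, leg3_apply, ← map_mul, ← map_mul]
    simp

lemma commute_leg1_leg23 (a : A) (x : MinTensor B C) :
    Commute (leg1 A B C a) (leg23 A B C x) := by
  refine (spatial B C).induction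
    (fun x => leg1 A B C a * leg23 A B C x = leg23 A B C x * leg1 A B C a) x
    (isClosed_eq ?_ ?_) fun x => ?_
  · exact continuous_const.mul (RepFamily.continuous_starHom (leg23 A B C))
  · exact (RepFamily.continuous_starHom (leg23 A B C)).mul continuous_const
  · change _ * leg23 A B C (MinTensor.of B C x) = leg23 A B C (MinTensor.of B C x) * _
    induction x using TensorProduct.induction_on with
    | zero => simp
    | add x y hx hy => simp only [map_add, mul_add, add_mul, hx, hy]
    | tmul b c =>
      rw [leg23_of, leg1_apply, ← map_mul, ← map_mul]
      simp

lemma rep_leg12 (i : Repn A) (j : Repn B) (k : Repn C) (x : MinTensor A B) :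
    rep i j k (leg12 A B C x) = ampL (HTensor i.H j.H) k.H (MinTensor.rep i j x) := by
  refine (spatial A B).induction (fun x => rep i j k (leg12 A B C x) =
    ampL (HTensor i.H j.H) k.H (MinTensor.rep i j x)) x (isClosed_eq ?_ ?_) fun x => ?_
  · exact (RepFamily.continuous_starHom (rep i j k)).comp
      (RepFamily.continuous_starHom (leg12 A B C))
  · exact (RepFamily.continuous_starHom (ampL (HTensor i.H j.H) k.H)).comp
      (RepFamily.continuous_starHom (MinTensor.rep i j))
  · change rep i j k (leg12 A B C (MinTensor.of A B x)) =
        ampL (HTensor i.H j.H) k.H (MinTensor.rep i j (MinTensor.of A B x))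
    rw [leg12_of, rep_of, MinTensor.rep_of, tensorRep_tmul, map_one, map_one, mul_one]

lemma rep_leg3 (i : Repn A) (j : Repn B) (k : Repn C) (c : C) :
    rep i j k (leg3 A B C c) = ampR (HTensor i.H j.H) k.H (k.rep c) := by
  rw [leg3_apply, rep_of, tensorRep_tmul, map_one, map_one, one_mul]

/-- `x ⊗ c ↦ x ⊗ c` on the algebraic tensor product `(A ⊗_min B) ⊗ C`. -/
def preL (A B C : Type u) [CStarAlgebra A] [CStarAlgebra B] [CStarAlgebra C] :
    MinTensor A B ⊗[ℂ] C →⋆ₐ[ℂ] MinTensor₃ A B C :=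
  starLift (leg12 A B C) (leg3 A B C) commute_leg12_leg3

lemma preL_tmul (x : MinTensor A B) (c : C) :
    preL A B C (x ⊗ₜ c) = leg12 A B C x * leg3 A B C c := starLift_tmul _ _ _ x c

lemma rep_preL (i : Repn A) (j : Repn B) (k : Repn C) (z : MinTensor A B ⊗[ℂ] C) :
    rep i j k (preL A B C z) = tensorRep (MinTensor.rep i j) k.rep z := by
  induction z using TensorProduct.induction_on with
  | zero => simp only [map_zero]
  | add x y hx hy => simp only [map_add, hx, hy]
  | tmul x c => rw [preL_tmul, map_mul, rep_leg12, rep_leg3, tensorRep_tmul]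

lemma norm_preL_le (z : MinTensor A B ⊗[ℂ] C) :
    ‖preL A B C z‖ ≤ (spatial (MinTensor A B) C).nrm z := by
  refine norm_le ((spatial (MinTensor A B) C).nrm_nonneg z) fun i j k => ?_
  rw [rep_preL]
  exact MinTensor.le_nrm z (MinTensor.repn i j) k

/-- The canonical identification `(A ⊗_min B) ⊗_min C → A ⊗_min B ⊗_min C`. -/
def assocL (A B C : Type u) [CStarAlgebra A] [CStarAlgebra B] [CStarAlgebra C] :
    MinTensor (MinTensor A B) C →⋆ₐ[ℂ] MinTensor₃ A B C :=
  (spatial (MinTensor A B) C).lift (preL A B C) norm_preL_le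

lemma assocL_of (x : MinTensor A B) (c : C) :
    assocL A B C (MinTensor.of _ _ (x ⊗ₜ c)) = leg12 A B C x * leg3 A B C c :=
  ((spatial (MinTensor A B) C).lift_of _ _ _).trans (preL_tmul x c)

section extend
variable {E F G : Type*} [NormedAddCommGroup E] [Module ℂ E]
    [NormedAddCommGroup F] [InnerProductSpace ℂ F] [NormedAddCommGroup G] [InnerProductSpace ℂ G]
    [CompleteSpace G]

/-- The extension of the isometry `f` along the isometry `e` with dense range. -/
def isoExtend (e : E →ₗᵢ[ℂ] F) (f : E →ₗᵢ[ℂ] G) : F →L[ℂ] G :=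
  f.toContinuousLinearMap.extend e.toContinuousLinearMap

lemma isoExtend_apply (e : E →ₗᵢ[ℂ] F) (f : E →ₗᵢ[ℂ] G) (hd : DenseRange e) (x : E) :
    isoExtend e f (e x) = f x :=
  ContinuousLinearMap.extend_eq (e := e.toContinuousLinearMap) f.toContinuousLinearMap hd
    e.isometry.isUniformInducing x
end extend

section assoc
variable (H K L : Type*) [NormedAddCommGroup H] [InnerProductSpace ℂ H] [CompleteSpace H]
    [NormedAddCommGroup K] [InnerProductSpace ℂ K] [CompleteSpace K]
    [NormedAddCommGroup L] [InnerProductSpace ℂ L] [CompleteSpace L]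

/-- `H ⊗ K ⊗ L` inside the Hilbert space `(H ⊗ K) ⊗ L`. -/
def embL : (H ⊗[ℂ] K) ⊗[ℂ] L →ₗᵢ[ℂ] HTensor (HTensor H K) L :=
  (HTensor.mk (HTensor H K) L).comp
    (TensorProduct.mapIsometry (HTensor.mk H K) LinearIsometry.id)

/-- `H ⊗ K ⊗ L` inside the Hilbert space `H ⊗ (K ⊗ L)`. -/
def embR : (H ⊗[ℂ] K) ⊗[ℂ] L →ₗᵢ[ℂ] HTensor H (HTensor K L) :=
  (HTensor.mk H (HTensor K L)).comp
    ((TensorProduct.mapIsometry LinearIsometry.id (HTensor.mk K L)).comp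
      (TensorProduct.assocIsometry ℂ H K L).toLinearIsometry)

lemma embL_tmul (x : H ⊗[ℂ] K) (l : L) :
    embL H K L (x ⊗ₜ l) = HTensor.mk _ _ (HTensor.mk H K x ⊗ₜ l) := rfl

lemma embR_tmul (h : H) (k : K) (l : L) :
    embR H K L ((h ⊗ₜ k) ⊗ₜ l) = HTensor.mk _ _ (h ⊗ₜ HTensor.mk K L (k ⊗ₜ l)) := rfl

lemma mk_mem_closure_embL (x : HTensor H K ⊗[ℂ] L) :
    HTensor.mk _ _ x ∈ (LinearMap.range (embL H K L).toLinearMap).topologicalClosure := by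
  induction x using TensorProduct.induction_on with
  | zero => rw [map_zero]; exact zero_mem _
  | add x y hx hy => rw [map_add]; exact add_mem hx hy
  | tmul x l =>
    refine (HTensor.denseRange_mk H K).induction_on (p := fun x =>
      HTensor.mk (HTensor H K) L (x ⊗ₜ l) ∈
        (LinearMap.range (embL H K L).toLinearMap).topologicalClosure) x ?_ fun x => ?_
    · exact (Submodule.isClosed_topologicalClosure _).preimage
        ((HTensor.mk (HTensor H K) L).continuous.comp
          (TensorProduct.continuous_tmul.comp (continuous_id.prodMk continuous_const)))
    · exact Submodule.le_topologicalClosure _ ⟨x ⊗ₜ l, rfl⟩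

lemma denseRange_embL : DenseRange (embL H K L) := fun y =>
  closure_minimal (Set.range_subset_iff.2 (mk_mem_closure_embL H K L)) isClosed_closure
    (HTensor.denseRange_mk (HTensor H K) L y)

/-- The canonical isometry `(H ⊗ K) ⊗ L → H ⊗ (K ⊗ L)`. -/
def hassoc : HTensor (HTensor H K) L →L[ℂ] HTensor H (HTensor K L) :=
  isoExtend (E := (H ⊗[ℂ] K) ⊗[ℂ] L) (embL H K L) (embR H K L)

set_option maxHeartbeats 4000000 in
lemma hassoc_embL (x : (H ⊗[ℂ] K) ⊗[ℂ] L) : hassoc H K L (embL H K L x) = embR H K L x := by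
  rw [hassoc, isoExtend_apply (E := (H ⊗[ℂ] K) ⊗[ℂ] L)]
  exact denseRange_embL H K L

lemma norm_hassoc (x : HTensor (HTensor H K) L) : ‖hassoc H K L x‖ = ‖x‖ := by
  refine (denseRange_embL H K L).induction_on
    (p := fun x => ‖hassoc H K L x‖ = ‖x‖) x
    (isClosed_eq (hassoc H K L).continuous.norm continuous_norm) fun x => ?_
  rw [hassoc_embL, LinearIsometry.norm_map, LinearIsometry.norm_map]

lemma hassoc_ext {W : Type*} [NormedAddCommGroup W] [NormedSpace ℂ W]
    {f g : HTensor (HTensor H K) L →L[ℂ] W}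
    (h : ∀ x k l, f (embL H K L ((x ⊗ₜ k) ⊗ₜ l)) = g (embL H K L ((x ⊗ₜ k) ⊗ₜ l))) : f = g := by
  have h2 : f.toLinearMap ∘ₗ (embL H K L).toLinearMap = g.toLinearMap ∘ₗ (embL H K L).toLinearMap :=
    TensorProduct.ext_threefold h
  ext x
  exact (denseRange_embL H K L).induction_on (p := fun x => f x = g x) x
    (isClosed_eq f.continuous g.continuous) fun x => LinearMap.congr_fun h2 x

end assoc

lemma hassoc_leg1 (i : Repn A) (j : Repn B) (k : Repn C) (a : A) :
    hassoc i.H j.H k.H ∘L rep i j k (leg1 A B C a)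
      = ampL i.H (HTensor j.H k.H) (i.rep a) ∘L hassoc i.H j.H k.H := by
  refine hassoc_ext _ _ _ fun x y z => ?_
  rw [leg1_apply, rep_of, tensorRep_tmul, tensorRep_tmul, map_one, map_one, map_one, map_one,
    mul_one, mul_one, ContinuousLinearMap.comp_apply, ContinuousLinearMap.comp_apply, hassoc_embL,
    embR_tmul, embL_tmul, ampL_mk, ampL_mk, ampL_mk, ← embL_tmul, hassoc_embL, embR_tmul]

lemma hassoc_leg23 (i : Repn A) (j : Repn B) (k : Repn C) (x : MinTensor B C) :
    hassoc i.H j.H k.H ∘L rep i j k (leg23 A B C x)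
      = ampR i.H (HTensor j.H k.H) (MinTensor.rep j k x) ∘L hassoc i.H j.H k.H := by
  refine (spatial B C).induction (fun x => hassoc i.H j.H k.H ∘L rep i j k (leg23 A B C x)
      = ampR i.H (HTensor j.H k.H) (MinTensor.rep j k x) ∘L hassoc i.H j.H k.H) x
      (isClosed_eq ?_ ?_) fun x => ?_
  · exact continuous_const.clm_comp ((RepFamily.continuous_starHom (rep i j k)).comp
      (RepFamily.continuous_starHom (leg23 A B C)))
  · exact ((RepFamily.continuous_starHom (ampR i.H (HTensor j.H k.H))).comp
      (RepFamily.continuous_starHom (MinTensor.rep j k))).clm_comp continuous_const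
  · change hassoc i.H j.H k.H ∘L rep i j k (leg23 A B C (MinTensor.of B C x))
      = ampR i.H (HTensor j.H k.H) (MinTensor.rep j k (MinTensor.of B C x)) ∘L _
    induction x using TensorProduct.induction_on with
    | zero => simp
    | add x y hx hy =>
      simp only [map_add, ContinuousLinearMap.comp_add, ContinuousLinearMap.add_comp, hx, hy]
    | tmul b c =>
      refine hassoc_ext _ _ _ fun x y z => ?_
      rw [leg23_of, rep_of, MinTensor.rep_of, tensorRep_tmul, tensorRep_tmul, tensorRep_tmul,
        map_one, map_one, one_mul, ContinuousLinearMap.comp_apply, ContinuousLinearMap.comp_apply,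
        hassoc_embL, embR_tmul, embL_tmul, ampR_mk, mul_apply_eq_comp, mul_apply_eq_comp, ampR_mk,
        ampR_mk, ampL_mk, ampL_mk, ampR_mk, ← embL_tmul, hassoc_embL, embR_tmul]

/-- `a ⊗ x ↦ a ⊗ x` on the algebraic tensor product `A ⊗ (B ⊗_min C)`. -/
def preR (A B C : Type u) [CStarAlgebra A] [CStarAlgebra B] [CStarAlgebra C] :
    A ⊗[ℂ] MinTensor B C →⋆ₐ[ℂ] MinTensor₃ A B C :=
  starLift (leg1 A B C) (leg23 A B C) commute_leg1_leg23

lemma preR_tmul (a : A) (x : MinTensor B C) :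
    preR A B C (a ⊗ₜ x) = leg1 A B C a * leg23 A B C x := starLift_tmul _ _ _ a x

lemma hassoc_preR (i : Repn A) (j : Repn B) (k : Repn C) (z : A ⊗[ℂ] MinTensor B C) :
    hassoc i.H j.H k.H ∘L rep i j k (preR A B C z)
      = tensorRep i.rep (MinTensor.rep j k) z ∘L hassoc i.H j.H k.H := by
  induction z using TensorProduct.induction_on with
  | zero => simp only [map_zero, ContinuousLinearMap.comp_zero, ContinuousLinearMap.zero_comp]
  | add x y hx hy =>
    simp only [map_add, ContinuousLinearMap.comp_add, ContinuousLinearMap.add_comp, hx, hy]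
  | tmul a x =>
    rw [preR_tmul, map_mul, ContinuousLinearMap.mul_def, ← ContinuousLinearMap.comp_assoc,
      hassoc_leg1, ContinuousLinearMap.comp_assoc, hassoc_leg23, tensorRep_tmul,
      ContinuousLinearMap.mul_def, ContinuousLinearMap.comp_assoc]

lemma norm_preR_le (z : A ⊗[ℂ] MinTensor B C) :
    ‖preR A B C z‖ ≤ (spatial A (MinTensor B C)).nrm z := by
  refine norm_le ((spatial A (MinTensor B C)).nrm_nonneg z) fun i j k => ?_
  refine ContinuousLinearMap.opNorm_le_bound _ ((spatial _ _).nrm_nonneg z) fun v => ?_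
  have h2 := DFunLike.congr_fun (hassoc_preR i j k z) v
  rw [ContinuousLinearMap.comp_apply, ContinuousLinearMap.comp_apply] at h2
  rw [← norm_hassoc, h2, ← norm_hassoc _ _ _ v]
  refine (ContinuousLinearMap.le_opNorm _ _).trans ?_
  exact mul_le_mul_of_nonneg_right (MinTensor.le_nrm z i (MinTensor.repn j k)) (norm_nonneg _)

/-- The canonical identification `A ⊗_min (B ⊗_min C) → A ⊗_min B ⊗_min C`. -/
def assocR (A B C : Type u) [CStarAlgebra A] [CStarAlgebra B] [CStarAlgebra C] :
    MinTensor A (MinTensor B C) →⋆ₐ[ℂ] MinTensor₃ A B C :=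
  (spatial A (MinTensor B C)).lift (preR A B C) norm_preR_le

lemma assocR_of (a : A) (x : MinTensor B C) :
    assocR A B C (MinTensor.of _ _ (a ⊗ₜ x)) = leg1 A B C a * leg23 A B C x :=
  ((spatial A (MinTensor B C)).lift_of _ _ _).trans (preR_tmul a x)

end MinTensor₃
end MinTensor

/-! ### Compact quantum groups, quantum subgroups, actions -/

/-- A compact quantum group: a unital C*-algebra `A = C(𝔾)` (nonzero) with a unital
`*`-homomorphism `Δ : A → A ⊗ A` that is coassociative and satisfies the density conditions. -/
structure CompactQuantumGroup (A : Type u) [CStarAlgebra A] where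
  nontrivial : Nontrivial A
  /-- the comultiplication `Δ` -/
  comul : A →⋆ₐ[ℂ] MinTensor A A
  /-- `(Δ ⊗ id) Δ = (id ⊗ Δ) Δ` -/
  coassoc : ∀ a, MinTensor₃.assocL A A A (MinTensor.map comul (StarAlgHom.id ℂ A) (comul a)) =
    MinTensor₃.assocR A A A (MinTensor.map (StarAlgHom.id ℂ A) comul (comul a))
  /-- the span of `Δ(A)(1 ⊗ A)` is dense -/
  dense_right : Dense (Submodule.span ℂ
    {x : MinTensor A A | ∃ a b, x = comul a * MinTensor.right A A b} : Set (MinTensor A A))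
  /-- the span of `Δ(A)(A ⊗ 1)` is dense -/
  dense_left : Dense (Submodule.span ℂ
    {x : MinTensor A A | ∃ a b, x = comul a * MinTensor.left A A b} : Set (MinTensor A A))

/-- `ℍ` is a compact quantum subgroup of `𝔾`: a surjective `*`-homomorphism `π : C(𝔾) → C(ℍ)` with
`Δ ∘ π = (π ⊗ π) ∘ Δ`. -/
structure QuantumSubgroup {A A' : Type u} [CStarAlgebra A] [CStarAlgebra A']
    (G : CompactQuantumGroup A) (H : CompactQuantumGroup A') where
  π : A →⋆ₐ[ℂ] A'
  surjective : Function.Surjective π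
  comul_π : ∀ a, H.comul (π a) = MinTensor.map π π (G.comul a)

/-- A continuous action of a compact quantum group on a unital C*-algebra `B`. -/
structure Action {A : Type u} [CStarAlgebra A] (G : CompactQuantumGroup A)
    (B : Type u) [CStarAlgebra B] where
  /-- the coaction `α : B → B ⊗ C(𝔾)` -/
  hom : B →⋆ₐ[ℂ] MinTensor B A
  /-- `(α ⊗ id) α = (id ⊗ Δ) α` -/
  coassoc : ∀ b, MinTensor₃.assocL B A A (MinTensor.map hom (StarAlgHom.id ℂ A) (hom b)) =
    MinTensor₃.assocR B A A (MinTensor.map (StarAlgHom.id ℂ B) G.comul (hom b))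
  /-- the span of `(1 ⊗ C(𝔾)) α(B)` is dense -/
  dense : Dense (Submodule.span ℂ
    {x : MinTensor B A | ∃ a b, x = MinTensor.right B A a * hom b} : Set (MinTensor B A))

/-- A coaction map `S → S ⊗ A` of a C*-algebra `A` on a C*-algebra `S`, where the values are
allowed to lie in a C*-algebra `E` in which `S ⊗ A` is embedded by `incl`. This is the part of the
data of an action that enters into fixed points and into morphism spaces. -/
structure Coaction (A : Type u) [CStarAlgebra A] (S : Type u) [CStarAlgebra S] where
  E : Type u
  [alg : CStarAlgebra E]
  /-- the canonical map `S ⊗ A → E` -/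
  incl : MinTensor S A →⋆ₐ[ℂ] E
  /-- the coaction map -/
  map : S →⋆ₐ[ℂ] E

attribute [instance] Coaction.alg

/-- The coaction map `α : B → B ⊗ C(𝔾)` of an action. -/
def Action.coaction {A : Type u} [CStarAlgebra A] {G : CompactQuantumGroup A}
    {B : Type u} [CStarAlgebra B] (α : Action G B) : Coaction A B where
  E := MinTensor B A
  incl := StarAlgHom.id ℂ (MinTensor B A)
  map := α.hom

/-- The canonical map `S ⊗ A → E` on the algebraic tensor product. -/
def Coaction.emb {A : Type u} [CStarAlgebra A] {S : Type u} [CStarAlgebra S] (β : Coaction A S) :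
    S ⊗[ℂ] A →⋆ₐ[ℂ] β.E := β.incl.comp (MinTensor.of S A)

/-- The fixed point algebra is `ℂ 1` (and `1 ≠ 0`). -/
structure Coaction.IsErgodic {A : Type u} [CStarAlgebra A] {S : Type u} [CStarAlgebra S]
    (β : Coaction A S) : Prop where
  nontrivial : Nontrivial S
  fixed : ∀ b : S, β.map b = β.emb (b ⊗ₜ[ℂ] (1 : A)) → ∃ c : ℂ, b = c • (1 : S)

section Induction
variable {A A' B : Type u} [CStarAlgebra A] [CStarAlgebra A'] [CStarAlgebra B]
  {G : CompactQuantumGroup A} {H : CompactQuantumGroup A'}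

/-- `(α ⊗ id) : B ⊗ C(𝔾) → B ⊗ C(ℍ) ⊗ C(𝔾)` -/
def indL (A : Type u) [CStarAlgebra A] (α : Action H B) : MinTensor B A →⋆ₐ[ℂ] MinTensor₃ B A' A :=
  (MinTensor₃.assocL B A' A).comp (MinTensor.map α.hom (StarAlgHom.id ℂ A))

/-- `(id ⊗ π ⊗ id)(id ⊗ Δ) : B ⊗ C(𝔾) → B ⊗ C(ℍ) ⊗ C(𝔾)` -/
def indR (P : QuantumSubgroup G H) (B : Type u) [CStarAlgebra B] :
    MinTensor B A →⋆ₐ[ℂ] MinTensor₃ B A' A :=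
  (MinTensor₃.assocR B A' A).comp (MinTensor.map (StarAlgHom.id ℂ B)
    ((MinTensor.map P.π (StarAlgHom.id ℂ A)).comp G.comul))

/-- `Ind(B) = {b ∈ B ⊗ C(𝔾) | (α ⊗ id)(b) = (id ⊗ π ⊗ id)(id ⊗ Δ)(b)}`. -/
def Ind (P : QuantumSubgroup G H) (α : Action H B) : StarSubalgebra ℂ (MinTensor B A) :=
  StarAlgHom.equalizer (indL A α) (indR P B)

lemma isClosed_ind (P : QuantumSubgroup G H) (α : Action H B) :
    IsClosed (Ind P α : Set (MinTensor B A)) :=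
  isClosed_eq (RepFamily.continuous_starHom (indL A α)) (RepFamily.continuous_starHom (indR P B))

instance (P : QuantumSubgroup G H) (α : Action H B) : CStarAlgebra (Ind P α) :=
  StarSubalgebra.cstarAlgebra (Ind P α) (h_closed := isClosed_ind P α)

/-- The induced action: the restriction of `id ⊗ Δ` to `Ind(B)`, with values in
`B ⊗ C(𝔾) ⊗ C(𝔾)`, which contains `Ind(B) ⊗ C(𝔾)`. -/
def indAction (P : QuantumSubgroup G H) (α : Action H B) : Coaction A (Ind P α) where
  E := MinTensor₃ B A A
  incl := (MinTensor₃.assocL B A A).comp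
    (MinTensor.map (Ind P α).subtype (StarAlgHom.id ℂ A))
  map := ((MinTensor₃.assocR B A A).comp (MinTensor.map (StarAlgHom.id ℂ B) G.comul)).comp
    (Ind P α).subtype

end Induction

/-! ### Finite-dimensional unitary representations -/

lemma mul_mem_unitary {R : Type*} [Ring R] [StarRing R] {p q : R} (h1 : star p * p = 1)
    (h2 : p * star p = 1) (h3 : star q * q = 1) (h4 : q * star q = 1) : p * q ∈ unitary R := by
  rw [Unitary.mem_iff, star_mul]
  constructor
  · rw [mul_assoc, ← mul_assoc (star p), h1, one_mul, h3]
  · rw [mul_assoc, ← mul_assoc q, h4, one_mul, h2]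

section
variable {X Y X' Y' : Type*} [Ring X] [StarRing X] [Algebra ℂ X] [StarModule ℂ X]
  [Ring Y] [StarRing Y] [Algebra ℂ Y] [StarModule ℂ Y]
  [Ring X'] [StarRing X'] [Algebra ℂ X'] [StarModule ℂ X']
  [Ring Y'] [StarRing Y'] [Algebra ℂ Y'] [StarModule ℂ Y']

lemma starMap_star_mul (f : X →⋆ₐ[ℂ] X') (g : Y →⋆ₐ[ℂ] Y') {x : X ⊗[ℂ] Y} (h : star x * x = 1) :
    star (starMap f g x) * starMap f g x = 1 := by
  have h1 : starMap f g 1 = 1 := by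
    rw [Algebra.TensorProduct.one_def, starMap_tmul, map_one, map_one]; rfl
  rw [← map_star, ← map_mul, h, h1]

lemma starMap_mul_star (f : X →⋆ₐ[ℂ] X') (g : Y →⋆ₐ[ℂ] Y') {x : X ⊗[ℂ] Y} (h : x * star x = 1) :
    starMap f g x * star (starMap f g x) = 1 := by
  have h1 : starMap f g 1 = 1 := by
    rw [Algebra.TensorProduct.one_def, starMap_tmul, map_one, map_one]; rfl
  rw [← map_star, ← map_mul, h, h1]

end

section Algebraic
variable {A : Type u} [CStarAlgebra A] {H K L : Type*}
  [NormedAddCommGroup H] [InnerProductSpace ℂ H] [FiniteDimensional ℂ H]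
  [NormedAddCommGroup K] [InnerProductSpace ℂ K] [FiniteDimensional ℂ K]

/-- `ξ ↦ x (ξ ⊗ 1)`, as a linear map `H → H ⊗ A`, for `x ∈ B(H) ⊗ A`. -/
def evalAt (x : Module.End ℂ H ⊗[ℂ] A) : H →ₗ[ℂ] H ⊗[ℂ] A where
  toFun ξ := LinearMap.rTensor A (LinearMap.applyₗ (R := ℂ) (M₂ := H) ξ) x
  map_add' ξ η := by rw [map_add, LinearMap.rTensor_add, LinearMap.add_apply]
  map_smul' c ξ := by
    rw [map_smul, LinearMap.rTensor_smul, LinearMap.smul_apply, RingHom.id_apply]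

@[simp] lemma evalAt_tmul (f : Module.End ℂ H) (a : A) (ξ : H) :
    evalAt (f ⊗ₜ a) ξ = f ξ ⊗ₜ a := by simp [evalAt]

@[simp] lemma evalAt_zero (ξ : H) : evalAt (0 : Module.End ℂ H ⊗[ℂ] A) ξ = 0 := by simp [evalAt]

@[simp] lemma evalAt_add (x y : Module.End ℂ H ⊗[ℂ] A) (ξ : H) :
    evalAt (x + y) ξ = evalAt x ξ + evalAt y ξ := by simp [evalAt]

@[simp] lemma evalAt_one (ξ : H) : evalAt (1 : Module.End ℂ H ⊗[ℂ] A) ξ = ξ ⊗ₜ 1 := by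
  rw [Algebra.TensorProduct.one_def, evalAt_tmul]; rfl

/-- The slice `(⟨ξ, ·⟩ ⊗ id) : H ⊗ A → A`. -/
def slice (A : Type u) [CStarAlgebra A] (ξ : H) : H ⊗[ℂ] A →ₗ[ℂ] A :=
  (TensorProduct.lid ℂ A).toLinearMap ∘ₗ LinearMap.rTensor A (innerₛₗ ℂ ξ)

@[simp] lemma slice_tmul (ξ η : H) (a : A) : slice A ξ (η ⊗ₜ a) = inner ℂ ξ η • a := by
  simp [slice]

lemma slice_expand {ι : Type*} [Fintype ι] (e : OrthonormalBasis ι ℂ H) (x : H ⊗[ℂ] A) :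
    ∑ i, e i ⊗ₜ slice A (e i) x = x := by
  induction x using TensorProduct.induction_on with
  | zero => simp
  | add x y hx hy => simp only [map_add, TensorProduct.tmul_add, Finset.sum_add_distrib, hx, hy]
  | tmul η a =>
    simp only [slice_tmul, TensorProduct.tmul_smul, TensorProduct.smul_tmul']
    rw [← TensorProduct.sum_tmul, e.sum_repr']

lemma slice_ext {x y : H ⊗[ℂ] A} (h : ∀ ξ, slice A ξ x = slice A ξ y) : x = y := by
  rw [← slice_expand (stdOrthonormalBasis ℂ H) x, ← slice_expand (stdOrthonormalBasis ℂ H) y]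
  simp only [h]

/-- Matrix coefficients `⟨ξ, x η⟩ ∈ A` of `x ∈ B(H) ⊗ A`. -/
def coeff (x : Module.End ℂ H ⊗[ℂ] A) (ξ η : H) : A := slice A ξ (evalAt x η)

lemma coeff_tmul (f : Module.End ℂ H) (a : A) (ξ η : H) :
    coeff (f ⊗ₜ a) ξ η = inner ℂ ξ (f η) • a := by simp [coeff]

lemma coeff_add (x y : Module.End ℂ H ⊗[ℂ] A) (ξ η : H) :
    coeff (x + y) ξ η = coeff x ξ η + coeff y ξ η := by simp [coeff]

lemma coeff_zero (ξ η : H) : coeff (0 : Module.End ℂ H ⊗[ℂ] A) ξ η = 0 := by simp [coeff]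

lemma coeff_star (x : Module.End ℂ H ⊗[ℂ] A) (ξ η : H) :
    coeff (star x) ξ η = star (coeff x η ξ) := by
  induction x using TensorProduct.induction_on with
  | zero => simp [coeff_zero]
  | add x y hx hy => simp only [star_add, coeff_add, hx, hy]
  | tmul f a =>
    rw [TensorProduct.star_tmul, coeff_tmul, coeff_tmul, LinearMap.star_eq_adjoint,
      LinearMap.adjoint_inner_right, star_smul, Complex.star_def, inner_conj_symm]

lemma coeff_one (ξ η : H) : coeff (1 : Module.End ℂ H ⊗[ℂ] A) ξ η = inner ℂ ξ η • (1 : A) := by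
  simp [coeff]

lemma coeff_sum_right {ι : Type*} [Fintype ι] (e : OrthonormalBasis ι ℂ H)
    (x : Module.End ℂ H ⊗[ℂ] A) (ξ η : H) :
    coeff x ξ η = ∑ i, inner ℂ (e i) η • coeff x ξ (e i) := by
  conv_lhs => rw [← e.sum_repr' η]
  simp [coeff]

lemma coeff_mul {ι : Type*} [Fintype ι] (e : OrthonormalBasis ι ℂ H)
    (x y : Module.End ℂ H ⊗[ℂ] A) (ξ η : H) :
    coeff (x * y) ξ η = ∑ i, coeff x ξ (e i) * coeff y (e i) η := by
  induction x using TensorProduct.induction_on with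
  | zero => simp [coeff_zero]
  | add x x' hx hx' => simp only [add_mul, coeff_add, hx, hx', Finset.sum_add_distrib]
  | tmul f a =>
    induction y using TensorProduct.induction_on with
    | zero => simp [coeff_zero]
    | add y y' hy hy' => simp only [mul_add, coeff_add, hy, hy', Finset.sum_add_distrib]
    | tmul g b =>
      rw [Algebra.TensorProduct.tmul_mul_tmul]
      simp only [coeff_tmul, smul_mul_smul_comm, ← Finset.sum_smul]
      congr 1
      rw [Module.End.mul_apply]
      conv_lhs => rw [← e.sum_repr' (g η)]
      simp [mul_comm]

lemma slice_rTensor (T : H →ₗ[ℂ] K) (ξ : K) (x : H ⊗[ℂ] A) :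
    slice A ξ (LinearMap.rTensor A T x) = slice A (LinearMap.adjoint T ξ) x := by
  induction x using TensorProduct.induction_on with
  | zero => simp
  | add x y hx hy => simp only [map_add, hx, hy]
  | tmul η a => simp [LinearMap.adjoint_inner_left]

/-- `id ⊗ f : B(H) ⊗ A → B(H) ⊗ A'` -/
def amp (H : Type*) [NormedAddCommGroup H] [InnerProductSpace ℂ H] [FiniteDimensional ℂ H]
    {A' : Type u} [CStarAlgebra A'] (f : A →⋆ₐ[ℂ] A') :
    Module.End ℂ H ⊗[ℂ] A →⋆ₐ[ℂ] Module.End ℂ H ⊗[ℂ] A' :=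
  starMap (StarAlgHom.id ℂ (Module.End ℂ H)) f

lemma amp_tmul {A' : Type u} [CStarAlgebra A'] (f : A →⋆ₐ[ℂ] A') (x : Module.End ℂ H) (a : A) :
    amp H f (x ⊗ₜ a) = x ⊗ₜ f a := starMap_tmul _ _ _ _

lemma amp_amp {A' A'' : Type u} [CStarAlgebra A'] [CStarAlgebra A''] (f : A →⋆ₐ[ℂ] A')
    (g : A' →⋆ₐ[ℂ] A'') (x : Module.End ℂ H ⊗[ℂ] A) : amp H g (amp H f x) = amp H (g.comp f) x := by
  induction x using TensorProduct.induction_on with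
  | zero => simp only [map_zero]
  | add x y hx hy => simp only [map_add, hx, hy]
  | tmul x a => simp only [amp_tmul, StarAlgHom.comp_apply]

lemma amp_unitary {A' : Type u} [CStarAlgebra A'] (f : A →⋆ₐ[ℂ] A') {x : Module.End ℂ H ⊗[ℂ] A}
    (hx : x ∈ unitary (Module.End ℂ H ⊗[ℂ] A)) : amp H f x ∈ unitary (Module.End ℂ H ⊗[ℂ] A') := by
  rw [Unitary.mem_iff] at hx ⊢
  exact ⟨starMap_star_mul (StarAlgHom.id ℂ (Module.End ℂ H)) f hx.1,
    starMap_mul_star (StarAlgHom.id ℂ (Module.End ℂ H)) f hx.2⟩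

/-! #### The legs `x₁₃` and `y₂₃` -/

section
variable (H K)

/-- `f ↦ f ⊗ 1` -/
def endLeft : Module.End ℂ H →⋆ₐ[ℂ] Module.End ℂ (H ⊗[ℂ] K) where
  toFun f := TensorProduct.map f LinearMap.id
  map_one' := TensorProduct.map_id
  map_mul' f g := by
    rw [← LinearMap.comp_id (LinearMap.id : K →ₗ[ℂ] K)]
    exact TensorProduct.map_comp _ _ _ _
  map_zero' := TensorProduct.map_zero_left _
  map_add' f g := TensorProduct.map_add_left _ _ _
  commutes' c := by
    rw [Algebra.algebraMap_eq_smul_one, Algebra.algebraMap_eq_smul_one, TensorProduct.map_smul_left]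
    congr 1
    exact TensorProduct.map_id
  map_star' f := by
    rw [LinearMap.star_eq_adjoint, LinearMap.star_eq_adjoint, TensorProduct.adjoint_map,
      LinearMap.adjoint_id]

/-- `g ↦ 1 ⊗ g` -/
def endRight : Module.End ℂ K →⋆ₐ[ℂ] Module.End ℂ (H ⊗[ℂ] K) where
  toFun f := TensorProduct.map LinearMap.id f
  map_one' := TensorProduct.map_id
  map_mul' f g := by
    rw [← LinearMap.comp_id (LinearMap.id : H →ₗ[ℂ] H)]
    exact TensorProduct.map_comp _ _ _ _
  map_zero' := TensorProduct.map_zero_right _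
  map_add' f g := TensorProduct.map_add_right _ _ _
  commutes' c := by
    rw [Algebra.algebraMap_eq_smul_one, Algebra.algebraMap_eq_smul_one, TensorProduct.map_smul_right]
    congr 1
    exact TensorProduct.map_id
  map_star' f := by
    rw [LinearMap.star_eq_adjoint, LinearMap.star_eq_adjoint, TensorProduct.adjoint_map,
      LinearMap.adjoint_id]

/-- `f ⊗ a ↦ (f ⊗ 1) ⊗ a`, that is, `x ↦ x₁₃`. -/
def leg13 (A : Type u) [CStarAlgebra A] :
    Module.End ℂ H ⊗[ℂ] A →⋆ₐ[ℂ] Module.End ℂ (H ⊗[ℂ] K) ⊗[ℂ] A :=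
  starMap (endLeft H K) (StarAlgHom.id ℂ A)

/-- `g ⊗ a ↦ (1 ⊗ g) ⊗ a`, that is, `y ↦ y₂₃`. -/
def leg23 (A : Type u) [CStarAlgebra A] :
    Module.End ℂ K ⊗[ℂ] A →⋆ₐ[ℂ] Module.End ℂ (H ⊗[ℂ] K) ⊗[ℂ] A :=
  starMap (endRight H K) (StarAlgHom.id ℂ A)

end

lemma leg13_tmul (f : Module.End ℂ H) (a : A) :
    leg13 H K A (f ⊗ₜ a) = endLeft H K f ⊗ₜ a := starMap_tmul _ _ _ _

lemma leg23_tmul (f : Module.End ℂ K) (a : A) :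
    leg23 H K A (f ⊗ₜ a) = endRight H K f ⊗ₜ a := starMap_tmul _ _ _ _

lemma endLeft_mul_endRight (f : Module.End ℂ H) (g : Module.End ℂ K) :
    endLeft H K f * endRight H K g = TensorProduct.map f g :=
  TensorProduct.ext' fun _ _ => rfl

lemma endRight_mul_endLeft (f : Module.End ℂ H) (g : Module.End ℂ K) :
    endRight H K g * endLeft H K f = TensorProduct.map f g :=
  TensorProduct.ext' fun _ _ => rfl

lemma amp_leg13 {A' : Type u} [CStarAlgebra A'] (f : A →⋆ₐ[ℂ] A') (x : Module.End ℂ H ⊗[ℂ] A) :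
    amp (H ⊗[ℂ] K) f (leg13 H K A x) = leg13 H K A' (amp H f x) := by
  induction x using TensorProduct.induction_on with
  | zero => simp only [map_zero]
  | add x y hx hy => simp only [map_add, hx, hy]
  | tmul x a => rw [leg13_tmul, amp_tmul, amp_tmul, leg13_tmul]

lemma amp_leg23 {A' : Type u} [CStarAlgebra A'] (f : A →⋆ₐ[ℂ] A') (x : Module.End ℂ K ⊗[ℂ] A) :
    amp (H ⊗[ℂ] K) f (leg23 H K A x) = leg23 H K A' (amp K f x) := by
  induction x using TensorProduct.induction_on with
  | zero => simp only [map_zero]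
  | add x y hx hy => simp only [map_add, hx, hy]
  | tmul x a => rw [leg23_tmul, amp_tmul, amp_tmul, leg23_tmul]

/-- `x₁₃ y₂₃ ∈ B(H ⊗ K) ⊗ A` for `x ∈ B(H) ⊗ A` and `y ∈ B(K) ⊗ A`. -/
def legMul (x : Module.End ℂ H ⊗[ℂ] A) (y : Module.End ℂ K ⊗[ℂ] A) :
    Module.End ℂ (H ⊗[ℂ] K) ⊗[ℂ] A := leg13 H K A x * leg23 H K A y

lemma leg13_one : leg13 H K A 1 = 1 := by
  rw [Algebra.TensorProduct.one_def, leg13_tmul]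
  have h : endLeft H K 1 = 1 := TensorProduct.map_id
  rw [h]
  rfl

lemma leg23_one : leg23 H K A 1 = 1 := by
  rw [Algebra.TensorProduct.one_def, leg23_tmul]
  have h : endRight H K 1 = 1 := TensorProduct.map_id
  rw [h]
  rfl

lemma legMul_unitary {x : Module.End ℂ H ⊗[ℂ] A} {y : Module.End ℂ K ⊗[ℂ] A}
    (hx : x ∈ unitary (Module.End ℂ H ⊗[ℂ] A)) (hy : y ∈ unitary (Module.End ℂ K ⊗[ℂ] A)) :
    legMul x y ∈ unitary (Module.End ℂ (H ⊗[ℂ] K) ⊗[ℂ] A) := by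
  rw [Unitary.mem_iff] at hx hy
  refine mul_mem_unitary (R := Module.End ℂ (H ⊗[ℂ] K) ⊗[ℂ] A) (p := leg13 H K A x)
    (q := leg23 H K A y) ?_ ?_ ?_ ?_
  · rw [← map_star, ← map_mul, hx.1, leg13_one]
  · rw [← map_star, ← map_mul, hx.2, leg13_one]
  · rw [← map_star, ← map_mul, hy.1, leg23_one]
  · rw [← map_star, ← map_mul, hy.2, leg23_one]

lemma leg_comm {A' A'' : Type u} [CStarAlgebra A'] [CStarAlgebra A''] (f : A →⋆ₐ[ℂ] A'')
    (g : A' →⋆ₐ[ℂ] A'') (h : ∀ a b, f a * g b = g b * f a) (x : Module.End ℂ H ⊗[ℂ] A)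
    (y : Module.End ℂ K ⊗[ℂ] A') :
    leg13 H K A'' (amp H f x) * leg23 H K A'' (amp K g y) =
      leg23 H K A'' (amp K g y) * leg13 H K A'' (amp H f x) := by
  induction x using TensorProduct.induction_on with
  | zero => simp only [map_zero, zero_mul, mul_zero]
  | add x x' hx hx' => simp only [map_add, add_mul, mul_add, hx, hx']
  | tmul x a =>
    induction y using TensorProduct.induction_on with
    | zero => simp only [map_zero, zero_mul, mul_zero]
    | add y y' hy hy' => simp only [map_add, add_mul, mul_add, hy, hy']
    | tmul y b =>
      rw [amp_tmul, amp_tmul, leg13_tmul, leg23_tmul, Algebra.TensorProduct.tmul_mul_tmul,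
        Algebra.TensorProduct.tmul_mul_tmul, h, endLeft_mul_endRight, endRight_mul_endLeft]

lemma amp_legMul {A' : Type u} [CStarAlgebra A'] (f : A →⋆ₐ[ℂ] A')
    (x : Module.End ℂ H ⊗[ℂ] A) (y : Module.End ℂ K ⊗[ℂ] A) :
    amp (H ⊗[ℂ] K) f (legMul x y) = legMul (amp H f x) (amp K f y) := by
  unfold legMul
  rw [map_mul, amp_leg13, amp_leg23]

lemma legMul_mul {x x' : Module.End ℂ H ⊗[ℂ] A} {y y' : Module.End ℂ K ⊗[ℂ] A}
    (h : leg13 H K A x' * leg23 H K A y = leg23 H K A y * leg13 H K A x') :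
    legMul (x * x') (y * y') = legMul x y * legMul x' y' := by
  unfold legMul
  rw [map_mul, map_mul]
  exact Commute.mul_mul_mul_comm h _ _

lemma commute_right_left (a b : A) :
    MinTensor.right A A a * MinTensor.left A A b = MinTensor.left A A b * MinTensor.right A A a := by
  change MinTensor.of A A (1 ⊗ₜ a) * MinTensor.of A A (b ⊗ₜ 1) =
    MinTensor.of A A (b ⊗ₜ 1) * MinTensor.of A A (1 ⊗ₜ a)
  rw [← map_mul, ← map_mul]
  simp

lemma legMul_comul {f : A →⋆ₐ[ℂ] MinTensor A A} {x : Module.End ℂ H ⊗[ℂ] A}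
    {y : Module.End ℂ K ⊗[ℂ] A}
    (hx : amp H f x = amp H (MinTensor.left A A) x * amp H (MinTensor.right A A) x)
    (hy : amp K f y = amp K (MinTensor.left A A) y * amp K (MinTensor.right A A) y) :
    amp (H ⊗[ℂ] K) f (legMul x y) = amp (H ⊗[ℂ] K) (MinTensor.left A A) (legMul x y) *
      amp (H ⊗[ℂ] K) (MinTensor.right A A) (legMul x y) := by
  rw [amp_legMul, amp_legMul, amp_legMul, hx, hy]
  exact legMul_mul (leg_comm _ _ commute_right_left x y)

/-- `(ξ ⊗ a) ⊗ (η ⊗ b) ↦ (ξ ⊗ η) ⊗ ab` -/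
def pairing (A : Type u) [CStarAlgebra A] (H K : Type*) [AddCommGroup H] [Module ℂ H]
    [AddCommGroup K] [Module ℂ K] : (H ⊗[ℂ] A) ⊗[ℂ] (K ⊗[ℂ] A) →ₗ[ℂ] (H ⊗[ℂ] K) ⊗[ℂ] A :=
  LinearMap.lTensor (H ⊗[ℂ] K) (LinearMap.mul' ℂ A) ∘ₗ
    (TensorProduct.tensorTensorTensorComm ℂ H A K A).toLinearMap

@[simp] lemma pairing_tmul {H K : Type*} [AddCommGroup H] [Module ℂ H]
    [AddCommGroup K] [Module ℂ K] (ξ : H) (a : A) (η : K) (b : A) :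
    pairing A H K ((ξ ⊗ₜ a) ⊗ₜ (η ⊗ₜ b)) = (ξ ⊗ₜ η) ⊗ₜ (a * b) := by simp [pairing]

lemma evalAt_legMul (x : Module.End ℂ H ⊗[ℂ] A) (y : Module.End ℂ K ⊗[ℂ] A) (ξ : H) (η : K) :
    evalAt (legMul x y) (ξ ⊗ₜ η) = pairing A H K (evalAt x ξ ⊗ₜ evalAt y η) := by
  unfold legMul
  induction x using TensorProduct.induction_on with
  | zero => simp only [map_zero, zero_mul, evalAt_zero, TensorProduct.zero_tmul]
  | add x x' hx hx' => simp only [map_add, add_mul, evalAt_add, hx, hx', TensorProduct.add_tmul]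
  | tmul f a =>
    induction y using TensorProduct.induction_on with
    | zero => simp only [map_zero, mul_zero, evalAt_zero, TensorProduct.tmul_zero]
    | add x x' hx hx' => simp only [map_add, mul_add, evalAt_add, hx, hx', TensorProduct.tmul_add]
    | tmul g b =>
      rw [leg13_tmul, leg23_tmul, Algebra.TensorProduct.tmul_mul_tmul, endLeft_mul_endRight,
        evalAt_tmul, evalAt_tmul, evalAt_tmul, pairing_tmul, TensorProduct.map_tmul]

end Algebraic

/-- A finite-dimensional unitary representation `u ∈ B(H) ⊗ C(𝔾)` of a compact quantum group. -/
structure FinRep {A : Type u} [CStarAlgebra A] (G : CompactQuantumGroup A) where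
  H : Type
  [normed : NormedAddCommGroup H]
  [ip : InnerProductSpace ℂ H]
  [fin : FiniteDimensional ℂ H]
  elt : Module.End ℂ H ⊗[ℂ] A
  /-- `u` is unitary -/
  unitary : elt ∈ unitary (Module.End ℂ H ⊗[ℂ] A)
  /-- `(id ⊗ Δ)(u) = u₁₂ u₁₃` -/
  comul : amp H G.comul elt =
    amp H (MinTensor.left A A) elt * amp H (MinTensor.right A A) elt

attribute [instance] FinRep.normed FinRep.ip FinRep.fin

namespace FinRep

variable {A : Type u} [CStarAlgebra A] {G : CompactQuantumGroup A}

/-- The coaction `δ_u : H → H ⊗ C(𝔾)`, `δ_u(ξ) = u (ξ ⊗ 1)`. -/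
def δ (u : FinRep G) : u.H →ₗ[ℂ] u.H ⊗[ℂ] A := evalAt u.elt

lemma slice_δ (u : FinRep G) (ξ η : u.H) : slice A ξ (u.δ η) = coeff u.elt ξ η := rfl

/-- The intertwiners `Mor(u, v)`. -/
def Mor (u v : FinRep G) : Submodule ℂ (u.H →ₗ[ℂ] v.H) where
  carrier := {T | v.δ ∘ₗ T = LinearMap.rTensor A T ∘ₗ u.δ}
  zero_mem' := by simp
  add_mem' {S T} hS hT := by
    simp only [Set.mem_ofPred_eq] at hS hT ⊢
    rw [LinearMap.comp_add, hS, hT, LinearMap.rTensor_add, LinearMap.add_comp]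
  smul_mem' c T hT := by
    simp only [Set.mem_ofPred_eq] at hT ⊢
    rw [LinearMap.comp_smul, hT, LinearMap.rTensor_smul, LinearMap.smul_comp]

lemma mem_Mor {u v : FinRep G} {T : u.H →ₗ[ℂ] v.H} :
    T ∈ Mor u v ↔ ∀ ξ, v.δ (T ξ) = LinearMap.rTensor A T (u.δ ξ) :=
  ⟨fun h ξ => DFunLike.congr_fun h ξ, fun h => LinearMap.ext h⟩

lemma Mor.δ_apply {u v : FinRep G} (T : Mor u v) (ξ : u.H) :
    v.δ (T.1 ξ) = LinearMap.rTensor A T.1 (u.δ ξ) := mem_Mor.1 T.2 ξ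

lemma coeff_mor {u v : FinRep G} {T : u.H →ₗ[ℂ] v.H} (hT : T ∈ Mor u v) (ξ : v.H)
    (η : u.H) : coeff v.elt ξ (T η) = coeff u.elt (LinearMap.adjoint T ξ) η := by
  rw [← slice_δ, mem_Mor.1 hT, slice_rTensor, slice_δ]

lemma coeff_conj_mul {ι : Type*} [Fintype ι] (u : FinRep G) (e : OrthonormalBasis ι ℂ u.H)
    (ξ η : u.H) : ∑ i, star (coeff u.elt (e i) ξ) * coeff u.elt (e i) η = inner ℂ ξ η • (1 : A) := by
  have h := coeff_mul e (star u.elt) u.elt ξ η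
  rw [(Unitary.mem_iff.1 u.unitary).1, coeff_one] at h
  simp only [coeff_star] at h
  exact h.symm

lemma coeff_mul_conj {ι : Type*} [Fintype ι] (u : FinRep G) (e : OrthonormalBasis ι ℂ u.H)
    (ξ η : u.H) : ∑ i, coeff u.elt ξ (e i) * star (coeff u.elt η (e i)) = inner ℂ ξ η • (1 : A) := by
  have h := coeff_mul e u.elt (star u.elt) ξ η
  rw [(Unitary.mem_iff.1 u.unitary).2, coeff_one] at h
  simp only [coeff_star] at h
  exact h.symm

lemma coeff_sum_left {ι : Type*} [Fintype ι] (u : FinRep G) (e : OrthonormalBasis ι ℂ u.H)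
    (ξ η : u.H) : coeff u.elt ξ η = ∑ i, inner ℂ ξ (e i) • coeff u.elt (e i) η := by
  have h := coeff_mul e (1 : Module.End ℂ u.H ⊗[ℂ] A) u.elt ξ η
  rw [one_mul] at h
  simpa [coeff_one] using h

/-- The adjoint of an intertwiner is an intertwiner. -/
lemma adjoint_mem {u v : FinRep G} {T : u.H →ₗ[ℂ] v.H} (hT : T ∈ Mor u v) :
    LinearMap.adjoint T ∈ Mor v u := by
  rw [mem_Mor]
  intro ξ
  refine slice_ext fun ζ => ?_
  rw [slice_rTensor, LinearMap.adjoint_adjoint, slice_δ, slice_δ]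
  let e := stdOrthonormalBasis ℂ u.H
  let f := stdOrthonormalBasis ℂ v.H
  calc coeff u.elt ζ (LinearMap.adjoint T ξ)
      = ∑ m, inner ℂ (e m) (LinearMap.adjoint T ξ) • coeff u.elt ζ (e m) :=
        coeff_sum_right e _ _ _
    _ = ∑ m, coeff u.elt ζ (e m) * ∑ l, star (coeff v.elt (f l) (T (e m))) * coeff v.elt (f l) ξ := by
        refine Finset.sum_congr rfl fun m _ => ?_
        rw [coeff_conj_mul, LinearMap.adjoint_inner_right, mul_smul_comm, mul_one]
    _ = ∑ l, (∑ m, coeff u.elt ζ (e m) * star (coeff u.elt (LinearMap.adjoint T (f l)) (e m))) *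
          coeff v.elt (f l) ξ := by
        simp only [coeff_mor hT, Finset.mul_sum, Finset.sum_mul, mul_assoc]
        exact Finset.sum_comm
    _ = ∑ l, inner ℂ (T ζ) (f l) • coeff v.elt (f l) ξ := by
        refine Finset.sum_congr rfl fun l _ => ?_
        rw [coeff_mul_conj, LinearMap.adjoint_inner_right, smul_mul_assoc, one_mul]
    _ = coeff v.elt (T ζ) ξ := (coeff_sum_left v f _ _).symm

/-- The identity intertwiner. -/
def Mor.id (u : FinRep G) : Mor u u :=
  ⟨LinearMap.id, mem_Mor.2 fun ξ => by simp⟩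

/-- Composition of intertwiners, `S ∘ T`. -/
def Mor.comp {u v w' : FinRep G} (S : Mor v w') (T : Mor u v) : Mor u w' :=
  ⟨S.1 ∘ₗ T.1, mem_Mor.2 fun ξ => by
    rw [LinearMap.comp_apply, Mor.δ_apply S, Mor.δ_apply T, LinearMap.rTensor_comp_apply]⟩

/-- The adjoint intertwiner `T^*`. -/
def Mor.adj {u v : FinRep G} (T : Mor u v) : Mor v u :=
  ⟨LinearMap.adjoint T.1, adjoint_mem T.2⟩

/-! #### Tensor products -/

/-- The tensor product `u ⊠ v = u₁₃ v₂₃`. -/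
def tensor (u v : FinRep G) : FinRep G where
  H := u.H ⊗[ℂ] v.H
  elt := legMul u.elt v.elt
  unitary := legMul_unitary u.unitary v.unitary
  comul := legMul_comul u.comul v.comul

/-- `δ_{u ⊠ v}(ξ ⊗ η) = δ_u(ξ)₁₃ δ_v(η)₂₃` -/
lemma δ_tensor (u v : FinRep G) (ξ : u.H) (η : v.H) :
    (u.tensor v).δ (ξ ⊗ₜ η) = pairing A u.H v.H (u.δ ξ ⊗ₜ v.δ η) :=
  evalAt_legMul u.elt v.elt ξ η

lemma amp_one {H : Type*} [NormedAddCommGroup H] [InnerProductSpace ℂ H] [FiniteDimensional ℂ H]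
    {A' : Type u} [CStarAlgebra A'] (f : A →⋆ₐ[ℂ] A') : amp H f 1 = 1 := by
  rw [Algebra.TensorProduct.one_def, amp_tmul, map_one]
  rfl

/-- The trivial representation on `ℂ`. -/
def triv (G : CompactQuantumGroup A) : FinRep G where
  H := ℂ
  elt := 1
  unitary := one_mem _
  comul := by rw [amp_one, amp_one, amp_one, one_mul]

lemma δ_triv (z : ℂ) : (triv G).δ z = z ⊗ₜ[ℂ] (1 : A) := evalAt_one z

section
variable {H K L H' K' : Type*} [AddCommGroup H] [Module ℂ H] [AddCommGroup K] [Module ℂ K]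
  [AddCommGroup L] [Module ℂ L] [AddCommGroup H'] [Module ℂ H'] [AddCommGroup K'] [Module ℂ K']

lemma pairing_map (S : H →ₗ[ℂ] H') (T : K →ₗ[ℂ] K') (x : H ⊗[ℂ] A) (y : K ⊗[ℂ] A) :
    LinearMap.rTensor A (TensorProduct.map S T) (pairing A H K (x ⊗ₜ y)) =
      pairing A H' K' (LinearMap.rTensor A S x ⊗ₜ LinearMap.rTensor A T y) := by
  induction x using TensorProduct.induction_on with
  | zero => simp
  | add x x' hx hx' => simp only [map_add, TensorProduct.add_tmul, hx, hx']
  | tmul x a =>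
    induction y using TensorProduct.induction_on with
    | zero => simp
    | add y y' hy hy' => simp only [map_add, TensorProduct.tmul_add, hy, hy']
    | tmul y b => simp

lemma pairing_assoc (x : H ⊗[ℂ] A) (y : K ⊗[ℂ] A) (z : L ⊗[ℂ] A) :
    LinearMap.rTensor A (TensorProduct.assoc ℂ H K L).toLinearMap
      (pairing A (H ⊗[ℂ] K) L (pairing A H K (x ⊗ₜ y) ⊗ₜ z)) =
    pairing A H (K ⊗[ℂ] L) (x ⊗ₜ pairing A K L (y ⊗ₜ z)) := by
  induction x using TensorProduct.induction_on with
  | zero => simp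
  | add x x' hx hx' => simp only [map_add, TensorProduct.add_tmul, hx, hx']
  | tmul x a =>
    induction y using TensorProduct.induction_on with
    | zero => simp
    | add y y' hy hy' =>
      simp only [map_add, TensorProduct.tmul_add, TensorProduct.add_tmul, hy, hy']
    | tmul y b =>
      induction z using TensorProduct.induction_on with
      | zero => simp
      | add z z' hz hz' => simp only [map_add, TensorProduct.tmul_add, hz, hz']
      | tmul z c => simp [mul_assoc]

lemma pairing_lid (z : ℂ) (y : K ⊗[ℂ] A) :
    LinearMap.rTensor A (TensorProduct.lid ℂ K).toLinearMap
      (pairing A ℂ K ((z ⊗ₜ[ℂ] (1 : A)) ⊗ₜ y)) = z • y := by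
  induction y using TensorProduct.induction_on with
  | zero => simp
  | add y y' hy hy' => simp only [map_add, TensorProduct.tmul_add, hy, hy', smul_add]
  | tmul y b => simp [TensorProduct.smul_tmul']

lemma pairing_rid (z : ℂ) (y : K ⊗[ℂ] A) :
    LinearMap.rTensor A (TensorProduct.rid ℂ K).toLinearMap
      (pairing A K ℂ (y ⊗ₜ (z ⊗ₜ[ℂ] (1 : A)))) = z • y := by
  induction y using TensorProduct.induction_on with
  | zero => simp
  | add y y' hy hy' => simp only [map_add, TensorProduct.add_tmul, hy, hy', smul_add]
  | tmul y b => simp [TensorProduct.smul_tmul']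

/-- The coaction `ξ ⊗ η ↦ d(ξ)₁₃ e(η)₂₃` on `H ⊗ K`. -/
def tensorCoact (d : H →ₗ[ℂ] H ⊗[ℂ] A) (e : K →ₗ[ℂ] K ⊗[ℂ] A) :
    H ⊗[ℂ] K →ₗ[ℂ] (H ⊗[ℂ] K) ⊗[ℂ] A := pairing A H K ∘ₗ TensorProduct.map d e

lemma tensorCoact_map {d : H →ₗ[ℂ] H ⊗[ℂ] A} {e : K →ₗ[ℂ] K ⊗[ℂ] A} {d' : H' →ₗ[ℂ] H' ⊗[ℂ] A}
    {e' : K' →ₗ[ℂ] K' ⊗[ℂ] A} {S : H →ₗ[ℂ] H'} {T : K →ₗ[ℂ] K'}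
    (hS : d' ∘ₗ S = LinearMap.rTensor A S ∘ₗ d) (hT : e' ∘ₗ T = LinearMap.rTensor A T ∘ₗ e) :
    tensorCoact d' e' ∘ₗ TensorProduct.map S T =
      LinearMap.rTensor A (TensorProduct.map S T) ∘ₗ tensorCoact d e := by
  refine TensorProduct.ext' fun ξ η => ?_
  have h1 : d' (S ξ) = LinearMap.rTensor A S (d ξ) := DFunLike.congr_fun hS ξ
  have h2 : e' (T η) = LinearMap.rTensor A T (e η) := DFunLike.congr_fun hT η
  simp only [tensorCoact, LinearMap.comp_apply, TensorProduct.map_tmul, h1, h2, pairing_map]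

lemma tensorCoact_assoc (d : H →ₗ[ℂ] H ⊗[ℂ] A) (e : K →ₗ[ℂ] K ⊗[ℂ] A) (f : L →ₗ[ℂ] L ⊗[ℂ] A) :
    tensorCoact d (tensorCoact e f) ∘ₗ (TensorProduct.assoc ℂ H K L).toLinearMap =
      LinearMap.rTensor A (TensorProduct.assoc ℂ H K L).toLinearMap ∘ₗ
        tensorCoact (tensorCoact d e) f := by
  refine TensorProduct.ext_threefold fun ξ η ζ => ?_
  simp only [tensorCoact, LinearMap.comp_apply, TensorProduct.map_tmul, pairing_assoc,
    LinearEquiv.coe_coe, TensorProduct.assoc_tmul]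

lemma tensorCoact_lid {d : ℂ →ₗ[ℂ] ℂ ⊗[ℂ] A} (hd : ∀ z, d z = z ⊗ₜ 1)
    (e : K →ₗ[ℂ] K ⊗[ℂ] A) : e ∘ₗ (TensorProduct.lid ℂ K).toLinearMap =
      LinearMap.rTensor A (TensorProduct.lid ℂ K).toLinearMap ∘ₗ tensorCoact d e := by
  refine TensorProduct.ext' fun z η => ?_
  simp only [tensorCoact, LinearMap.comp_apply, TensorProduct.map_tmul, hd, pairing_lid,
    LinearEquiv.coe_coe, TensorProduct.lid_tmul, map_smul]

lemma tensorCoact_rid {d : ℂ →ₗ[ℂ] ℂ ⊗[ℂ] A} (hd : ∀ z, d z = z ⊗ₜ 1)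
    (e : K →ₗ[ℂ] K ⊗[ℂ] A) : e ∘ₗ (TensorProduct.rid ℂ K).toLinearMap =
      LinearMap.rTensor A (TensorProduct.rid ℂ K).toLinearMap ∘ₗ tensorCoact e d := by
  refine TensorProduct.ext' fun η z => ?_
  simp only [tensorCoact, LinearMap.comp_apply, TensorProduct.map_tmul, hd, pairing_rid,
    LinearEquiv.coe_coe, TensorProduct.rid_tmul, map_smul]

lemma lTensor_mor {A' : Type u} [CStarAlgebra A'] {d : H →ₗ[ℂ] H ⊗[ℂ] A} {e : K →ₗ[ℂ] K ⊗[ℂ] A}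
    {T : H →ₗ[ℂ] K} (f : A →ₗ[ℂ] A') (h : e ∘ₗ T = LinearMap.rTensor A T ∘ₗ d) :
    (LinearMap.lTensor K f ∘ₗ e) ∘ₗ T = LinearMap.rTensor A' T ∘ₗ (LinearMap.lTensor H f ∘ₗ d) := by
  rw [LinearMap.comp_assoc, h, ← LinearMap.comp_assoc, ← LinearMap.comp_assoc,
    LinearMap.lTensor_comp_rTensor, LinearMap.rTensor_comp_lTensor]

end

lemma δ_tensor' (u v : FinRep G) : (u.tensor v).δ = tensorCoact u.δ v.δ :=
  TensorProduct.ext' fun ξ η => δ_tensor u v ξ η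

/-- The tensor product `S ⊠ T` of intertwiners. -/
def Mor.tensor {u v u' v' : FinRep G} (S : Mor u u') (T : Mor v v') :
    Mor (u.tensor v) (u'.tensor v') :=
  ⟨TensorProduct.map S.1 T.1, by
    have h := tensorCoact_map S.2 T.2
    rw [← δ_tensor', ← δ_tensor'] at h
    exact h⟩

/-- The associativity intertwiner `(u ⊠ v) ⊠ x → u ⊠ (v ⊠ x)`. -/
def Mor.assoc (u v x : FinRep G) : Mor ((u.tensor v).tensor x) (u.tensor (v.tensor x)) :=
  ⟨(TensorProduct.assoc ℂ u.H v.H x.H).toLinearMap, by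
    have h := tensorCoact_assoc u.δ v.δ x.δ
    rw [← δ_tensor', ← δ_tensor'] at h
    have h1 : (u.tensor (v.tensor x)).δ = tensorCoact u.δ (v.tensor x).δ := δ_tensor' _ _
    have h2 : ((u.tensor v).tensor x).δ = tensorCoact (u.tensor v).δ x.δ := δ_tensor' _ _
    change _ = _
    rw [h1, h2]
    exact h⟩

/-- The left unit intertwiner `1 ⊠ u → u`. -/
def Mor.leftUnit (u : FinRep G) : Mor ((triv G).tensor u) u :=
  ⟨(TensorProduct.lid ℂ u.H).toLinearMap, by
    have h := tensorCoact_lid (d := (triv G).δ) δ_triv u.δ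
    have h2 : ((triv G).tensor u).δ = tensorCoact (triv G).δ u.δ := δ_tensor' _ _
    change _ = _
    rw [h2]
    exact h⟩

/-- The right unit intertwiner `u ⊠ 1 → u`. -/
def Mor.rightUnit (u : FinRep G) : Mor (u.tensor (triv G)) u :=
  ⟨(TensorProduct.rid ℂ u.H).toLinearMap, by
    have h := tensorCoact_rid (d := (triv G).δ) δ_triv u.δ
    have h2 : (u.tensor (triv G)).δ = tensorCoact u.δ (triv G).δ := δ_tensor' _ _
    change _ = _
    rw [h2]
    exact h⟩

/-! #### Restriction to a quantum subgroup -/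

section Restriction
variable {A' : Type u} [CStarAlgebra A'] {H : CompactQuantumGroup A'}

lemma evalAt_amp {V : Type*} [NormedAddCommGroup V] [InnerProductSpace ℂ V]
    [FiniteDimensional ℂ V] (f : A →⋆ₐ[ℂ] A') (x : Module.End ℂ V ⊗[ℂ] A) (ξ : V) :
    evalAt (amp V f x) ξ = LinearMap.lTensor V f.toAlgHom.toLinearMap (evalAt x ξ) := by
  induction x using TensorProduct.induction_on with
  | zero => simp only [map_zero, evalAt_zero]
  | add x y hx hy => simp only [map_add, evalAt_add, hx, hy]
  | tmul x a => rw [amp_tmul, evalAt_tmul, evalAt_tmul]; rfl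

/-- The restriction `Res(u) = (id ⊗ π)(u)`. -/
def res (P : QuantumSubgroup G H) (u : FinRep G) : FinRep H where
  H := u.H
  elt := amp u.H P.π u.elt
  unitary := amp_unitary P.π u.unitary
  comul := by
    have h1 : H.comul.comp P.π = (MinTensor.map P.π P.π).comp G.comul :=
      StarAlgHom.ext P.comul_π
    have h2 : (MinTensor.left A' A').comp P.π =
        (MinTensor.map P.π P.π).comp (MinTensor.left A A) := StarAlgHom.ext fun a => by
      change MinTensor.of A' A' (P.π a ⊗ₜ 1) = MinTensor.map P.π P.π (MinTensor.of A A (a ⊗ₜ 1))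
      rw [MinTensor.map_of, starMap_tmul, map_one]
    have h3 : (MinTensor.right A' A').comp P.π =
        (MinTensor.map P.π P.π).comp (MinTensor.right A A) := StarAlgHom.ext fun a => by
      change MinTensor.of A' A' (1 ⊗ₜ P.π a) = MinTensor.map P.π P.π (MinTensor.of A A (1 ⊗ₜ a))
      rw [MinTensor.map_of, starMap_tmul, map_one]
    rw [amp_amp, amp_amp, amp_amp, h1, h2, h3, ← amp_amp, ← amp_amp, ← amp_amp, u.comul, map_mul]

lemma δ_res (P : QuantumSubgroup G H) (u : FinRep G) :
    (u.res P).δ = LinearMap.lTensor u.H P.π.toAlgHom.toLinearMap ∘ₗ u.δ :=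
  LinearMap.ext fun ξ => evalAt_amp P.π u.elt ξ

/-- An intertwiner of `𝔾` as an intertwiner of the restricted representations. -/
def Mor.res (P : QuantumSubgroup G H) {u v : FinRep G} (T : Mor u v) : Mor (u.res P) (v.res P) :=
  ⟨T.1, by
    have h := lTensor_mor P.π.toAlgHom.toLinearMap T.2
    rw [← δ_res, ← δ_res] at h
    exact h⟩

lemma δ_res_tensor (P : QuantumSubgroup G H) (u v : FinRep G) :
    ((u.tensor v).res P).δ = ((u.res P).tensor (v.res P)).δ :=
  congrArg (fun x => evalAt (H := u.H ⊗[ℂ] v.H) x) (amp_legMul P.π u.elt v.elt)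

lemma δ_res_triv (P : QuantumSubgroup G H) : ((triv G).res P).δ = (triv H).δ :=
  congrArg (fun x => evalAt (H := ℂ) x) (amp_one P.π)

lemma id_mem_mor {V : Type*} [AddCommGroup V] [Module ℂ V] {d e : V →ₗ[ℂ] V ⊗[ℂ] A} (h : e = d) :
    e ∘ₗ LinearMap.id = LinearMap.rTensor A LinearMap.id ∘ₗ d := by
  rw [h, LinearMap.rTensor_id, LinearMap.id_comp, LinearMap.comp_id]

/-- The identification `Res(u) ⊠ Res(v) = Res(u ⊠ v)`. -/
def Mor.resTensor (P : QuantumSubgroup G H) (u v : FinRep G) :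
    Mor ((u.res P).tensor (v.res P)) ((u.tensor v).res P) :=
  ⟨(LinearMap.id : u.H ⊗[ℂ] v.H →ₗ[ℂ] u.H ⊗[ℂ] v.H), id_mem_mor (δ_res_tensor P u v)⟩

/-- The identification `1 = Res(1)`. -/
def Mor.resTriv (P : QuantumSubgroup G H) : Mor (triv H) ((triv G).res P) :=
  ⟨(LinearMap.id : ℂ →ₗ[ℂ] ℂ), id_mem_mor (δ_res_triv P)⟩

end Restriction

end FinRep

/-! ### Spectral subspaces -/

section Spec
variable {A : Type u} [CStarAlgebra A] {G : CompactQuantumGroup A}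
  {S : Type u} [CStarAlgebra S]

/-- `Mor(u, β) = {T : H_u → S | β ∘ T = (T ⊗ id) ∘ δ_u}`. -/
def SpecMor (u : FinRep G) (β : Coaction A S) : Submodule ℂ (u.H →ₗ[ℂ] S) where
  carrier := {T | ∀ ξ, β.map (T ξ) = β.emb (LinearMap.rTensor A T (u.δ ξ))}
  zero_mem' ξ := by simp
  add_mem' {T R} hT hR ξ := by
    rw [LinearMap.add_apply, map_add, hT, hR, LinearMap.rTensor_add, LinearMap.add_apply, map_add]
  smul_mem' c T hT ξ := by
    rw [LinearMap.smul_apply, map_smul, hT, LinearMap.rTensor_smul, LinearMap.smul_apply, map_smul]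

lemma SpecMor.apply {u : FinRep G} {β : Coaction A S} (T : SpecMor u β) (ξ : u.H) :
    β.map (T.1 ξ) = β.emb (LinearMap.rTensor A T.1 (u.δ ξ)) := T.2 ξ

/-- `T ∘ R` for an intertwiner `R`. -/
def SpecMor.comp {u v : FinRep G} {β : Coaction A S} (T : SpecMor u β) (R : FinRep.Mor v u) :
    SpecMor v β :=
  ⟨T.1 ∘ₗ R.1, fun ξ => by
    rw [LinearMap.comp_apply, SpecMor.apply, FinRep.Mor.δ_apply, LinearMap.rTensor_comp_apply]⟩

lemma rTensor_pairing {H K : Type*} [AddCommGroup H] [Module ℂ H] [AddCommGroup K] [Module ℂ K]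
    (T : H →ₗ[ℂ] S) (R : K →ₗ[ℂ] S) (x : H ⊗[ℂ] A) (y : K ⊗[ℂ] A) :
    LinearMap.rTensor A (LinearMap.mul' ℂ S ∘ₗ TensorProduct.map T R) (pairing A H K (x ⊗ₜ y)) =
      LinearMap.rTensor A T x * LinearMap.rTensor A R y := by
  induction x using TensorProduct.induction_on with
  | zero => simp
  | add x x' hx hx' => simp only [map_add, TensorProduct.add_tmul, hx, hx', add_mul]
  | tmul x a =>
    induction y using TensorProduct.induction_on with
    | zero => simp
    | add y y' hy hy' => simp only [map_add, TensorProduct.tmul_add, hy, hy', mul_add]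
    | tmul y b => simp

lemma specMul_apply {H K : Type*} [AddCommGroup H] [Module ℂ H] [AddCommGroup K] [Module ℂ K]
    (T : H →ₗ[ℂ] S) (R : K →ₗ[ℂ] S) (β : Coaction A S) {d : H →ₗ[ℂ] H ⊗[ℂ] A}
    {e : K →ₗ[ℂ] K ⊗[ℂ] A} (hT : ∀ ξ, β.map (T ξ) = β.emb (LinearMap.rTensor A T (d ξ)))
    (hR : ∀ ξ, β.map (R ξ) = β.emb (LinearMap.rTensor A R (e ξ))) (ζ : H ⊗[ℂ] K) :
    β.map ((LinearMap.mul' ℂ S ∘ₗ TensorProduct.map T R) ζ) =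
      β.emb (LinearMap.rTensor A (LinearMap.mul' ℂ S ∘ₗ TensorProduct.map T R)
        (FinRep.tensorCoact d e ζ)) := by
  induction ζ using TensorProduct.induction_on with
  | zero => simp only [map_zero]
  | add x y hx hy => simp only [map_add, hx, hy]
  | tmul ξ η =>
    rw [FinRep.tensorCoact, LinearMap.comp_apply, LinearMap.comp_apply, TensorProduct.map_tmul,
      TensorProduct.map_tmul, rTensor_pairing, map_mul, LinearMap.mul'_apply, map_mul, hT, hR]

/-- The product `ξ ⊗ η ↦ T(ξ) R(η)`, in `Mor(u ⊠ v, β)`. -/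
def SpecMor.mul {u v : FinRep G} {β : Coaction A S} (T : SpecMor u β) (R : SpecMor v β) :
    SpecMor (u.tensor v) β :=
  ⟨LinearMap.mul' ℂ S ∘ₗ TensorProduct.map T.1 R.1, fun ζ => by
    have h := specMul_apply T.1 R.1 β T.2 R.2 ζ
    rw [← FinRep.δ_tensor'] at h
    exact h⟩

lemma SpecMor.mul_tmul {u v : FinRep G} {β : Coaction A S} (T : SpecMor u β) (R : SpecMor v β)
    (ξ : u.H) (η : v.H) : (SpecMor.mul T R).1 (ξ ⊗ₜ[ℂ] η) = T.1 ξ * R.1 η := rfl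

lemma toSpanSingleton_spec (β : Coaction A S) (c : ℂ) (z : ℂ) :
    β.map (LinearMap.toSpanSingleton ℂ S (c • 1) z) =
      β.emb (LinearMap.rTensor A (LinearMap.toSpanSingleton ℂ S (c • 1)) (z ⊗ₜ[ℂ] (1 : A))) := by
  rw [LinearMap.rTensor_tmul, LinearMap.toSpanSingleton_apply, map_smul, map_smul, map_one,
    ← TensorProduct.smul_tmul', ← TensorProduct.smul_tmul', map_smul, map_smul]
  congr 2
  exact (map_one β.emb).symm

/-- The element `z ↦ z c 1` of `Mor(1, β)`. -/
def SpecMor.unit (G : CompactQuantumGroup A) (β : Coaction A S) (c : ℂ) :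
    SpecMor (FinRep.triv G) β :=
  ⟨LinearMap.toSpanSingleton ℂ S (c • 1), fun z => by
    have h := toSpanSingleton_spec β c z
    have h1 : (FinRep.triv G).δ z = z ⊗ₜ[ℂ] (1 : A) := FinRep.δ_triv z
    exact h.trans (by rw [h1]; rfl)⟩

/-- The algebra-valued inner product `∑ T(eᵢ) R(eᵢ)^*`. -/
def SpecMor.ip {u : FinRep G} {β : Coaction A S} (T R : SpecMor u β) : S :=
  ∑ i, T.1 (stdOrthonormalBasis ℂ u.H i) * star (R.1 (stdOrthonormalBasis ℂ u.H i))

lemma sum_basis_eq {H ι κ : Type*} [NormedAddCommGroup H] [InnerProductSpace ℂ H] [Fintype ι]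
    [Fintype κ] (e : OrthonormalBasis ι ℂ H) (f : OrthonormalBasis κ ℂ H) (T R : H →ₗ[ℂ] S) :
    ∑ i, T (e i) * star (R (e i)) = ∑ k, T (f k) * star (R (f k)) := by
  have h1 : ∀ (T : H →ₗ[ℂ] S) i, T (e i) = ∑ k, inner ℂ (f k) (e i) • T (f k) := fun T i => by
    conv_lhs => rw [← f.sum_repr' (e i)]
    simp
  have h2 : ∀ k l, ∑ i, inner ℂ (f k) (e i) * star (inner ℂ (f l) (e i)) = inner ℂ (f k) (f l) :=
    fun k l => by
      rw [← e.sum_inner_mul_inner]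
      refine Finset.sum_congr rfl fun i _ => ?_
      rw [Complex.star_def, inner_conj_symm]
  classical
  calc ∑ i, T (e i) * star (R (e i))
      = ∑ i, ∑ k, ∑ l, (inner ℂ (f k) (e i) * star (inner ℂ (f l) (e i))) •
          (T (f k) * star (R (f l))) := by
        refine Finset.sum_congr rfl fun i _ => ?_
        rw [h1 T i, h1 R i, star_sum, Finset.sum_mul_sum]
        simp only [star_smul, smul_mul_smul_comm]
    _ = ∑ k, ∑ l, (∑ i, inner ℂ (f k) (e i) * star (inner ℂ (f l) (e i))) •
          (T (f k) * star (R (f l))) := by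
        rw [Finset.sum_comm]
        refine Finset.sum_congr rfl fun k _ => ?_
        rw [Finset.sum_comm]
        simp only [Finset.sum_smul]
    _ = ∑ k, T (f k) * star (R (f k)) := by
        refine Finset.sum_congr rfl fun k _ => ?_
        simp only [h2, orthonormal_iff_ite.1 f.orthonormal]
        simp

lemma SpecMor.ip_eq {u : FinRep G} {β : Coaction A S} (T R : SpecMor u β) {ι : Type*} [Fintype ι]
    (e : OrthonormalBasis ι ℂ u.H) : SpecMor.ip T R = ∑ i, T.1 (e i) * star (R.1 (e i)) :=
  sum_basis_eq _ _ _ _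

lemma SpecMor.apply_basis {u : FinRep G} {β : Coaction A S} (T : SpecMor u β) {ι : Type*}
    [Fintype ι] (e : OrthonormalBasis ι ℂ u.H) (ξ : u.H) :
    β.map (T.1 ξ) = ∑ k, β.emb (T.1 (e k) ⊗ₜ coeff u.elt (e k) ξ) := by
  rw [SpecMor.apply T, ← slice_expand e (u.δ ξ), map_sum, map_sum]
  rfl

/-- `∑ T(eᵢ) R(eᵢ)^*` is a fixed point. -/
lemma SpecMor.ip_fixed {u : FinRep G} {β : Coaction A S} (T R : SpecMor u β) :
    β.map (SpecMor.ip T R) = β.emb (SpecMor.ip T R ⊗ₜ[ℂ] (1 : A)) := by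
  unfold SpecMor.ip
  set e := stdOrthonormalBasis ℂ u.H
  classical
  calc β.map (∑ i, T.1 (e i) * star (R.1 (e i)))
      = ∑ i, ∑ k, ∑ l, β.emb ((T.1 (e k) * star (R.1 (e l))) ⊗ₜ
          (coeff u.elt (e k) (e i) * star (coeff u.elt (e l) (e i)))) := by
        rw [map_sum]
        refine Finset.sum_congr rfl fun i _ => ?_
        rw [map_mul, map_star, SpecMor.apply_basis T e, SpecMor.apply_basis R e, star_sum, Finset.sum_mul_sum]
        refine Finset.sum_congr rfl fun k _ => Finset.sum_congr rfl fun l _ => ?_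
        rw [← map_star, ← map_mul, TensorProduct.star_tmul, Algebra.TensorProduct.tmul_mul_tmul]
    _ = ∑ k, ∑ l, β.emb ((T.1 (e k) * star (R.1 (e l))) ⊗ₜ
          (∑ i, coeff u.elt (e k) (e i) * star (coeff u.elt (e l) (e i)))) := by
        rw [Finset.sum_comm]
        refine Finset.sum_congr rfl fun k _ => ?_
        rw [Finset.sum_comm]
        refine Finset.sum_congr rfl fun l _ => ?_
        rw [TensorProduct.tmul_sum, map_sum]
    _ = ∑ k, β.emb ((T.1 (e k) * star (R.1 (e k))) ⊗ₜ 1) := by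
        refine Finset.sum_congr rfl fun k _ => ?_
        simp only [FinRep.coeff_mul_conj, orthonormal_iff_ite.1 e.orthonormal]
        rw [Finset.sum_eq_single k]
        · simp
        · intro l _ hl
          simp [hl.symm]
        · simp
    _ = β.emb ((∑ i, T.1 (e i) * star (R.1 (e i))) ⊗ₜ[ℂ] (1 : A)) := by
        rw [TensorProduct.sum_tmul, map_sum]

lemma SpecMor.ip_add_left {u : FinRep G} {β : Coaction A S} (T T' R : SpecMor u β) :
    SpecMor.ip (T + T') R = SpecMor.ip T R + SpecMor.ip T' R := by
  simp [SpecMor.ip, add_mul, Finset.sum_add_distrib]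

lemma SpecMor.ip_smul_left {u : FinRep G} {β : Coaction A S} (c : ℂ) (T R : SpecMor u β) :
    SpecMor.ip (c • T) R = c • SpecMor.ip T R := by
  simp [SpecMor.ip, Finset.smul_sum]

lemma SpecMor.star_ip {u : FinRep G} {β : Coaction A S} (T R : SpecMor u β) :
    star (SpecMor.ip T R) = SpecMor.ip R T := by
  simp [SpecMor.ip, star_sum]

lemma SpecMor.ip_comp {u v : FinRep G} {β : Coaction A S} (T : SpecMor u β) (R : SpecMor v β)
    (V : FinRep.Mor u v) : SpecMor.ip (SpecMor.comp T (FinRep.Mor.adj V)) R = SpecMor.ip T (SpecMor.comp R V) := by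
  set e := stdOrthonormalBasis ℂ u.H with he
  set f := stdOrthonormalBasis ℂ v.H with hf
  have h1 : ∀ l, T.1 (LinearMap.adjoint V.1 (f l)) =
      ∑ i, inner ℂ (V.1 (e i)) (f l) • T.1 (e i) := fun l => by
    rw [← e.sum_repr' (LinearMap.adjoint V.1 (f l))]
    simp [LinearMap.adjoint_inner_right]
  have h2 : ∀ i, R.1 (V.1 (e i)) = ∑ l, inner ℂ (f l) (V.1 (e i)) • R.1 (f l) := fun i => by
    conv_lhs => rw [← f.sum_repr' (V.1 (e i))]
    simp
  change ∑ l, T.1 (LinearMap.adjoint V.1 (f l)) * star (R.1 (f l)) =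
    ∑ i, T.1 (e i) * star (R.1 (V.1 (e i)))
  simp only [h1, h2, Finset.sum_mul, star_sum, Finset.mul_sum, star_smul, smul_mul_assoc,
    mul_smul_comm, Complex.star_def, inner_conj_symm]
  exact Finset.sum_comm

lemma sum_mul_aux {ι κ : Type*} [Fintype ι] [Fintype κ] (t t' : ι → S) (r r' : κ → S) (c d : ℂ)
    (hr : ∑ j, r j * star (r' j) = c • 1) (ht : ∑ i, t i * star (t' i) = d • 1) :
    ∑ p : ι × κ, (t p.1 * r p.2) * star (t' p.1 * r' p.2) = (d * c) • 1 := by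
  rw [Fintype.sum_prod_type]
  have : ∀ i, ∑ j, (t i * r j) * star (t' i * r' j) = c • (t i * star (t' i)) := fun i => by
    calc ∑ j, (t i * r j) * star (t' i * r' j) = t i * (∑ j, r j * star (r' j)) * star (t' i) := by
          rw [Finset.mul_sum, Finset.sum_mul]
          refine Finset.sum_congr rfl fun j _ => ?_
          rw [star_mul]
          simp only [mul_assoc]
      _ = _ := by rw [hr, mul_smul_comm, mul_one, smul_mul_assoc]
  simp only [this]
  rw [← Finset.smul_sum, ht, smul_smul, mul_comm]

/-- Multiplicativity of the inner products. -/
lemma SpecMor.ip_mul {u v : FinRep G} {β : Coaction A S} (T T' : SpecMor u β) (R R' : SpecMor v β)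
    (c d : ℂ) (hR : SpecMor.ip R R' = c • 1) (hT : SpecMor.ip T T' = d • 1) :
    SpecMor.ip (SpecMor.mul T R) (SpecMor.mul T' R') = (d * c) • 1 := by
  rw [SpecMor.ip_eq (SpecMor.mul T R) (SpecMor.mul T' R')
    (OrthonormalBasis.tensorProduct (stdOrthonormalBasis ℂ u.H) (stdOrthonormalBasis ℂ v.H))]
  refine Eq.trans ?_ (sum_mul_aux _ _ _ _ c d hR hT)
  refine Finset.sum_congr rfl fun p _ => ?_
  have h : (stdOrthonormalBasis ℂ u.H).tensorProduct (stdOrthonormalBasis ℂ v.H) p =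
      stdOrthonormalBasis ℂ u.H p.1 ⊗ₜ[ℂ] stdOrthonormalBasis ℂ v.H p.2 :=
    OrthonormalBasis.tensorProduct_apply _ _ p.1 p.2
  exact congrArg₂ (fun a b => a * star b) (congrArg (SpecMor.mul T R).1 h)
    (congrArg (SpecMor.mul T' R').1 h)

end Spec

/-! ### The inner product on spectral subspaces of ergodic actions -/

section Pos
variable {S : Type u} [CStarAlgebra S]

open scoped ComplexOrder in
lemma nonneg_of_smul_one_eq_sum [Nontrivial S] {ι : Type*} [Fintype ι] (t : ι → S) {c : ℂ}
    (h : ∑ i, t i * star (t i) = c • (1 : S)) : 0 ≤ c.re := by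
  let _ := CStarAlgebra.spectralOrder S
  have := CStarAlgebra.spectralOrderedRing S
  have h1 : 0 ≤ c • (1 : S) := h ▸ Finset.sum_nonneg fun i _ => mul_star_self_nonneg (t i)
  have h2 : 0 ≤ c := by
    refine spectrum_nonneg_of_nonneg (𝕜 := ℂ) h1 ?_
    rw [← Algebra.algebraMap_eq_smul_one]
    simp
  exact (Complex.nonneg_iff.1 h2).1

lemma eq_zero_of_sum_eq_zero {ι : Type*} [Fintype ι] (t : ι → S)
    (h : ∑ i, t i * star (t i) = 0) (i : ι) : t i = 0 := by
  let _ := CStarAlgebra.spectralOrder S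
  have := CStarAlgebra.spectralOrderedRing S
  have := (Finset.sum_eq_zero_iff_of_nonneg
    (fun i _ => mul_star_self_nonneg (t i))).1 h i (Finset.mem_univ i)
  exact (CStarRing.mul_star_self_eq_zero_iff _).1 this

lemma smul_one_inj [Nontrivial S] {c d : ℂ} (h : c • (1 : S) = d • 1) : c = d := by
  rw [← Algebra.algebraMap_eq_smul_one, ← Algebra.algebraMap_eq_smul_one] at h
  exact (algebraMap ℂ S).injective h
end Pos

section Spectral
variable {A : Type u} [CStarAlgebra A] {G : CompactQuantumGroup A}
  {S : Type u} [CStarAlgebra S]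

/-- For an ergodic action, the scalar `c` with `∑ T(eᵢ) R(eᵢ)^* = c 1`. -/
def SpecMor.scalarIp {β : Coaction A S} (hβ : β.IsErgodic) {u : FinRep G}
    (T R : SpecMor u β) : ℂ := (hβ.fixed _ (SpecMor.ip_fixed T R)).choose

lemma SpecMor.scalarIp_spec {β : Coaction A S} (hβ : β.IsErgodic) {u : FinRep G}
    (T R : SpecMor u β) : SpecMor.ip T R = SpecMor.scalarIp hβ T R • (1 : S) :=
  (hβ.fixed _ (SpecMor.ip_fixed T R)).choose_spec

lemma SpecMor.scalarIp_eq {β : Coaction A S} (hβ : β.IsErgodic) {u : FinRep G}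
    (T R : SpecMor u β) {c : ℂ} (h : SpecMor.ip T R = c • (1 : S)) :
    SpecMor.scalarIp hβ T R = c := by
  have := hβ.nontrivial
  exact smul_one_inj ((SpecMor.scalarIp_spec hβ T R).symm.trans h)

/-- The spectral subspace `φ_β(u)` of an ergodic action: `Mor(u, β)` as an inner product space. The
inner product `⟨T, R⟩ = ∑ T(eᵢ) R(eᵢ)^*` is linear in `T`; in order to get a functor that is linear
in the intertwiners, and an inner product that is linear in the second variable, the scalars act
through complex conjugation. -/
def Spectral (u : FinRep G) (β : Coaction A S) (_hβ : β.IsErgodic) : Type u := SpecMor u β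

instance (u : FinRep G) (β : Coaction A S) (hβ : β.IsErgodic) : AddCommGroup (Spectral u β hβ) :=
  inferInstanceAs (AddCommGroup (SpecMor u β))

/-- The conjugate scalar multiplication. -/
instance (u : FinRep G) (β : Coaction A S) (hβ : β.IsErgodic) : Module ℂ (Spectral u β hβ) :=
  Module.compHom (SpecMor u β) (starRingEnd ℂ)

/-- The identity map, from `Mor(u, β)` to the inner product space. -/
def toSpectral {u : FinRep G} {β : Coaction A S} (hβ : β.IsErgodic) :
    SpecMor u β ≃+ Spectral u β hβ := AddEquiv.refl (SpecMor u β)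

lemma toSpectral_smul {u : FinRep G} {β : Coaction A S} (hβ : β.IsErgodic) (c : ℂ)
    (T : SpecMor u β) : toSpectral hβ (c • T) = star c • toSpectral hβ T := by
  change c • T = (starRingEnd ℂ) (star c) • T
  simp

lemma symm_smul {u : FinRep G} {β : Coaction A S} (hβ : β.IsErgodic) (c : ℂ)
    (T : Spectral u β hβ) : (toSpectral hβ).symm (c • T) = star c • (toSpectral hβ).symm T := rfl

/-- The inner product `⟨T, R⟩ = ∑ T(eᵢ) R(eᵢ)^*`. -/
@[reducible]
def spectralCore (u : FinRep G) (β : Coaction A S) (hβ : β.IsErgodic) :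
    InnerProductSpace.Core ℂ (Spectral u β hβ) where
  inner T R := SpecMor.scalarIp hβ ((toSpectral hβ).symm T) ((toSpectral hβ).symm R)
  conj_inner_symm T R := by
    refine (SpecMor.scalarIp_eq hβ _ _ ?_).symm
    rw [← SpecMor.star_ip, SpecMor.scalarIp_spec hβ, star_smul, star_one]
    rfl
  re_inner_nonneg T := by
    have := hβ.nontrivial
    exact nonneg_of_smul_one_eq_sum _ (SpecMor.scalarIp_spec hβ ((toSpectral hβ).symm T) _)
  add_left T T' R := by
    refine SpecMor.scalarIp_eq hβ _ _ ?_
    rw [map_add, SpecMor.ip_add_left, SpecMor.scalarIp_spec hβ, SpecMor.scalarIp_spec hβ, add_smul]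
  smul_left T R c := by
    refine SpecMor.scalarIp_eq hβ _ _ ?_
    rw [symm_smul, SpecMor.ip_smul_left, SpecMor.scalarIp_spec hβ, smul_smul]
    rfl
  definite T h := by
    have h1 := SpecMor.scalarIp_spec hβ ((toSpectral hβ).symm T) ((toSpectral hβ).symm T)
    have h2 : SpecMor.scalarIp hβ ((toSpectral hβ).symm T) ((toSpectral hβ).symm T) = 0 := h
    rw [h2, zero_smul] at h1
    have h3 : (toSpectral hβ).symm T = 0 := Subtype.ext
      ((stdOrthonormalBasis ℂ u.H).toBasis.ext fun i => by
        have := eq_zero_of_sum_eq_zero _ h1 i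
        simpa using this)
    exact h3

instance (u : FinRep G) (β : Coaction A S) (hβ : β.IsErgodic) :
    NormedAddCommGroup (Spectral u β hβ) :=
  @InnerProductSpace.Core.toNormedAddCommGroup ℂ (Spectral u β hβ) _ _ _ (spectralCore u β hβ)

instance (u : FinRep G) (β : Coaction A S) (hβ : β.IsErgodic) :
    InnerProductSpace ℂ (Spectral u β hβ) :=
  InnerProductSpace.ofCore (spectralCore u β hβ).toCore

lemma inner_toSpectral {u : FinRep G} {β : Coaction A S} (hβ : β.IsErgodic) (T R : SpecMor u β) :
    inner ℂ (toSpectral hβ T) (toSpectral hβ R) = SpecMor.scalarIp hβ T R := rfl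

end Spectral

/-! ### Weak unitary tensor functors -/

open FinRep in
/-- A weak unitary tensor functor on `Rep(𝔾)`: a linear `*`-functor `φ` to inner product spaces with
natural associative isometries `ι : φ(u) ⊗ φ(v) → φ(u ⊠ v)`, and with `φ(1) = ℂ`. Compatibility with
finite direct sums follows from linearity. -/
structure WeakUnitaryTensorFunctor {A : Type u} [CStarAlgebra A] (G : CompactQuantumGroup A) where
  obj : FinRep G → Type v
  [normed : ∀ u, NormedAddCommGroup (obj u)]
  [ip : ∀ u, InnerProductSpace ℂ (obj u)]
  map : ∀ {u v : FinRep G}, Mor u v →ₗ[ℂ] obj u →ₗ[ℂ] obj v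
  map_id : ∀ u, map (Mor.id u) = LinearMap.id
  map_comp : ∀ {u v x : FinRep G} (R : Mor v x) (T : Mor u v),
    map (Mor.comp R T) = map R ∘ₗ map T
  /-- `φ(T^*) = φ(T)^*` -/
  map_adj : ∀ {u v : FinRep G} (T : Mor u v) (x : obj u) (y : obj v),
    inner ℂ (map (Mor.adj T) y) x = inner ℂ y (map T x)
  ι : ∀ u v, obj u ⊗[ℂ] obj v →ₗᵢ[ℂ] obj (u.tensor v)
  ι_natural : ∀ {u v u' v' : FinRep G} (T : Mor u u') (R : Mor v v') (x : obj u) (y : obj v),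
    map (Mor.tensor T R) (ι u v (x ⊗ₜ y)) = ι u' v' (map T x ⊗ₜ map R y)
  ι_assoc : ∀ (u v x : FinRep G) (a : obj u) (b : obj v) (c : obj x),
    map (Mor.assoc u v x) (ι (u.tensor v) x (ι u v (a ⊗ₜ b) ⊗ₜ c)) =
      ι u (v.tensor x) (a ⊗ₜ ι v x (b ⊗ₜ c))
  unit : ℂ ≃ₗᵢ[ℂ] obj (triv G)
  ι_unit_left : ∀ u (a : obj u), map (Mor.leftUnit u) (ι (triv G) u (unit 1 ⊗ₜ a)) = a
  ι_unit_right : ∀ u (a : obj u), map (Mor.rightUnit u) (ι u (triv G) (a ⊗ₜ unit 1)) = a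

attribute [instance] WeakUnitaryTensorFunctor.normed WeakUnitaryTensorFunctor.ip

/-- A natural unitary monoidal isomorphism of weak unitary tensor functors. -/
structure NatUnitaryMonoidalIso {A : Type u} [CStarAlgebra A] {G : CompactQuantumGroup A}
    (F F' : WeakUnitaryTensorFunctor.{u, v} G) where
  /-- the unitaries `F(u) ≃ F'(u)` -/
  app : ∀ u, F.obj u ≃ₗᵢ[ℂ] F'.obj u
  natural : ∀ {u v : FinRep G} (T : FinRep.Mor u v) (x : F.obj u),
    app v (F.map T x) = F'.map T (app u x)
  monoidal : ∀ (u v : FinRep G) (x : F.obj u) (y : F.obj v),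
    app (u.tensor v) (F.ι u v (x ⊗ₜ y)) = F'.ι u v (app u x ⊗ₜ app v y)
  unit : ∀ z, app (FinRep.triv G) (F.unit z) = F'.unit z

section SpectralFunctor
variable {A : Type u} [CStarAlgebra A] {G : CompactQuantumGroup A}
  {S : Type u} [CStarAlgebra S] {β : Coaction A S} (hβ : β.IsErgodic)

lemma SpecMor.scalarIp_smul_one {u : FinRep G} (T R : Spectral u β hβ) :
    SpecMor.ip ((toSpectral hβ).symm T) ((toSpectral hβ).symm R) = inner ℂ T R • (1 : S) :=
  SpecMor.scalarIp_spec hβ _ _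

lemma inner_eq {u : FinRep G} {T R : Spectral u β hβ} {c : ℂ}
    (h : SpecMor.ip ((toSpectral hβ).symm T) ((toSpectral hβ).symm R) = c • (1 : S)) :
    inner ℂ T R = c := SpecMor.scalarIp_eq hβ _ _ h

/-- `φ(V)(T) = T ∘ V^*` -/
def Spectral.map {u v : FinRep G} : FinRep.Mor u v →ₗ[ℂ] Spectral u β hβ →ₗ[ℂ] Spectral v β hβ :=
  LinearMap.mk₂ ℂ (fun V T => toSpectral hβ (SpecMor.comp ((toSpectral hβ).symm T) (FinRep.Mor.adj V)))
    (fun V V' T => Subtype.ext (LinearMap.ext fun ξ => by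
      change T.1 (LinearMap.adjoint (V.1 + V'.1) ξ) =
        T.1 (LinearMap.adjoint V.1 ξ) + T.1 (LinearMap.adjoint V'.1 ξ)
      rw [map_add, LinearMap.add_apply, map_add]))
    (fun c V T => Subtype.ext (LinearMap.ext fun ξ => by
      change T.1 (LinearMap.adjoint (c • V.1) ξ) =
        (starRingEnd ℂ c) • T.1 (LinearMap.adjoint V.1 ξ)
      rw [LinearEquiv.map_smulₛₗ, LinearMap.smul_apply, map_smul]))
    (fun V T T' => rfl)
    (fun c V T => rfl)

/-- `ι(T ⊗ R)(ξ ⊗ η) = T(ξ) R(η)` -/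
def Spectral.mul (u v : FinRep G) :
    Spectral u β hβ →ₗ[ℂ] Spectral v β hβ →ₗ[ℂ] Spectral (u.tensor v) β hβ :=
  LinearMap.mk₂ ℂ (fun T R => toSpectral hβ (SpecMor.mul ((toSpectral hβ).symm T)
      ((toSpectral hβ).symm R)))
    (fun T T' R => Subtype.ext (TensorProduct.ext' fun ξ η => by
      change (T.1 ξ + T'.1 ξ) * R.1 η = T.1 ξ * R.1 η + T'.1 ξ * R.1 η
      exact add_mul _ _ _))
    (fun c T R => Subtype.ext (TensorProduct.ext' fun ξ η => by
      change (starRingEnd ℂ c • T.1 ξ) * R.1 η = starRingEnd ℂ c • (T.1 ξ * R.1 η)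
      exact smul_mul_assoc _ _ _))
    (fun T R R' => Subtype.ext (TensorProduct.ext' fun ξ η => by
      change T.1 ξ * (R.1 η + R'.1 η) = T.1 ξ * R.1 η + T.1 ξ * R'.1 η
      exact mul_add _ _ _))
    (fun c T R => Subtype.ext (TensorProduct.ext' fun ξ η => by
      change T.1 ξ * (starRingEnd ℂ c • R.1 η) = starRingEnd ℂ c • (T.1 ξ * R.1 η)
      exact mul_smul_comm _ _ _))

/-- The isometry `φ(u) ⊗ φ(v) → φ(u ⊠ v)`. -/
def Spectral.ι (u v : FinRep G) :
    Spectral u β hβ ⊗[ℂ] Spectral v β hβ →ₗᵢ[ℂ] Spectral (u.tensor v) β hβ :=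
  (TensorProduct.lift (Spectral.mul hβ u v)).isometryOfInner fun x y => by
    induction x using TensorProduct.induction_on with
    | zero => simp
    | add x x' hx hx' => simp only [map_add, inner_add_left, hx, hx']
    | tmul T R =>
      induction y using TensorProduct.induction_on with
      | zero => simp
      | add y y' hy hy' => simp only [map_add, inner_add_right, hy, hy']
      | tmul T' R' =>
        rw [TensorProduct.lift.tmul, TensorProduct.lift.tmul, TensorProduct.inner_tmul]
        exact inner_eq hβ (SpecMor.ip_mul _ _ _ _ _ _ (SpecMor.scalarIp_smul_one hβ R R')
          (SpecMor.scalarIp_smul_one hβ T T'))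

lemma Spectral.ι_tmul (u v : FinRep G) (T : Spectral u β hβ) (R : Spectral v β hβ) :
    Spectral.ι hβ u v (T ⊗ₜ R) = toSpectral hβ (SpecMor.mul ((toSpectral hβ).symm T)
      ((toSpectral hβ).symm R)) := TensorProduct.lift.tmul _ _

lemma Spectral.map_apply {u v : FinRep G} (V : FinRep.Mor u v) (T : Spectral u β hβ) :
    Spectral.map hβ V T =
      toSpectral hβ (SpecMor.comp ((toSpectral hβ).symm T) (FinRep.Mor.adj V)) := rfl

lemma adjoint_isometryEquiv {H K : Type*} [NormedAddCommGroup H] [InnerProductSpace ℂ H]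
    [FiniteDimensional ℂ H] [NormedAddCommGroup K] [InnerProductSpace ℂ K] [FiniteDimensional ℂ K]
    (e : H ≃ₗᵢ[ℂ] K) : LinearMap.adjoint e.toLinearEquiv.toLinearMap =
      e.symm.toLinearEquiv.toLinearMap := by
  refine LinearMap.ext fun y => ext_inner_left ℂ fun x => ?_
  rw [LinearMap.adjoint_inner_right]
  change inner ℂ (e x) y = inner ℂ x (e.symm y)
  rw [← e.inner_map_map x, e.apply_symm_apply]

/-- `z ↦ (w ↦ w z̄ 1)`, which is linear for the conjugate scalar multiplication. -/
def Spectral.unitMap (G : CompactQuantumGroup A) (hβ : β.IsErgodic) :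
    ℂ →ₗ[ℂ] Spectral (FinRep.triv G) β hβ where
  toFun z := toSpectral hβ (SpecMor.unit G β (star z))
  map_add' z z' := Subtype.ext (LinearMap.ext fun (w : ℂ) => by
    change w • (star (z + z') • (1 : S)) = w • (star z • (1 : S)) + w • (star z' • (1 : S))
    rw [star_add, add_smul, smul_add])
  map_smul' c z := Subtype.ext (LinearMap.ext fun (w : ℂ) => by
    change w • (star (c * z) • (1 : S)) = star c • (w • (star z • (1 : S)))
    rw [star_mul', mul_smul, smul_comm])

lemma Spectral.inner_unitMap (z z' : ℂ) :
    inner ℂ (Spectral.unitMap G hβ z) (Spectral.unitMap G hβ z') = inner ℂ z z' := by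
  refine inner_eq hβ ?_
  rw [SpecMor.ip_eq _ _ (OrthonormalBasis.singleton Unit ℂ)]
  change ∑ i : Unit, (OrthonormalBasis.singleton Unit ℂ i • (star z • (1 : S))) *
    star (OrthonormalBasis.singleton Unit ℂ i • (star z' • (1 : S))) = _
  simp [smul_smul]

lemma Spectral.unitMap_surjective : Function.Surjective (Spectral.unitMap G hβ) := fun T => by
  have h : β.map (T.1 (1 : ℂ)) = β.emb (T.1 (1 : ℂ) ⊗ₜ[ℂ] (1 : A)) := by
    have h1 : (FinRep.triv G).δ (1 : ℂ) = (1 : ℂ) ⊗ₜ[ℂ] (1 : A) := FinRep.δ_triv 1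
    exact (T.2 (1 : ℂ)).trans (by rw [h1]; rfl)
  obtain ⟨c, hc⟩ := hβ.fixed _ h
  refine ⟨star c, Subtype.ext (LinearMap.ext_ring ?_)⟩
  change (1 : ℂ) • (star (star c) • (1 : S)) = T.1 (1 : ℂ)
  rw [hc, star_star, one_smul]

/-- The identification `ℂ = φ(1)`. -/
def Spectral.unit (G : CompactQuantumGroup A) (hβ : β.IsErgodic) :
    ℂ ≃ₗᵢ[ℂ] Spectral (FinRep.triv G) β hβ :=
  LinearIsometryEquiv.ofSurjective
    ((Spectral.unitMap G hβ).isometryOfInner (Spectral.inner_unitMap hβ))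
    (Spectral.unitMap_surjective hβ)

/-- The spectral functor `φ_β` of an ergodic action: `φ_β(u) = Mor(u, β)`,
`φ_β(V)(T) = T ∘ V^*` and `ι(T ⊗ R)(ξ ⊗ η) = T(ξ) R(η)`. -/
def spectralFunctor (G : CompactQuantumGroup A) {S : Type u} [CStarAlgebra S] (β : Coaction A S)
    (hβ : β.IsErgodic) : WeakUnitaryTensorFunctor.{u, u} G where
  obj u := Spectral u β hβ
  map := Spectral.map hβ
  map_id u := LinearMap.ext fun T => Subtype.ext (LinearMap.ext fun ξ => by
    change T.1 (LinearMap.adjoint LinearMap.id ξ) = T.1 ξ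
    rw [LinearMap.adjoint_id]
    rfl)
  map_comp R V := LinearMap.ext fun T => Subtype.ext (LinearMap.ext fun ξ => by
    change T.1 (LinearMap.adjoint (R.1 ∘ₗ V.1) ξ) =
      T.1 (LinearMap.adjoint V.1 (LinearMap.adjoint R.1 ξ))
    rw [LinearMap.adjoint_comp]
    rfl)
  map_adj V x y := inner_eq hβ ((SpecMor.ip_comp ((toSpectral hβ).symm y)
    ((toSpectral hβ).symm x) (FinRep.Mor.adj V)).trans
    (SpecMor.scalarIp_smul_one hβ y (Spectral.map hβ V x)))
  ι := Spectral.ι hβ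
  ι_natural {u v u' v'} V W T R := by
    rw [Spectral.ι_tmul, Spectral.ι_tmul]
    refine Subtype.ext (TensorProduct.ext' fun ξ η => ?_)
    change (LinearMap.mul' ℂ S ∘ₗ TensorProduct.map T.1 R.1)
      (LinearMap.adjoint (TensorProduct.map V.1 W.1) (ξ ⊗ₜ[ℂ] η)) =
        T.1 (LinearMap.adjoint V.1 ξ) * R.1 (LinearMap.adjoint W.1 η)
    rw [TensorProduct.adjoint_map]
    rfl
  ι_assoc u v x a b c := by
    rw [Spectral.ι_tmul, Spectral.ι_tmul, Spectral.ι_tmul, Spectral.ι_tmul]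
    refine Subtype.ext (LinearMap.ext fun ζ => ?_)
    change (LinearMap.mul' ℂ S ∘ₗ TensorProduct.map (LinearMap.mul' ℂ S ∘ₗ
        TensorProduct.map a.1 b.1) c.1)
      (LinearMap.adjoint (TensorProduct.assocIsometry ℂ u.H v.H x.H).toLinearEquiv.toLinearMap ζ) =
      (LinearMap.mul' ℂ S ∘ₗ TensorProduct.map a.1 (LinearMap.mul' ℂ S ∘ₗ
        TensorProduct.map b.1 c.1)) ζ
    rw [adjoint_isometryEquiv]
    revert ζ
    refine fun ζ => LinearMap.congr_fun (f := (LinearMap.mul' ℂ S ∘ₗ TensorProduct.map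
      (LinearMap.mul' ℂ S ∘ₗ TensorProduct.map a.1 b.1) c.1) ∘ₗ
        (TensorProduct.assocIsometry ℂ u.H v.H x.H).symm.toLinearEquiv.toLinearMap) ?_ ζ
    refine TensorProduct.ext' fun ξ ζ => ?_
    induction ζ using TensorProduct.induction_on with
    | zero => simp only [TensorProduct.tmul_zero, map_zero]
    | add ζ ζ' h h' => simp only [TensorProduct.tmul_add, map_add, h, h']
    | tmul η ζ => exact mul_assoc _ _ _
  unit := Spectral.unit G hβ
  ι_unit_left u a := by
    rw [Spectral.ι_tmul]
    refine Subtype.ext (LinearMap.ext fun ξ => ?_)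
    change (LinearMap.mul' ℂ S ∘ₗ TensorProduct.map
      (LinearMap.toSpanSingleton ℂ S (star (1 : ℂ) • 1)) a.1)
      (LinearMap.adjoint (TensorProduct.lidIsometry ℂ u.H).toLinearEquiv.toLinearMap ξ) = a.1 ξ
    rw [adjoint_isometryEquiv]
    change ((1 : ℂ) • (star (1 : ℂ) • (1 : S))) * a.1 ξ = a.1 ξ
    rw [star_one, one_smul, one_smul, one_mul]
  ι_unit_right u a := by
    rw [Spectral.ι_tmul]
    refine Subtype.ext (LinearMap.ext fun ξ => ?_)
    change (LinearMap.mul' ℂ S ∘ₗ TensorProduct.map a.1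
      (LinearMap.toSpanSingleton ℂ S (star (1 : ℂ) • 1)))
      (LinearMap.adjoint (TensorProduct.ridIsometry ℂ u.H).toLinearEquiv.toLinearMap ξ) = a.1 ξ
    rw [adjoint_isometryEquiv]
    change a.1 ξ * ((1 : ℂ) • (star (1 : ℂ) • (1 : S))) = a.1 ξ
    rw [star_one, one_smul, one_smul, mul_one]

end SpectralFunctor

section Restriction
variable {A A' : Type u} [CStarAlgebra A] [CStarAlgebra A'] {G : CompactQuantumGroup A}
  {H : CompactQuantumGroup A'}

namespace WeakUnitaryTensorFunctor

lemma map_map (F : WeakUnitaryTensorFunctor.{u, v} G) {u v x : FinRep G} (R : FinRep.Mor v x)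
    (T : FinRep.Mor u v) (a : F.obj u) : F.map R (F.map T a) = F.map (FinRep.Mor.comp R T) a := by
  rw [F.map_comp]; rfl

lemma map_id_apply (F : WeakUnitaryTensorFunctor.{u, v} G) {u : FinRep G} (a : F.obj u) :
    F.map (FinRep.Mor.id u) a = a := by
  rw [F.map_id]; rfl

/-- The image of a unitary intertwiner. -/
def unitaryMap (F : WeakUnitaryTensorFunctor.{u, v} G) {u v : FinRep G} (V : FinRep.Mor u v)
    (h1 : FinRep.Mor.comp (FinRep.Mor.adj V) V = FinRep.Mor.id u)
    (h2 : FinRep.Mor.comp V (FinRep.Mor.adj V) = FinRep.Mor.id v) : F.obj u ≃ₗᵢ[ℂ] F.obj v :=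
  LinearIsometryEquiv.ofSurjective ((F.map V).isometryOfInner fun x y => by
    rw [← F.map_adj, map_map, h1, map_id_apply]) fun y =>
    ⟨F.map (FinRep.Mor.adj V) y, by
      change F.map V (F.map (FinRep.Mor.adj V) y) = y
      rw [map_map, h2, map_id_apply]⟩

lemma unitaryMap_apply (F : WeakUnitaryTensorFunctor.{u, v} G) {u v : FinRep G}
    (V : FinRep.Mor u v) (h1 : FinRep.Mor.comp (FinRep.Mor.adj V) V = FinRep.Mor.id u)
    (h2 : FinRep.Mor.comp V (FinRep.Mor.adj V) = FinRep.Mor.id v) (x : F.obj u) :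
    F.unitaryMap V h1 h2 x = F.map V x := rfl

end WeakUnitaryTensorFunctor

namespace FinRep.Mor

/-- Restriction of intertwiners as a linear map. -/
def resₗ (P : QuantumSubgroup G H) (u v : FinRep G) : Mor u v →ₗ[ℂ] Mor (u.res P) (v.res P) where
  toFun := Mor.res P
  map_add' _ _ := rfl
  map_smul' _ _ := rfl

lemma adjoint_id_aux {V : Type*} [NormedAddCommGroup V] [InnerProductSpace ℂ V]
    [FiniteDimensional ℂ V] :
    LinearMap.adjoint (LinearMap.id : V →ₗ[ℂ] V) ∘ₗ LinearMap.id = LinearMap.id := by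
  rw [LinearMap.adjoint_id]; rfl

lemma adjoint_id_aux' {V : Type*} [NormedAddCommGroup V] [InnerProductSpace ℂ V]
    [FiniteDimensional ℂ V] :
    LinearMap.id ∘ₗ LinearMap.adjoint (LinearMap.id : V →ₗ[ℂ] V) = LinearMap.id := by
  rw [LinearMap.adjoint_id]; rfl

lemma resTensor_unitary (P : QuantumSubgroup G H) (u v : FinRep G) :
    Mor.comp (Mor.adj (Mor.resTensor P u v)) (Mor.resTensor P u v) = Mor.id _ :=
  Subtype.ext (adjoint_id_aux (V := u.H ⊗[ℂ] v.H))

lemma resTensor_unitary' (P : QuantumSubgroup G H) (u v : FinRep G) :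
    Mor.comp (Mor.resTensor P u v) (Mor.adj (Mor.resTensor P u v)) = Mor.id _ :=
  Subtype.ext (adjoint_id_aux' (V := u.H ⊗[ℂ] v.H))

lemma resTriv_unitary (P : QuantumSubgroup G H) :
    Mor.comp (Mor.adj (Mor.resTriv P)) (Mor.resTriv P) = Mor.id _ :=
  Subtype.ext (adjoint_id_aux (V := ℂ))

lemma resTriv_unitary' (P : QuantumSubgroup G H) :
    Mor.comp (Mor.resTriv P) (Mor.adj (Mor.resTriv P)) = Mor.id _ :=
  Subtype.ext (adjoint_id_aux' (V := ℂ))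

end FinRep.Mor

open FinRep in
/-- The composition `φ ∘ Res`, on `Rep(𝔾)`, of a weak unitary tensor functor `φ` on `Rep(ℍ)` with
the restriction functor. -/
def WeakUnitaryTensorFunctor.compRes (F : WeakUnitaryTensorFunctor.{u, v} H)
    (P : QuantumSubgroup G H) : WeakUnitaryTensorFunctor.{u, v} G where
  obj u := F.obj (u.res P)
  map {u v} := F.map ∘ₗ Mor.resₗ P u v
  map_id u := F.map_id (u.res P)
  map_comp R T := F.map_comp (Mor.res P R) (Mor.res P T)
  map_adj T := F.map_adj (Mor.res P T)
  ι u v := (F.unitaryMap (Mor.resTensor P u v) (Mor.resTensor_unitary P u v)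
    (Mor.resTensor_unitary' P u v)).toLinearIsometry.comp (F.ι (u.res P) (v.res P))
  ι_natural {u v u' v'} T R x y := by
    change F.map (Mor.res P (Mor.tensor T R)) (F.map (Mor.resTensor P u v) (F.ι _ _ (x ⊗ₜ y))) =
      F.map (Mor.resTensor P u' v') (F.ι _ _ (F.map (Mor.res P T) x ⊗ₜ F.map (Mor.res P R) y))
    rw [← F.ι_natural, F.map_map, F.map_map]
    rfl
  ι_assoc u v x a b c := by
    change F.map (Mor.res P (Mor.assoc u v x)) (F.map (Mor.resTensor P (u.tensor v) x)
        (F.ι _ _ (F.map (Mor.resTensor P u v) (F.ι _ _ (a ⊗ₜ b)) ⊗ₜ c))) =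
      F.map (Mor.resTensor P u (v.tensor x))
        (F.ι _ _ (a ⊗ₜ F.map (Mor.resTensor P v x) (F.ι _ _ (b ⊗ₜ c))))
    have h1 := F.ι_natural (Mor.resTensor P u v) (Mor.id (x.res P)) (F.ι _ _ (a ⊗ₜ b)) c
    have h2 := F.ι_natural (Mor.id (u.res P)) (Mor.resTensor P v x) a (F.ι _ _ (b ⊗ₜ c))
    rw [F.map_id_apply] at h1 h2
    rw [← h1, ← h2, ← F.ι_assoc, F.map_map, F.map_map, F.map_map, F.map_map]
    congr 2
    refine Subtype.ext (TensorProduct.ext_threefold fun ξ η ζ => ?_)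
    rfl
  unit := F.unit.trans (F.unitaryMap (Mor.resTriv P) (Mor.resTriv_unitary P)
    (Mor.resTriv_unitary' P))
  ι_unit_left u a := by
    change F.map (Mor.res P (Mor.leftUnit u)) (F.map (Mor.resTensor P (triv G) u)
      (F.ι _ _ (F.map (Mor.resTriv P) (F.unit 1) ⊗ₜ a))) = a
    have h1 := F.ι_natural (Mor.resTriv P) (Mor.id (u.res P)) (F.unit 1) a
    rw [F.map_id_apply] at h1
    rw [← h1, F.map_map, F.map_map]
    refine Eq.trans ?_ (F.ι_unit_left (u.res P) a)
    congr 2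
    exact Subtype.ext (TensorProduct.ext' fun z ξ => rfl)
  ι_unit_right u a := by
    change F.map (Mor.res P (Mor.rightUnit u)) (F.map (Mor.resTensor P u (triv G))
      (F.ι _ _ (a ⊗ₜ F.map (Mor.resTriv P) (F.unit 1)))) = a
    have h1 := F.ι_natural (Mor.id (u.res P)) (Mor.resTriv P) a (F.unit 1)
    rw [F.map_id_apply] at h1
    rw [← h1, F.map_map, F.map_map]
    refine Eq.trans ?_ (F.ι_unit_right (u.res P) a)
    congr 2
    exact Subtype.ext (TensorProduct.ext' fun z ξ => rfl)

end Restriction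

end QG

end

/-! Write `u_{ξη}` for the matrix coefficients of `u` and `e_k` for an orthonormal basis of `H_u`.
The bijection is explicit: `T` goes to `(T ⊗ id) ∘ δ_u`, whose value at `ξ` is `∑ T(e_k) ⊗ u_{kξ}`
in `B ⊗ C(𝔾)` (`toTensor`). Each of the two homomorphisms defining `Ind(B)` turns this element into
a sum `∑ d(e_k) ⊗ u_{kξ}`, with `d = α ∘ T` for the first and `d = (T ⊗ id) ∘ δ_{Res(u)}` for the
second. Since `u` is unitary, such a sum determines `d` (`eq_of_sum_leg12`), so the values lie in
`Ind(B)` exactly when `T` is `ℍ`-equivariant (`toTensor_mem_ind_iff`). The same cancellation gives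
injectivity and the identity for inner products. Equivariance under `𝔾` is the formula `Δ(u_{ξη}) =
∑ u_{ξk} ⊗ u_{kη}`; naturality and multiplicativity are formal.

Surjectivity is the substantial point. Given an equivariant `S : H_u → Ind(B)`, multiply by `u^*` to
form `η ↦ ∑ S(e_j)(1 ⊗ u_{ηj}^*)` (`untwist`). Its values are fixed by `id ⊗ Δ`, hence of the form
`b ⊗ 1`, and `η ↦ b` is the preimage of `S` (`exists_toTensor_eq`). Ergodicity rests on the same
fact: a fixed point of `Ind(B)` is some `b ⊗ 1`, and membership in `Ind(B)` then says `α(b) = b ⊗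
1`.

That the fixed points of `id ⊗ Δ` are the elements `b ⊗ 1` (`exists_eq_left`) would follow by
integrating against the Haar state. Less is enough: for any two states `ρ` and `σ` there is a state
`h` with `ρ * h = h = σ * h` (`exists_common_absorbing_state`). Slicing `(id ⊗ Δ)(x) = x ⊗ 1` by `φ
⊗ h` gives `(id ⊗ φ)(x) = (id ⊗ (φ * h))(x)`, so the slices of `x` by `ρ` and by `σ` agree; as `σ`
is arbitrary, `x = b ⊗ 1` with `b = (id ⊗ ρ)(x)`. The state `h` is a limit of Cesàro means of
convolution powers of `ω = (ρ + σ)/2`. It absorbs `ω`, and the step from `ω` to `ρ` and `σ` is a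
Cauchy-Schwarz argument followed by the density of `Δ(A)(A ⊗ 1)`, as in the construction of the Haar
state (`apply_mul_convR`, `conv_eq_of_absorbing`).

Identities in completed tensor products are reduced to scalars by states. The GNS construction makes
the slice maps `id ⊗ φ` contractive for the minimal norm, slices by states separate points
(`eq_of_sliceR`), and an identity in a triple tensor product passes to iterated slices
(`assoc_slice`) with no appeal to injectivity of the two bracketing maps. -/

noncomputable section

namespace QG

/-! ### States of a C*-algebra, the GNS representation, and separation of points -/

section States
variable {A : Type u} [CStarAlgebra A]

/-- A state: a unital contractive functional. -/
structure IsState (φ : A →ₗ[ℂ] ℂ) : Prop where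
  apply_one : φ 1 = 1
  norm_le : ∀ a, ‖φ a‖ ≤ ‖a‖

/-- Positivity is not part of the definition of a state here, so reality on self-adjoint elements
has to come from contractivity, by translating `b` along the imaginary axis. -/
lemma IsState.im_eq_zero {φ : A →ₗ[ℂ] ℂ} (hφ : IsState φ) {b : A} (hb : IsSelfAdjoint b) :
    (φ b).im = 0 := by
  -- The C*-identity gives `‖b + it‖² ≤ ‖b‖² + t²`, while the imaginary part of `φ(b + it)` is `Im
  -- φ(b) + t`; the `t²` cancels and a bound linear in `t` remains.
  have key : ∀ t : ℝ, 2 * t * (φ b).im ≤ ‖b‖ ^ 2 := fun t => by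
    have : Nontrivial A := nontrivial_of_ne (1 : A) 0 fun h => by
      have := hφ.apply_one
      rw [h, map_zero] at this
      exact zero_ne_one this
    set z : ℂ := t * Complex.I
    have h1 : ‖φ (b + z • 1)‖ ^ 2 ≤ ‖b‖ ^ 2 + t ^ 2 := by
      have h2 : star (b + z • (1 : A)) * (b + z • 1) = b * b + ((t ^ 2 : ℝ) : ℂ) • 1 := by
        have hz : star z = -z := by simp [z]
        have hzz : z * z = -((t ^ 2 : ℝ) : ℂ) := by
          simp only [z]; push_cast; ring_nf; simp
        rw [star_add, hb.star_eq, star_smul, star_one, hz, add_mul, mul_add, mul_add,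
          smul_mul_smul_comm, one_mul, neg_mul, hzz, neg_neg]
        simp only [neg_smul, mul_smul_comm, smul_mul_assoc, mul_one, neg_mul, one_mul]
        abel
      calc ‖φ (b + z • 1)‖ ^ 2 ≤ ‖b + z • (1 : A)‖ ^ 2 := by gcongr; exact hφ.norm_le _
        _ = ‖b * b + ((t ^ 2 : ℝ) : ℂ) • (1 : A)‖ := by rw [sq, ← CStarRing.norm_star_mul_self, h2]
        _ ≤ ‖b * b‖ + ‖((t ^ 2 : ℝ) : ℂ) • (1 : A)‖ := norm_add_le _ _
        _ ≤ ‖b‖ ^ 2 + t ^ 2 := by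
          rw [norm_smul, norm_one, mul_one, Complex.norm_real, Real.norm_of_nonneg (sq_nonneg t)]
          gcongr
          rw [sq]; exact norm_mul_le _ _
    rw [map_add, map_smul, hφ.apply_one, ← Complex.normSq_eq_norm_sq, Complex.normSq_apply] at h1
    simp [z] at h1
    nlinarith [sq_nonneg (φ b).re, sq_nonneg (φ b).im]
  by_contra hne
  -- This `t` makes the left side equal to `‖b‖² + 1`, which exceeds the bound.
  have h := key ((‖b‖ ^ 2 + 1) / (2 * (φ b).im))
  have h2 : 2 * ((‖b‖ ^ 2 + 1) / (2 * (φ b).im)) * (φ b).im = ‖b‖ ^ 2 + 1 := by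
    field_simp
  linarith

/-- From `0 ≤ ‖b‖ - b ≤ ‖b‖` the element `‖b‖ - b` has norm at most `‖b‖`, so contractivity keeps
`φ(b)` within distance `‖b‖` of the number `‖b‖`. -/
lemma IsState.nonneg [PartialOrder A] [StarOrderedRing A] {φ : A →ₗ[ℂ] ℂ} (hφ : IsState φ) {b : A}
    (hb : 0 ≤ b) : 0 ≤ (φ b).re := by
  have h1 : ‖algebraMap ℝ A ‖b‖ - b‖ ≤ ‖b‖ := by
    have h0 : b ≤ algebraMap ℝ A ‖b‖ := IsSelfAdjoint.le_algebraMap_norm_self (.of_nonneg hb)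
    refine (CStarAlgebra.norm_le_norm_of_nonneg_of_le (sub_nonneg.2 h0)
      (sub_le_self (algebraMap ℝ A ‖b‖) hb)).trans ?_
    rw [Algebra.algebraMap_eq_smul_one, norm_smul, Real.norm_of_nonneg (norm_nonneg b)]
    rcases subsingleton_or_nontrivial A with h | h
    · simp [Subsingleton.elim (1 : A) 0]
    · rw [norm_one, mul_one]
  have h2 : φ (algebraMap ℝ A ‖b‖) = ‖b‖ := by
    have : algebraMap ℝ A ‖b‖ = ((‖b‖ : ℝ) : ℂ) • (1 : A) := by
      rw [Algebra.algebraMap_eq_smul_one, Complex.coe_smul]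
    rw [this, map_smul, hφ.apply_one, smul_eq_mul, mul_one]
  have h3 := (Complex.abs_re_le_norm _).trans ((hφ.norm_le _).trans h1)
  rw [map_sub, h2] at h3
  simp only [Complex.sub_re, Complex.ofReal_re] at h3
  linarith [(abs_le.1 h3).2]

open scoped ComplexOrder in
/-- The GNS representation of a state. -/
lemma IsState.exists_repn {φ : A →ₗ[ℂ] ℂ} (hφ : IsState φ) :
    ∃ (i : Repn A) (η : i.H), ∀ a, φ a = inner ℂ η (i.rep a η) := by
  let _ := CStarAlgebra.spectralOrder A
  have := CStarAlgebra.spectralOrderedRing A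
  let f : A →ₚ[ℂ] ℂ := PositiveLinearMap.mk₀ φ fun a ha => Complex.nonneg_iff.2
    ⟨hφ.nonneg ha, (hφ.im_eq_zero (.of_nonneg ha)).symm⟩
  -- The cyclic vector is the class of `1` in the GNS space.
  refine ⟨⟨f.GNS, f.gnsStarAlgHom⟩, ((f.toPreGNS 1 : f.PreGNS) : f.GNS), fun a => ?_⟩
  change φ a = inner ℂ ((f.toPreGNS 1 : f.PreGNS) : f.GNS)
    (f.gnsNonUnitalStarAlgHom a ((f.toPreGNS 1 : f.PreGNS) : f.GNS))
  rw [PositiveLinearMap.gnsNonUnitalStarAlgHom_apply_coe, UniformSpace.Completion.inner_coe,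
    PositiveLinearMap.preGNS_inner_def]
  simp
  rfl

lemma isState_of_repn (i : Repn A) {η : i.H} (hη : ‖η‖ = 1) {φ : A →ₗ[ℂ] ℂ}
    (h : ∀ a, φ a = inner ℂ η (i.rep a η)) : IsState φ where
  apply_one := by
    rw [h, map_one]
    change inner ℂ η η = 1
    rw [inner_self_eq_norm_sq_to_K, hη]; simp
  norm_le a := by
    rw [h]
    refine (norm_inner_le_norm _ _).trans ?_
    rw [hη, one_mul]
    refine ((i.rep a).le_opNorm η).trans ?_
    rw [hη, mul_one]
    exact i.norm_rep_le a

/-- The functional `a ↦ ⟨η, ρ(a) η⟩`. -/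
def repnVec (i : Repn A) (η : i.H) : A →ₗ[ℂ] ℂ where
  toFun a := inner ℂ η (i.rep a η)
  map_add' a b := by rw [map_add, add_apply, inner_add_right]
  map_smul' c a := by
    rw [map_smul, smul_apply, inner_smul_right, RingHom.id_apply, smul_eq_mul]

lemma IsState.apply_star {φ : A →ₗ[ℂ] ℂ} (hφ : IsState φ) (a : A) : φ (star a) = star (φ a) := by
  obtain ⟨i, η, h⟩ := hφ.exists_repn
  rw [h, h, map_star, ContinuousLinearMap.star_eq_adjoint, ContinuousLinearMap.adjoint_inner_right,
    Complex.star_def, inner_conj_symm]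

lemma IsState.norm_vec {φ : A →ₗ[ℂ] ℂ} (hφ : IsState φ) {i : Repn A} {η : i.H}
    (h : ∀ a, φ a = inner ℂ η (i.rep a η)) : ‖η‖ = 1 := by
  have h1 := h 1
  rw [hφ.apply_one, map_one] at h1
  change 1 = inner ℂ η η at h1
  rw [inner_self_eq_norm_sq_to_K] at h1
  rw [RCLike.ofReal_eq_complex_ofReal] at h1
  have h2 : ‖η‖ ^ 2 = 1 := by exact_mod_cast h1.symm
  nlinarith [norm_nonneg η]

/-- A Hahn-Banach functional norming `1 + a^*a` is automatically a state: its values at `1` and at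
`a^*a` are bounded by `1` and `‖a‖²`, and their sum is `1 + ‖a‖²`, so both bounds are attained. -/
lemma exists_isState_norm [Nontrivial A] (a : A) :
    ∃ φ : A →ₗ[ℂ] ℂ, IsState φ ∧ φ (star a * a) = ((‖a‖ ^ 2 : ℝ) : ℂ) := by
  let _ := CStarAlgebra.spectralOrder A
  have := CStarAlgebra.spectralOrderedRing A
  set p := star a * a with hp
  have hp0 : 0 ≤ p := star_mul_self_nonneg a
  have hpn : ‖p‖ = ‖a‖ ^ 2 := by rw [hp, CStarRing.norm_star_mul_self, sq]
  -- The norm is additive here because `‖p‖` lies in the spectrum of the positive element `p`, so `1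
  -- + ‖p‖` lies in the spectrum of `1 + p`.
  have hn : ‖1 + p‖ = 1 + ‖p‖ := by
    refine le_antisymm ((norm_add_le _ _).trans (by rw [norm_one])) ?_
    have h1 : ‖p‖ + 1 ∈ spectrum ℝ (p + 1) := by
      have h2 := CStarAlgebra.norm_mem_spectrum_of_nonneg hp0
      have h3 := spectrum.add_mem_add_iff (R := ℝ) (a := p) (r := ‖p‖) (s := 1)
      rw [map_one, add_comm 1 p] at h3
      exact h3.2 h2
    have h2 := spectrum.norm_le_norm_of_mem h1
    rw [Real.norm_of_nonneg (by positivity), add_comm p] at h2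
    linarith
  obtain ⟨g, hg1, hg2⟩ := exists_dual_vector'' ℂ (1 + p)
  have hle : ∀ x, ‖g x‖ ≤ ‖x‖ := fun x => (g.le_opNorm x).trans
    (mul_le_of_le_one_left (norm_nonneg x) hg1)
  rw [hn, map_add] at hg2
  have h1 := hle 1
  have h2 := hle p
  rw [norm_one] at h1
  have hre := congrArg Complex.re hg2
  simp only [Complex.add_re, RCLike.ofReal_eq_complex_ofReal, Complex.ofReal_re] at hre
  have h1' := Complex.re_le_norm (g 1)
  have h2' := Complex.re_le_norm (g p)
  have e1 : g 1 = 1 := by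
    have : (g 1).re = ‖g 1‖ := by linarith
    have h3 := Complex.re_eq_norm.1 this
    have h4 : (g 1).re = 1 := by linarith
    exact Complex.ext h4 (Complex.nonneg_iff.1 h3).2.symm
  refine ⟨g.toLinearMap, ⟨e1, hle⟩, ?_⟩
  change g p = _
  rw [e1] at hg2
  rw [← hpn]
  have : (1 : ℂ) + g p = 1 + (‖p‖ : ℂ) := by
    rw [hg2]; simp
  exact add_left_cancel this

/-- The norm of a C*-algebra is determined by its representations. -/
lemma norm_le_of_repn {a : A} {M : ℝ} (hM : 0 ≤ M) (h : ∀ i : Repn A, ‖i.rep a‖ ≤ M) : ‖a‖ ≤ M := by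
  rcases subsingleton_or_nontrivial A with hs | hs
  · rw [Subsingleton.elim a 0, norm_zero]; exact hM
  -- The unit GNS vector `η` of this state satisfies `‖ρ(a)η‖ = ‖a‖`, so one representation already
  -- attains the norm.
  obtain ⟨φ, hφ, hφa⟩ := exists_isState_norm a
  obtain ⟨i, η, hi⟩ := hφ.exists_repn
  have hη := hφ.norm_vec hi
  rw [hi, map_mul, map_star] at hφa
  have h1 : inner ℂ η ((star (i.rep a) * i.rep a) η) = ((‖i.rep a η‖ ^ 2 : ℝ) : ℂ) := by
    rw [mul_apply_eq_comp, ContinuousLinearMap.star_eq_adjoint,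
      ContinuousLinearMap.adjoint_inner_right, inner_self_eq_norm_sq_to_K]
    simp
  rw [h1] at hφa
  have h2 : ‖i.rep a η‖ ^ 2 = ‖a‖ ^ 2 := by exact_mod_cast hφa
  have h3 : ‖i.rep a η‖ = ‖a‖ := by
    rwa [sq_eq_sq₀ (norm_nonneg _) (norm_nonneg _)] at h2
  rw [← h3]
  refine ((i.rep a).le_opNorm η).trans ?_
  rw [hη, mul_one]
  exact h i

lemma eq_of_repn {a b : A} (h : ∀ i : Repn A, i.rep a = i.rep b) : a = b := by
  have : ‖a - b‖ ≤ 0 := norm_le_of_repn le_rfl fun i => by rw [map_sub, h, sub_self, norm_zero]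
  exact sub_eq_zero.1 (norm_le_zero_iff.1 this)

/-- Over `ℂ` the quadratic form determines the operator by polarization; scaling reduces to unit
vectors, which are the ones that define states. -/
lemma clm_eq_zero_of_unit {V : Type*} [NormedAddCommGroup V] [InnerProductSpace ℂ V]
    {T : V →L[ℂ] V} (h : ∀ η : V, ‖η‖ = 1 → inner ℂ η (T η) = 0) : T = 0 := by
  have h1 : (T : V →ₗ[ℂ] V) = 0 := by
    rw [← inner_map_self_eq_zero]
    intro η
    rcases eq_or_ne η 0 with rfl | hη
    · simp
    have h2 := h ((‖η‖⁻¹ : ℂ) • η) (by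
      rw [norm_smul]; simp [norm_ne_zero_iff.2 hη])
    rw [map_smul, inner_smul_left, inner_smul_right] at h2
    have h3 : (‖η‖⁻¹ : ℂ) ≠ 0 := by simpa using hη
    have h4 : inner ℂ η (T η) = 0 := by simpa [hη] using h2
    rw [← inner_conj_symm, ContinuousLinearMap.coe_coe, h4, map_zero]
  ext x
  exact LinearMap.congr_fun h1 x

/-- States separate the points of a C*-algebra. -/
lemma eq_of_isState {a b : A} (h : ∀ φ : A →ₗ[ℂ] ℂ, IsState φ → φ a = φ b) : a = b := by
  refine eq_of_repn fun i => sub_eq_zero.1 (clm_eq_zero_of_unit fun η hη => ?_)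
  rw [sub_apply, inner_sub_right]
  have h1 : inner ℂ η (i.rep a η) = inner ℂ η (i.rep b η) :=
    h (repnVec i η) (isState_of_repn i hη fun _ => rfl)
  rw [h1, sub_self]

end States

/-! ### Slice maps on the minimal tensor product -/

section Slices
variable {A B C B' : Type u} [CStarAlgebra A] [CStarAlgebra B] [CStarAlgebra C] [CStarAlgebra B']

/-- A linear map dominated by the seminorm of a family extends to the completion. -/
lemma RepFamily.exists_linearLift {X : Type u} [Ring X] [StarRing X] [Algebra ℂ X] [StarModule ℂ X]
    (F : RepFamily X) {W : Type*} [NormedAddCommGroup W] [NormedSpace ℂ W] [CompleteSpace W]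
    (f : X →ₗ[ℂ] W) (hf : ∀ x, ‖f x‖ ≤ F.nrm x) :
    ∃ s : F.Cstar →L[ℂ] W, (∀ x, s (F.of x) = f x) ∧ ∀ x, ‖s x‖ ≤ ‖x‖ := by
  let f' : F.Pre →L[ℂ] W := LinearMap.mkContinuous (σ := RingHom.id ℂ) (E := F.Pre)
    { toFun := f, map_add' := f.map_add, map_smul' := f.map_smul } 1 fun x => by
      rw [one_mul]; exact hf x
  let s : F.Cstar →L[ℂ] W := f'.extend (UniformSpace.Completion.toComplL (𝕜 := ℂ) (E := F.Pre))
  have hs : ∀ x, s (F.of x) = f x := fun x =>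
    ContinuousLinearMap.extend_eq (e := UniformSpace.Completion.toComplL (𝕜 := ℂ) (E := F.Pre)) f'
      UniformSpace.Completion.denseRange_coe
      (UniformSpace.Completion.isUniformInducing_coe F.Pre) x
  refine ⟨s, hs, fun x => F.induction (fun x => ‖s x‖ ≤ ‖x‖) x
    (isClosed_le s.continuous.norm continuous_norm) fun x => ?_⟩
  rw [hs, F.norm_of]
  exact hf x

lemma MinTensor.induction_tmul {p : MinTensor A B → Prop} (x : MinTensor A B)
    (hc : IsClosed {x | p x}) (ha : ∀ x y, p x → p y → p (x + y))
    (h : ∀ a b, p (MinTensor.of A B (a ⊗ₜ b))) : p x := by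
  refine (spatial A B).induction p x hc fun x => ?_
  change p (MinTensor.of A B x)
  induction x using TensorProduct.induction_on with
  | zero => rw [← TensorProduct.zero_tmul A (0 : B)]; exact h 0 0
  | add x y hx hy => rw [map_add]; exact ha _ _ hx hy
  | tmul a b => exact h a b

lemma opNorm_le_of_inner {V : Type*} [NormedAddCommGroup V] [InnerProductSpace ℂ V]
    {T : V →L[ℂ] V} {M : ℝ} (hM : 0 ≤ M) (h : ∀ ζ ζ', ‖inner ℂ ζ' (T ζ)‖ ≤ M * ‖ζ‖ * ‖ζ'‖) :
    ‖T‖ ≤ M := by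
  refine T.opNorm_le_bound hM fun ζ => ?_
  -- Testing against `T ζ` itself bounds `‖T ζ‖²` by `M ‖ζ‖ ‖T ζ‖`.
  have h1 := h ζ (T ζ)
  rw [inner_self_eq_norm_sq_to_K, RCLike.ofReal_eq_complex_ofReal, norm_pow, Complex.norm_real,
    norm_norm, sq] at h1
  rcases (norm_nonneg (T ζ)).eq_or_lt with h0 | h0
  · rw [← h0]; positivity
  · exact le_of_mul_le_mul_right h1 h0

/-- `id ⊗ φ` on the algebraic tensor product. -/
def algSliceR (B : Type u) [CStarAlgebra B] (φ : A →ₗ[ℂ] ℂ) : B ⊗[ℂ] A →ₗ[ℂ] B :=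
  (TensorProduct.rid ℂ B).toLinearMap ∘ₗ LinearMap.lTensor B φ

/-- `φ ⊗ id` on the algebraic tensor product. -/
def algSliceL (A : Type u) [CStarAlgebra A] (φ : B →ₗ[ℂ] ℂ) : B ⊗[ℂ] A →ₗ[ℂ] A :=
  (TensorProduct.lid ℂ A).toLinearMap ∘ₗ LinearMap.rTensor A φ

lemma algSliceR_tmul (φ : A →ₗ[ℂ] ℂ) (b : B) (a : A) : algSliceR B φ (b ⊗ₜ a) = φ a • b := by
  simp [algSliceR]

lemma algSliceL_tmul (φ : B →ₗ[ℂ] ℂ) (b : B) (a : A) : algSliceL A φ (b ⊗ₜ a) = φ b • a := by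
  simp [algSliceL]

lemma inner_tensorRep_tmul (i : Repn B) (j : Repn A) (ζ ζ' : i.H) (η η' : j.H) (b : B) (a : A) :
    inner ℂ (HTensor.mk _ _ (ζ' ⊗ₜ η')) (tensorRep i.rep j.rep (b ⊗ₜ a)
      (HTensor.mk _ _ (ζ ⊗ₜ η))) = inner ℂ ζ' (i.rep b ζ) * inner ℂ η' (j.rep a η) := by
  rw [tensorRep_tmul, mul_apply_eq_comp, ampR_mk, ampL_mk, LinearIsometry.inner_map_map,
    TensorProduct.inner_tmul]

/-- With `φ` the vector state of `η`, slicing by `φ` is compression to vectors of the form `ζ ⊗ η`.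
This is what controls slices by the spatial norm. -/
lemma inner_algSliceR {φ : A →ₗ[ℂ] ℂ} (i : Repn B) {j : Repn A} {η : j.H}
    (h : ∀ a, φ a = inner ℂ η (j.rep a η)) (x : B ⊗[ℂ] A) (ζ ζ' : i.H) :
    inner ℂ ζ' (i.rep (algSliceR B φ x) ζ) = inner ℂ (HTensor.mk _ _ (ζ' ⊗ₜ η))
      (tensorRep i.rep j.rep x (HTensor.mk _ _ (ζ ⊗ₜ η))) := by
  induction x using TensorProduct.induction_on with
  | zero => simp
  | add x y hx hy => simp only [map_add, add_apply, inner_add_right, hx, hy]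
  | tmul b a =>
    rw [inner_tensorRep_tmul, algSliceR_tmul, map_smul, smul_apply, inner_smul_right, h, mul_comm]

lemma inner_algSliceL {φ : B →ₗ[ℂ] ℂ} {i : Repn B} (j : Repn A) {ζ : i.H}
    (h : ∀ b, φ b = inner ℂ ζ (i.rep b ζ)) (x : B ⊗[ℂ] A) (η η' : j.H) :
    inner ℂ η' (j.rep (algSliceL A φ x) η) = inner ℂ (HTensor.mk _ _ (ζ ⊗ₜ η'))
      (tensorRep i.rep j.rep x (HTensor.mk _ _ (ζ ⊗ₜ η))) := by
  induction x using TensorProduct.induction_on with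
  | zero => simp
  | add x y hx hy => simp only [map_add, add_apply, inner_add_right, hx, hy]
  | tmul b a =>
    rw [inner_tensorRep_tmul, algSliceL_tmul, map_smul, smul_apply, inner_smul_right, h]

lemma norm_inner_tensorRep_le (i : Repn B) (j : Repn A) (x : B ⊗[ℂ] A)
    (v w : HTensor i.H j.H) :
    ‖inner ℂ w (tensorRep i.rep j.rep x v)‖ ≤ (spatial B A).nrm x * ‖v‖ * ‖w‖ := by
  refine (norm_inner_le_norm _ _).trans ?_
  rw [mul_comm]
  gcongr
  exact ((tensorRep i.rep j.rep x).le_opNorm v).trans (by gcongr; exact MinTensor.le_nrm x i j)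

/-- The norm of the slice can be computed in representations of `B`, where its matrix coefficients
are matrix coefficients of `x` at `ζ ⊗ η` with `‖η‖ = 1`. This bound allows the slice map to extend
to the completion. -/
lemma norm_algSliceR_le {φ : A →ₗ[ℂ] ℂ} (hφ : IsState φ) (x : B ⊗[ℂ] A) :
    ‖algSliceR B φ x‖ ≤ (spatial B A).nrm x := by
  obtain ⟨j, η, h⟩ := hφ.exists_repn
  have hη := hφ.norm_vec h
  have h0 := (spatial B A).nrm_nonneg x
  refine norm_le_of_repn h0 fun i => opNorm_le_of_inner h0 fun ζ ζ' => ?_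
  rw [inner_algSliceR i h]
  refine (norm_inner_tensorRep_le i j x _ _).trans ?_
  rw [LinearIsometry.norm_map, LinearIsometry.norm_map, TensorProduct.norm_tmul,
    TensorProduct.norm_tmul, hη, mul_one, mul_one]

lemma norm_algSliceL_le {φ : B →ₗ[ℂ] ℂ} (hφ : IsState φ) (x : B ⊗[ℂ] A) :
    ‖algSliceL A φ x‖ ≤ (spatial B A).nrm x := by
  obtain ⟨i, ζ, h⟩ := hφ.exists_repn
  have hζ := hφ.norm_vec h
  have h0 := (spatial B A).nrm_nonneg x
  refine norm_le_of_repn h0 fun j => opNorm_le_of_inner h0 fun η η' => ?_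
  rw [inner_algSliceL j h]
  refine (norm_inner_tensorRep_le i j x _ _).trans ?_
  rw [LinearIsometry.norm_map, LinearIsometry.norm_map, TensorProduct.norm_tmul,
    TensorProduct.norm_tmul, hζ, one_mul, one_mul]

lemma exists_sliceR (B : Type u) [CStarAlgebra B] {φ : A →ₗ[ℂ] ℂ} (hφ : IsState φ) :
    ∃ s : MinTensor B A →L[ℂ] B, (∀ x, s (MinTensor.of B A x) = algSliceR B φ x) ∧
      ∀ x, ‖s x‖ ≤ ‖x‖ :=
  (spatial B A).exists_linearLift (algSliceR B φ) (norm_algSliceR_le hφ)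

lemma exists_sliceL (A : Type u) [CStarAlgebra A] {φ : B →ₗ[ℂ] ℂ} (hφ : IsState φ) :
    ∃ s : MinTensor B A →L[ℂ] A, (∀ x, s (MinTensor.of B A x) = algSliceL A φ x) ∧
      ∀ x, ‖s x‖ ≤ ‖x‖ :=
  (spatial B A).exists_linearLift (algSliceL A φ) (norm_algSliceL_le hφ)

/-- The slice map `id ⊗ φ : B ⊗ A → B` of a state `φ` of `A`. -/
def sliceR (B : Type u) [CStarAlgebra B] {φ : A →ₗ[ℂ] ℂ} (hφ : IsState φ) : MinTensor B A →L[ℂ] B :=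
  (exists_sliceR B hφ).choose

/-- The slice map `φ ⊗ id : B ⊗ A → A` of a state `φ` of `B`. -/
def sliceL (A : Type u) [CStarAlgebra A] {φ : B →ₗ[ℂ] ℂ} (hφ : IsState φ) : MinTensor B A →L[ℂ] A :=
  (exists_sliceL A hφ).choose

variable {φ : A →ₗ[ℂ] ℂ} (hφ : IsState φ) {ψ : B →ₗ[ℂ] ℂ} (hψ : IsState ψ)

lemma sliceR_tmul (b : B) (a : A) : sliceR B hφ (MinTensor.of B A (b ⊗ₜ a)) = φ a • b :=
  ((exists_sliceR B hφ).choose_spec.1 _).trans (algSliceR_tmul φ b a)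

lemma sliceL_tmul (b : B) (a : A) : sliceL A hψ (MinTensor.of B A (b ⊗ₜ a)) = ψ b • a :=
  ((exists_sliceL A hψ).choose_spec.1 _).trans (algSliceL_tmul ψ b a)

lemma norm_sliceR_le (x : MinTensor B A) : ‖sliceR B hφ x‖ ≤ ‖x‖ :=
  (exists_sliceR B hφ).choose_spec.2 x

lemma IsState.continuous {φ : A →ₗ[ℂ] ℂ} (hφ : IsState φ) : Continuous φ :=
  AddMonoidHomClass.continuous_of_bound φ 1 fun x => by rw [one_mul]; exact hφ.norm_le x

lemma sliceR_left (b : B) : sliceR B hφ (MinTensor.left B A b) = b :=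
  (sliceR_tmul hφ b 1).trans (by rw [hφ.apply_one, one_smul])

/-- Slicing by any state of `A` is a left inverse; nontriviality of `A` supplies a state. -/
lemma left_injective [Nontrivial A] : Function.Injective (MinTensor.left B A) := fun b b' h => by
  obtain ⟨φ, hφ, -⟩ := exists_isState_norm (1 : A)
  rw [← sliceR_left hφ b, h, sliceR_left]

/-- A Fubini rule: both sides are `ψ ⊗ φ`. It converts slices in one leg into slices in the other.
-/
lemma apply_sliceR (x : MinTensor B A) : ψ (sliceR B hφ x) = φ (sliceL A hψ x) := by
  have h1 := hφ.continuous
  have h2 := hψ.continuous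
  induction x using MinTensor.induction_tmul
  case hc => exact isClosed_eq (by fun_prop) (by fun_prop)
  case ha x y hx hy => simp only [map_add, hx, hy]
  rename_i b a
  rw [sliceR_tmul, sliceL_tmul, map_smul, map_smul, smul_eq_mul, smul_eq_mul, mul_comm]

lemma sliceR_map (f : B →⋆ₐ[ℂ] B') (x : MinTensor B A) :
    sliceR B' hφ (MinTensor.map f (StarAlgHom.id ℂ A) x) = f (sliceR B hφ x) := by
  have h1 := RepFamily.continuous_starHom f
  have h2 := RepFamily.continuous_starHom (MinTensor.map f (StarAlgHom.id ℂ A))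
  induction x using MinTensor.induction_tmul
  case hc => exact isClosed_eq (by fun_prop) (by fun_prop)
  case ha x y hx hy => simp only [map_add, hx, hy]
  rename_i b a
  rw [sliceR_tmul, MinTensor.map_of, starMap_tmul, sliceR_tmul, map_smul]
  rfl

lemma sliceL_map (f : A →⋆ₐ[ℂ] C) (x : MinTensor B A) :
    sliceL C hψ (MinTensor.map (StarAlgHom.id ℂ B) f x) = f (sliceL A hψ x) := by
  have h1 := RepFamily.continuous_starHom f
  have h2 := RepFamily.continuous_starHom (MinTensor.map (StarAlgHom.id ℂ B) f)
  induction x using MinTensor.induction_tmul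
  case hc => exact isClosed_eq (by fun_prop) (by fun_prop)
  case ha x y hx hy => simp only [map_add, hx, hy]
  rename_i b a
  rw [sliceL_tmul, MinTensor.map_of, starMap_tmul, sliceL_tmul, map_smul]
  rfl

lemma sliceR_left_mul (b : B) (x : MinTensor B A) :
    sliceR B hφ (MinTensor.left B A b * x) = b * sliceR B hφ x := by
  induction x using MinTensor.induction_tmul
  case hc => exact isClosed_eq (by fun_prop) (by fun_prop)
  case ha x y hx hy => simp only [mul_add, map_add, hx, hy]
  rename_i b' a
  change sliceR B hφ (MinTensor.of B A (b ⊗ₜ 1) * _) = _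
  rw [← map_mul, Algebra.TensorProduct.tmul_mul_tmul, one_mul, sliceR_tmul, sliceR_tmul,
    mul_smul_comm]

lemma sliceR_mul_left (b : B) (x : MinTensor B A) :
    sliceR B hφ (x * MinTensor.left B A b) = sliceR B hφ x * b := by
  induction x using MinTensor.induction_tmul
  case hc => exact isClosed_eq (by fun_prop) (by fun_prop)
  case ha x y hx hy => simp only [add_mul, map_add, hx, hy]
  rename_i b' a
  change sliceR B hφ (_ * MinTensor.of B A (b ⊗ₜ 1)) = _
  rw [← map_mul, Algebra.TensorProduct.tmul_mul_tmul, mul_one, sliceR_tmul, sliceR_tmul,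
    smul_mul_assoc]

lemma sliceR_star (x : MinTensor B A) : sliceR B hφ (star x) = star (sliceR B hφ x) := by
  induction x using MinTensor.induction_tmul
  case hc => exact isClosed_eq (by fun_prop) (by fun_prop)
  case ha x y hx hy => simp only [star_add, map_add, hx, hy]
  rename_i b a
  rw [← map_star, TensorProduct.star_tmul, sliceR_tmul, sliceR_tmul, hφ.apply_star, star_smul]

lemma inner_sliceR (i : Repn B) {j : Repn A} {η : j.H} (h : ∀ a, φ a = inner ℂ η (j.rep a η))
    (x : MinTensor B A) (ζ ζ' : i.H) :
    inner ℂ ζ' (i.rep (sliceR B hφ x) ζ) = inner ℂ (HTensor.mk _ _ (ζ' ⊗ₜ η))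
      (MinTensor.rep i j x (HTensor.mk _ _ (ζ ⊗ₜ η))) := by
  have h1 := RepFamily.continuous_starHom i.rep
  have h2 := RepFamily.continuous_starHom (MinTensor.rep i j)
  induction x using MinTensor.induction_tmul
  case hc => exact isClosed_eq (by fun_prop) (by fun_prop)
  case ha x y hx hy => simp only [map_add, add_apply, inner_add_right, hx, hy]
  rename_i b a
  rw [MinTensor.rep_of, inner_tensorRep_tmul, sliceR_tmul, map_smul, smul_apply,
    inner_smul_right, h, mul_comm]

lemma minTensor_eq_of_rep {x y : MinTensor B A}
    (h : ∀ i j, MinTensor.rep i j x = MinTensor.rep i j y) : x = y := by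
  have : ‖x - y‖ ≤ 0 := (spatial B A).norm_le le_rfl fun i => by
    have h1 : MinTensor.rep i.1 i.2 (x - y) = 0 :=
      (map_sub _ _ _).trans (sub_eq_zero.2 (h i.1 i.2))
    exact (congrArg norm h1).le.trans norm_zero.le
  exact sub_eq_zero.1 (norm_le_zero_iff.1 this)

/-- The operator `η ↦ ζ ⊗ η`. -/
def leftTensor {H : Type*} (K : Type*) [NormedAddCommGroup H] [InnerProductSpace ℂ H]
    [NormedAddCommGroup K] [InnerProductSpace ℂ K] (ζ : H) : K →L[ℂ] HTensor H K :=
  LinearMap.mkContinuous ((HTensor.mk H K).toLinearMap ∘ₗ TensorProduct.mk ℂ H K ζ) ‖ζ‖ fun η =>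
    ((HTensor.mk H K).norm_map _).trans_le (TensorProduct.norm_tmul ζ η).le

/-- Slices by states separate the points of the minimal tensor product. -/
lemma eq_of_sliceR {x y : MinTensor B A}
    (h : ∀ (φ : A →ₗ[ℂ] ℂ) (hφ : IsState φ), sliceR B hφ x = sliceR B hφ y) : x = y := by
  refine minTensor_eq_of_rep fun i j => sub_eq_zero.1 ?_
  set T := MinTensor.rep i j x - MinTensor.rep i j y with hT
  -- The compressions `η ↦ ζ ⊗ η`, then `T`, then the adjoint of `η ↦ ζ' ⊗ η`, have quadratic forms
  -- given by slices with vector states. Equality of all slices makes these forms vanish on unit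
  -- vectors, hence the compressions vanish.
  have key : ∀ ζ ζ' : i.H,
      ContinuousLinearMap.adjoint (leftTensor j.H ζ') ∘L T ∘L leftTensor j.H ζ = 0 := fun ζ ζ' => by
    refine clm_eq_zero_of_unit fun η hη => ?_
    rw [ContinuousLinearMap.comp_apply, ContinuousLinearMap.adjoint_inner_right]
    change inner ℂ (HTensor.mk _ _ (ζ' ⊗ₜ η)) (T (HTensor.mk _ _ (ζ ⊗ₜ η))) = 0
    have hs : IsState (repnVec j η) := isState_of_repn j hη fun _ => rfl
    rw [hT, sub_apply, inner_sub_right, ← inner_sliceR hs i fun _ => rfl,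
      ← inner_sliceR hs i fun _ => rfl, h, sub_self]
  -- Vanishing compressions mean that all matrix coefficients of `T` between elementary tensors
  -- vanish, and these are total in the Hilbert space.
  have h0 : T = star 0 := HTensor.adjoint_eq fun ζ η ζ' η' => by
    have h1 := congrArg (fun S => inner ℂ η' (S η)) (key ζ ζ')
    simp only [ContinuousLinearMap.comp_apply, ContinuousLinearMap.adjoint_inner_right,
      zero_apply, inner_zero_right] at h1
    rw [zero_apply, inner_zero_right, ← inner_conj_symm]
    exact (congrArg _ h1).trans (map_zero _)
  rw [h0, star_zero]

lemma inner_rep_tmul {i : Repn B} {j : Repn A} {ζ : i.H} {η : j.H}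
    (hi : ∀ b, ψ b = inner ℂ ζ (i.rep b ζ)) (hj : ∀ a, φ a = inner ℂ η (j.rep a η))
    (x : MinTensor B A) : inner ℂ (HTensor.mk _ _ (ζ ⊗ₜ η))
      (MinTensor.rep i j x (HTensor.mk _ _ (ζ ⊗ₜ η))) = ψ (sliceR B hφ x) := by
  rw [← inner_sliceR hφ i hj, hi]

/-- The functional `⟨v, (ρ ⊗ σ ⊗ τ)(z) v⟩` of a vector `v`. -/
def tripleVec (i : Repn B) (j : Repn A) (k : Repn C) (v : HTensor (HTensor i.H j.H) k.H) :
    MinTensor₃ B A C →ₗ[ℂ] ℂ where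
  toFun z := inner ℂ v (MinTensor₃.rep i j k z v)
  map_add' a b := by rw [map_add, add_apply, inner_add_right]
  map_smul' c a := by
    rw [map_smul, smul_apply, inner_smul_right, RingHom.id_apply, smul_eq_mul]

lemma continuous_tripleVec (i : Repn B) (j : Repn A) (k : Repn C)
    (v : HTensor (HTensor i.H j.H) k.H) : Continuous (tripleVec i j k v) := by
  have h2 := RepFamily.continuous_starHom (MinTensor₃.rep i j k)
  change Continuous fun z => inner ℂ v (MinTensor₃.rep i j k z v)
  fun_prop

/-! ### Product functionals on triple tensor products -/

section Triple
variable {χ : C →ₗ[ℂ] ℂ} (hχ : IsState χ) {Φ : MinTensor₃ B A C →ₗ[ℂ] ℂ}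

/-- Both sides are continuous and linear, so two successive reductions to elementary tensors, first
in the outer and then in the inner tensor product, leave the product formula assumed for `Φ`. -/
lemma triple_assocL (hψ : IsState ψ) (hc : Continuous Φ)
    (hΦ : ∀ b a c, Φ (MinTensor₃.of B A C ((b ⊗ₜ a) ⊗ₜ c)) = ψ b * φ a * χ c)
    (x : MinTensor (MinTensor B A) C) :
    Φ (MinTensor₃.assocL B A C x) = ψ (sliceR B hφ (sliceR (MinTensor B A) hχ x)) := by
  induction x using MinTensor.induction_tmul
  case hc =>
    exact isClosed_eq (hc.comp (RepFamily.continuous_starHom (MinTensor₃.assocL B A C)))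
      (hψ.continuous.comp ((sliceR B hφ).continuous.comp (sliceR (MinTensor B A) hχ).continuous))
  case ha x y hx hy => simp only [map_add, hx, hy]
  rename_i y c
  rw [sliceR_tmul, MinTensor₃.assocL_of]
  induction y using MinTensor.induction_tmul
  case hc =>
    exact isClosed_eq
      (hc.comp ((RepFamily.continuous_starHom (MinTensor₃.leg12 B A C)).mul continuous_const))
      (hψ.continuous.comp ((sliceR B hφ).continuous.comp (continuous_const_smul _)))
  case ha x y hx hy => simp only [map_add, smul_add, add_mul, hx, hy]
  rename_i b a
  rw [MinTensor₃.leg12_of, MinTensor₃.leg3_apply, ← map_mul, Algebra.TensorProduct.tmul_mul_tmul,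
    mul_one, one_mul, hΦ, map_smul, map_smul, sliceR_tmul, map_smul]
  simp only [smul_eq_mul]
  ring

lemma triple_assocR (hφ : IsState φ) (hc : Continuous Φ)
    (hΦ : ∀ b a c, Φ (MinTensor₃.of B A C ((b ⊗ₜ a) ⊗ₜ c)) = ψ b * φ a * χ c)
    (x : MinTensor B (MinTensor A C)) :
    Φ (MinTensor₃.assocR B A C x) = φ (sliceR A hχ (sliceL (MinTensor A C) hψ x)) := by
  induction x using MinTensor.induction_tmul
  case hc =>
    exact isClosed_eq (hc.comp (RepFamily.continuous_starHom (MinTensor₃.assocR B A C)))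
      (hφ.continuous.comp ((sliceR A hχ).continuous.comp (sliceL (MinTensor A C) hψ).continuous))
  case ha x y hx hy => simp only [map_add, hx, hy]
  rename_i b y
  rw [sliceL_tmul, MinTensor₃.assocR_of]
  induction y using MinTensor.induction_tmul
  case hc =>
    exact isClosed_eq
      (hc.comp (continuous_const.mul (RepFamily.continuous_starHom (MinTensor₃.leg23 B A C))))
      (hφ.continuous.comp ((sliceR A hχ).continuous.comp (continuous_const_smul _)))
  case ha x y hx hy => simp only [map_add, smul_add, mul_add, hx, hy]
  rename_i a c
  rw [MinTensor₃.leg23_of, MinTensor₃.leg1_apply, ← map_mul, Algebra.TensorProduct.tmul_mul_tmul,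
    Algebra.TensorProduct.tmul_mul_tmul, mul_one, one_mul, one_mul, hΦ, map_smul, map_smul,
    sliceR_tmul, map_smul]
  simp only [smul_eq_mul]
  ring

/-- The functional `ψ ⊗ φ ⊗ χ` on a triple tensor product. -/
lemma exists_tripleFunctional :
    ∃ Φ : MinTensor₃ B A C → ℂ,
      (∀ x, Φ (MinTensor₃.assocL B A C x) = ψ (sliceR B hφ (sliceR (MinTensor B A) hχ x))) ∧
      ∀ x, Φ (MinTensor₃.assocR B A C x) = φ (sliceR A hχ (sliceL (MinTensor A C) hψ x)) := by
  obtain ⟨i, ζ, hi⟩ := hψ.exists_repn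
  obtain ⟨j, η, hj⟩ := hφ.exists_repn
  obtain ⟨k, θ, hk⟩ := hχ.exists_repn
  -- The tensor product of the three GNS vectors; its vector functional is `ψ ⊗ φ ⊗ χ`, continuous
  -- on the triple product because it comes from a representation.
  set v := HTensor.mk _ _ (HTensor.mk _ _ (ζ ⊗ₜ[ℂ] η) ⊗ₜ[ℂ] θ)
  have hΦ : ∀ b a c, tripleVec i j k v (MinTensor₃.of B A C ((b ⊗ₜ a) ⊗ₜ c)) =
      ψ b * φ a * χ c := fun b a c => by
    change inner ℂ v (MinTensor₃.rep i j k (MinTensor₃.of B A C ((b ⊗ₜ a) ⊗ₜ c)) v) = _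
    rw [MinTensor₃.rep_of, tensorRep_tmul, mul_apply_eq_comp, ampR_mk, ampL_mk,
      LinearIsometry.inner_map_map, TensorProduct.inner_tmul, inner_tensorRep_tmul, hi, hj, hk]
  exact ⟨tripleVec i j k v, triple_assocL hφ hχ hψ (continuous_tripleVec i j k v) hΦ,
    triple_assocR hψ hχ hφ (continuous_tripleVec i j k v) hΦ⟩

/-- Coassociativity and the fixed-point equation compare the images of two differently bracketed
tensors. Evaluating `ψ ⊗ φ ⊗ χ` on both turns each such equation into an equation between iterated
slices. -/
lemma assoc_slice {x : MinTensor (MinTensor B A) C} {y : MinTensor B (MinTensor A C)}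
    (h : MinTensor₃.assocL B A C x = MinTensor₃.assocR B A C y) :
    ψ (sliceR B hφ (sliceR (MinTensor B A) hχ x)) =
      φ (sliceR A hχ (sliceL (MinTensor A C) hψ y)) := by
  obtain ⟨Φ, h1, h2⟩ := exists_tripleFunctional hφ hψ hχ
  rw [← h1, h, h2]

end Triple
end Slices

/-! ### Invariant states by Cesàro averaging -/

section InvariantStates
variable {A : Type u} [CStarAlgebra A]

lemma IsState.comp {A' : Type u} [CStarAlgebra A'] {ρ : A →ₗ[ℂ] ℂ} (hρ : IsState ρ)
    {S : A' →ₗ[ℂ] A} (h1 : S 1 = 1) (hS : ∀ a, ‖S a‖ ≤ ‖a‖) : IsState (ρ ∘ₗ S) where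
  apply_one := by rw [LinearMap.comp_apply, h1, hρ.apply_one]
  norm_le a := (hρ.norm_le _).trans (hS a)

lemma IsState.average {ρ σ : A →ₗ[ℂ] ℂ} (hρ : IsState ρ) (hσ : IsState σ) :
    IsState ((2⁻¹ : ℂ) • (ρ + σ)) where
  apply_one := by
    rw [LinearMap.smul_apply, LinearMap.add_apply, hρ.apply_one, hσ.apply_one, smul_eq_mul]
    norm_num
  norm_le a := by
    rw [LinearMap.smul_apply, LinearMap.add_apply, norm_smul]
    have h1 := hρ.norm_le a
    have h2 := hσ.norm_le a
    have h3 := norm_add_le (ρ a) (σ a)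
    have h4 : ‖(2⁻¹ : ℂ)‖ = 2⁻¹ := by norm_num
    rw [h4]
    linarith

/-- The Cesàro means `(n+1)⁻¹ ∑ ω ∘ R^m`, over `m ≤ n`. -/
def cesaro (ω : A →ₗ[ℂ] ℂ) (R : A →ₗ[ℂ] A) (n : ℕ) : A →ₗ[ℂ] ℂ :=
  ((n + 1 : ℂ)⁻¹) • ∑ m ∈ Finset.range (n + 1), ω ∘ₗ (R ^ m)

lemma cesaro_apply (ω : A →ₗ[ℂ] ℂ) (R : A →ₗ[ℂ] A) (n : ℕ) (a : A) :
    cesaro ω R n a = (n + 1 : ℂ)⁻¹ * ∑ m ∈ Finset.range (n + 1), ω ((R ^ m) a) := by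
  simp [cesaro]

lemma norm_natCast_add_one (n : ℕ) : ‖(n + 1 : ℂ)‖ = n + 1 := by
  have := Complex.norm_natCast (n + 1)
  push_cast at this
  exact this

lemma norm_pow_apply_le {R : A →ₗ[ℂ] A} (hR : ∀ a, ‖R a‖ ≤ ‖a‖) (m : ℕ) (a : A) :
    ‖(R ^ m) a‖ ≤ ‖a‖ := by
  induction m with
  | zero => simp
  | succ m ih =>
    rw [pow_succ', Module.End.mul_apply]
    exact (hR _).trans ih

lemma pow_apply_one {R : A →ₗ[ℂ] A} (h1 : R 1 = 1) (m : ℕ) : (R ^ m) 1 = 1 := by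
  induction m with
  | zero => simp
  | succ m ih => rw [pow_succ', Module.End.mul_apply, ih, h1]

lemma isState_cesaro {ω : A →ₗ[ℂ] ℂ} (hω : IsState ω) {R : A →ₗ[ℂ] A} (h1 : R 1 = 1)
    (hR : ∀ a, ‖R a‖ ≤ ‖a‖) (n : ℕ) : IsState (cesaro ω R n) where
  apply_one := by
    rw [cesaro_apply]
    simp only [pow_apply_one h1, hω.apply_one, Finset.sum_const, Finset.card_range, nsmul_eq_mul,
      mul_one, Nat.cast_add, Nat.cast_one]
    exact inv_mul_cancel₀ (Nat.cast_add_one_ne_zero n)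
  norm_le a := by
    rw [cesaro_apply, norm_mul, norm_inv, norm_natCast_add_one, inv_mul_le_iff₀ (by positivity)]
    refine (norm_sum_le _ _).trans ((Finset.sum_le_card_nsmul _ _ ‖a‖ fun m _ =>
      (hω.norm_le _).trans (norm_pow_apply_le hR m a)).trans ?_)
    simp

/-- Existence of invariant states by averaging. -/
lemma exists_invariant_state {ω : A →ₗ[ℂ] ℂ} (hω : IsState ω) {R : A →ₗ[ℂ] A} (h1 : R 1 = 1)
    (hR : ∀ a, ‖R a‖ ≤ ‖a‖) : ∃ h : A →ₗ[ℂ] ℂ, IsState h ∧ ∀ L : A →ₗ[ℂ] A,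
      (∀ m a, ω ((R ^ m) (L a)) = ω ((R ^ (m + 1)) a)) → ∀ a, h (L a) = h a := by
  -- A limit along a nonprincipal ultrafilter exists for every `a` at once, the means being bounded
  -- by `‖a‖`, and it is linear in `a`.
  let U := Filter.hyperfilter ℕ
  have hs := isState_cesaro hω h1 hR
  have hlim : ∀ a, ∃ z, Filter.Tendsto (fun n => cesaro ω R n a) U (nhds z) := fun a => by
    obtain ⟨z, -, hz⟩ := (isCompact_closedBall (0 : ℂ) ‖a‖).ultrafilter_le_nhds
      (U.map fun n => cesaro ω R n a) (by
        rw [Ultrafilter.coe_map, Filter.le_principal_iff, Filter.mem_map]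
        refine Filter.univ_mem' fun n => ?_
        rw [Set.mem_preimage, mem_closedBall_zero_iff]
        exact (hs n).norm_le a)
    exact ⟨z, hz⟩
  choose h hh using hlim
  have hadd : ∀ a b, h (a + b) = h a + h b := fun a b =>
    tendsto_nhds_unique (hh (a + b)) (((hh a).add (hh b)).congr fun n => (map_add _ a b).symm)
  have hsmul : ∀ (c : ℂ) a, h (c • a) = c • h a := fun c a =>
    tendsto_nhds_unique (hh (c • a)) (((hh a).const_smul c).congr fun n => (map_smul _ c a).symm)
  refine ⟨⟨⟨h, hadd⟩, hsmul⟩, ⟨?_, fun a => ?_⟩, fun L hL a => ?_⟩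
  · exact tendsto_nhds_unique (hh 1)
      (tendsto_const_nhds.congr fun n => (hs n).apply_one.symm)
  · exact le_of_tendsto (hh a).norm (Filter.Eventually.of_forall fun n => (hs n).norm_le a)
  · have hle : (U : Filter ℕ) ≤ Filter.atTop := Nat.hyperfilter_le_atTop
    have h0 : Filter.Tendsto (fun n => cesaro ω R n (L a) - cesaro ω R n a) Filter.atTop
        (nhds 0) := by
      have hb : Filter.Tendsto (fun n : ℕ => (2 * ‖a‖) * (1 / ((n : ℝ) + 1))) Filter.atTop
          (nhds 0) := by
        simpa using tendsto_one_div_add_atTop_nhds_zero_nat.const_mul (2 * ‖a‖)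
      refine squeeze_zero_norm (fun n => ?_) hb
      -- The hypothesis on `L` replaces `ω ∘ R^m ∘ L` by `ω ∘ R^(m+1)`, so the difference of the two
      -- means telescopes to its end terms and is at most `2‖a‖/(n+1)`.
      have h2 : cesaro ω R n (L a) - cesaro ω R n a =
          (n + 1 : ℂ)⁻¹ * (ω ((R ^ (n + 1)) a) - ω a) := by
        rw [cesaro_apply, cesaro_apply, ← mul_sub, ← Finset.sum_sub_distrib]
        simp only [hL]
        rw [Finset.sum_range_sub (fun m => ω ((R ^ m) a))]
        simp
      rw [h2, norm_mul, norm_inv, norm_natCast_add_one, one_div, mul_comm]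
      gcongr
      refine (norm_sub_le _ _).trans ?_
      linarith [(hω.norm_le _).trans (norm_pow_apply_le hR (n + 1) a), hω.norm_le a]
    exact sub_eq_zero.1 (tendsto_nhds_unique ((hh (L a)).sub (hh a)) (h0.mono_left hle))

end InvariantStates

/-! ### Convolution of states, absorbing states, and the fixed points of `id ⊗ Δ` -/

section Convolution
variable {A : Type u} [CStarAlgebra A] {p q r : A →ₗ[ℂ] ℂ}

lemma sliceR_average {B : Type u} [CStarAlgebra B] (hp : IsState p) (hq : IsState q)
    (x : MinTensor B A) :
    sliceR B (hp.average hq) x = (2⁻¹ : ℂ) • (sliceR B hp x + sliceR B hq x) := by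
  refine eq_of_isState fun ψ hψ => ?_
  rw [apply_sliceR _ hψ, map_smul, map_add, apply_sliceR _ hψ, apply_sliceR _ hψ]
  rfl

/-- The Cauchy-Schwarz argument for the functional `p ⊗ q`. -/
lemma exists_norm_sq_slice {B : Type u} [CStarAlgebra B] {p : B →ₗ[ℂ] ℂ} (hp : IsState p)
    (hq : IsState q) (x : MinTensor B A) : ∃ t : ℝ, 0 ≤ t ∧ p (sliceR B hq (star x * x)) = t ∧
      (t = 0 → ∀ y, p (sliceR B hq (y * x)) = 0) := by
  obtain ⟨i, ζ, hi⟩ := hp.exists_repn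
  obtain ⟨j, η, hj⟩ := hq.exists_repn
  set v := HTensor.mk _ _ (ζ ⊗ₜ[ℂ] η) with hv
  -- In the representation on `v = ζ ⊗ η`, the functional `p ⊗ q` is a vector functional, so `t = ‖x
  -- v‖²`. If this is zero, then `x` kills `v`, and so does `y x`.
  refine ⟨‖MinTensor.rep i j x v‖ ^ 2, sq_nonneg _, ?_, fun h y => ?_⟩
  · rw [← inner_rep_tmul hq hi hj, ← hv, map_mul, map_star, mul_apply_eq_comp,
      ContinuousLinearMap.star_eq_adjoint, ContinuousLinearMap.adjoint_inner_right,
      inner_self_eq_norm_sq_to_K, RCLike.ofReal_eq_complex_ofReal]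
    push_cast
    rfl
  · have h1 : MinTensor.rep i j x v = 0 := norm_eq_zero.1 (pow_eq_zero_iff two_ne_zero |>.1 h)
    rw [← inner_rep_tmul hq hi hj, ← hv, map_mul, mul_apply_eq_comp, h1, map_zero,
      inner_zero_right]

namespace CompactQuantumGroup
variable (G : CompactQuantumGroup A)

/-- `a ↦ (id ⊗ q)(Δ(a))` -/
def convR (hq : IsState q) : A →ₗ[ℂ] A :=
  (sliceR A hq).toLinearMap ∘ₗ G.comul.toAlgHom.toLinearMap

/-- `a ↦ (q ⊗ id)(Δ(a))` -/
def convL (hq : IsState q) : A →ₗ[ℂ] A :=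
  (sliceL A hq).toLinearMap ∘ₗ G.comul.toAlgHom.toLinearMap

lemma convR_apply (hq : IsState q) (a : A) : G.convR hq a = sliceR A hq (G.comul a) := rfl
lemma convR_one (hq : IsState q) : G.convR hq 1 = 1 := by
  rw [convR_apply, map_one, ← map_one (MinTensor.left A A), sliceR_left]

lemma norm_convR_le (hq : IsState q) (a : A) : ‖G.convR hq a‖ ≤ ‖a‖ :=
  (norm_sliceR_le hq _).trans (NonUnitalStarAlgHom.norm_apply_le G.comul a)

lemma convR_star (hq : IsState q) (a : A) : G.convR hq (star a) = star (G.convR hq a) := by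
  rw [convR_apply, map_star, sliceR_star, convR_apply]

/-- Both sides are the convolution `p * q = (p ⊗ q)Δ`. -/
lemma apply_convR (hp : IsState p) (hq : IsState q) (a : A) :
    p (G.convR hq a) = q (G.convL hp a) := apply_sliceR hq hp _

/-- Associativity of the convolution of states. -/
lemma apply_convR_convR (hp : IsState p) (hq : IsState q) (hr : IsState r) (a : A) :
    p (G.convR hq (G.convR hr a)) = q (G.convR hr (G.convL hp a)) := by
  have h := assoc_slice hq hp hr (G.coassoc a)
  rwa [sliceR_map, sliceL_map] at h

/-- Left and right convolution operators commute: tested on a state `q`, both orders give the triple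
convolution `p * q * r`. -/
lemma convL_convR (hp : IsState p) (hr : IsState r) (a : A) :
    G.convR hr (G.convL hp a) = G.convL hp (G.convR hr a) :=
  eq_of_isState fun q hq => by rw [← G.apply_convR_convR hp hq hr, apply_convR]

/-- The convolution of two states. -/
def conv (p : A →ₗ[ℂ] ℂ) (hq : IsState q) : A →ₗ[ℂ] ℂ := p ∘ₗ G.convR hq

lemma isState_conv (hp : IsState p) (hq : IsState q) : IsState (G.conv p hq) :=
  hp.comp (G.convR_one hq) (G.norm_convR_le hq)

lemma convR_convR (hq : IsState q) (hr : IsState r) (a : A) :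
    G.convR hq (G.convR hr a) = G.convR (G.isState_conv hq hr) a :=
  eq_of_isState fun p hp => by
    rw [G.apply_convR_convR hp hq hr, G.apply_convR hp (G.isState_conv hq hr)]
    rfl

/-- Each state `ω` has an idempotent state `h` with `h * ω = ω * h = h`. -/
lemma exists_absorbing_state {ω : A →ₗ[ℂ] ℂ} (hω : IsState ω) : ∃ h : A →ₗ[ℂ] ℂ, IsState h ∧
    (∀ a, h (G.convR hω a) = h a) ∧ ∀ a, h (G.convL hω a) = h a := by
  obtain ⟨h, hh, H⟩ := exists_invariant_state hω (G.convR_one hω) (G.norm_convR_le hω)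
  -- The averaging is along powers of right convolution by `ω`, so invariance under that operator is
  -- immediate.
  refine ⟨h, hh, H _ fun m a => by rw [pow_succ, Module.End.mul_apply], H _ fun m a => ?_⟩
  -- For left convolution, commute it past the powers; when `ω` is applied last, left and right
  -- convolution by `ω` agree, as both yield `ω * ω`.
  have h1 : ∀ m a, ((G.convR hω) ^ m) (G.convL hω a) = G.convL hω (((G.convR hω) ^ m) a) := by
    intro m
    induction m with
    | zero => simp
    | succ m ih =>
      intro a
      rw [pow_succ', Module.End.mul_apply, Module.End.mul_apply, ih, convL_convR]
  rw [h1, ← apply_convR, pow_succ', Module.End.mul_apply]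

/-- Only the density of the span of `Δ(A)(A ⊗ 1)` enters. It lets functionals on `A ⊗ A` be compared
on elements where slices reduce to convolutions. -/
lemma eq_of_mul_left_comul {f g : MinTensor A A →ₗ[ℂ] ℂ} (hf : Continuous f) (hg : Continuous g)
    (h : ∀ a c, f (G.comul a * MinTensor.left A A c) = g (G.comul a * MinTensor.left A A c)) :
    f = g := by
  refine LinearMap.ext fun x => ?_
  have hd := G.dense_left.closure_eq
  have hx : x ∈ closure ((Submodule.span ℂ {x : MinTensor A A | ∃ a b,
    x = G.comul a * MinTensor.left A A b} : Submodule ℂ (MinTensor A A)) :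
      Set (MinTensor A A)) := by rw [hd]; trivial
  refine closure_minimal (t := {x | f x = g x}) (fun y hy => ?_) (isClosed_eq hf hg) hx
  refine LinearMap.eqOn_span (f := f) (g := g) (fun z hz => ?_) hy
  obtain ⟨a, b, rfl⟩ := hz
  exact h a b

/-- Put `ω = (ρ + σ)/2`. For a fixed vector `b` of convolution by `ω`, the element `x = Δ(b) - b ⊗
1` is null for `h ⊗ ω`. As `h ⊗ ω` is the average of the positive functionals `h ⊗ ρ` and `h ⊗ σ`,
it is null for `h ⊗ ρ` too, and Cauchy-Schwarz annihilates `(h ⊗ ρ)((c ⊗ 1)x)`. -/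
lemma apply_mul_convR {h ρ σ : A →ₗ[ℂ] ℂ} (hρ : IsState ρ) (hσ : IsState σ) (hh : IsState h)
    (h1 : ∀ a, h (G.convR (hρ.average hσ) a) = h a) {b : A}
    (hb : G.convR (hρ.average hσ) b = b) (c : A) :
    h (c * G.convR hρ b) = h (c * b) := by
  set x := G.comul b - MinTensor.left A A b with hx
  -- Expanding `x^*x` gives four terms. Invariance `h * ω = h` handles `Δ(b^*b)`, the fixed-point
  -- property of `b` handles the mixed ones, and each becomes `±h(b^*b)`.
  have h0 : h (sliceR A (hρ.average hσ) (star x * x)) = 0 := by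
    have e : star x * x = G.comul (star b * b) - G.comul (star b) * MinTensor.left A A b -
        MinTensor.left A A (star b) * G.comul b + MinTensor.left A A (star b * b) := by
      rw [hx, star_sub, ← map_star, ← map_star, map_mul, map_mul]
      noncomm_ring
    rw [e, map_add, map_sub, map_sub, sliceR_mul_left (hρ.average hσ),
      sliceR_left_mul (hρ.average hσ), sliceR_left (hρ.average hσ),
      ← convR_apply, ← convR_apply, ← convR_apply, convR_star, hb, map_add, map_sub, map_sub, h1]
    ring
  -- The value zero is half the sum of two nonnegative numbers, one for `ρ` and one for `σ`, so the
  -- one for `ρ` vanishes.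
  rw [sliceR_average hρ hσ, map_smul, map_add] at h0
  obtain ⟨s, hs, hs1, hs2⟩ := exists_norm_sq_slice hh hρ x
  obtain ⟨t, ht, ht1, -⟩ := exists_norm_sq_slice hh hσ x
  rw [hs1, ht1, smul_eq_mul, ← Complex.ofReal_add, mul_eq_zero, Complex.ofReal_eq_zero] at h0
  have h3 : s = 0 := by
    rcases h0 with h0 | h0
    · norm_num at h0
    · linarith
  -- Taking `y = c ⊗ 1` in the Cauchy-Schwarz conclusion gives `h(c (id ⊗ ρ)Δ(b)) - h(cb) = 0`.
  have h4 := hs2 h3 (MinTensor.left A A c)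
  rw [hx, mul_sub, map_sub, sliceR_left_mul, sliceR_left_mul, sliceR_left, map_sub,
    ← convR_apply] at h4
  exact sub_eq_zero.1 h4

/-- The preceding identity, applied to `b = (id ⊗ h)Δ(a)`, says that `h ⊗ (ρ * h)` and `h ⊗ h` agree
on `Δ(A)(A ⊗ 1)`. By density they are equal, and evaluation at `1 ⊗ d` removes the first factor. -/
lemma conv_eq_of_absorbing {h ρ σ : A →ₗ[ℂ] ℂ} (hρ : IsState ρ) (hσ : IsState σ) (hh : IsState h)
    (h1 : ∀ a, h (G.convR (hρ.average hσ) a) = h a)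
    (h2 : ∀ a, h (G.convL (hρ.average hσ) a) = h a) : G.conv ρ hh = h := by
  -- Convolving `(id ⊗ h)Δ(a)` with `ω` yields `(id ⊗ (ω * h))Δ(a)`, and `ω * h = h`.
  have hfix : ∀ a, G.convR (hρ.average hσ) (G.convR hh a) = G.convR hh a := fun a =>
    eq_of_isState fun p hp => by
      rw [G.apply_convR_convR hp (hρ.average hσ) hh, G.apply_convR (hρ.average hσ) hh, h2,
        G.apply_convR hp hh]
  have hκ := G.isState_conv hρ hh
  have key : ∀ a c, h (c * G.convR hκ a) = h (c * G.convR hh a) := fun a c => by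
    rw [← G.convR_convR hρ hh, G.apply_mul_convR hρ hσ hh h1 (hfix a)]
  have hfg : h ∘ₗ (sliceR A hκ).toLinearMap = h ∘ₗ (sliceR A hh).toLinearMap := by
    refine G.eq_of_mul_left_comul (hh.continuous.comp (sliceR A hκ).continuous)
      (hh.continuous.comp (sliceR A hh).continuous) fun a c => ?_
    -- The identity `key` has `c` on the left of the slice, whereas the density condition has `A ⊗
    -- 1` on the right of `Δ(A)`; passing to adjoints exchanges the sides.
    have h3 := congrArg star (key (star a) (star c))
    rw [G.convR_star, G.convR_star, ← star_mul, ← star_mul, hh.apply_star, hh.apply_star,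
      star_star, star_star] at h3
    change h (sliceR A hκ _) = h (sliceR A hh _)
    rw [sliceR_mul_left, sliceR_mul_left]
    exact h3
  refine LinearMap.ext fun d => ?_
  have h4 : h (sliceR A hκ (MinTensor.of A A (1 ⊗ₜ d))) =
    h (sliceR A hh (MinTensor.of A A (1 ⊗ₜ d))) := LinearMap.congr_fun hfg _
  rw [sliceR_tmul, sliceR_tmul, map_smul, map_smul, hh.apply_one, smul_eq_mul, smul_eq_mul,
    mul_one, mul_one] at h4
  exact h4

/-- A state absorbing the average `(ρ + σ)/2` on both sides absorbs `ρ` on the left, and by symmetry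
of the average it absorbs `σ` as well. -/
lemma exists_common_absorbing_state {ρ σ : A →ₗ[ℂ] ℂ} (hρ : IsState ρ) (hσ : IsState σ) :
    ∃ (h : A →ₗ[ℂ] ℂ) (hh : IsState h), G.conv ρ hh = h ∧ G.conv σ hh = h := by
  obtain ⟨h, hh, h1, h2⟩ := G.exists_absorbing_state (hρ.average hσ)
  refine ⟨h, hh, G.conv_eq_of_absorbing hρ hσ hh h1 h2, ?_⟩
  have hc : (2⁻¹ : ℂ) • (ρ + σ) = (2⁻¹ : ℂ) • (σ + ρ) := by rw [add_comm]
  -- The convolution operators carry a proof that the functional is a state, so exchanging the two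
  -- summands of the average needs transport along an equality of functionals.
  have aux : ∀ {ω ω' : A →ₗ[ℂ] ℂ} (hω : IsState ω) (hω' : IsState ω'), ω = ω' →
      G.convR hω = G.convR hω' ∧ G.convL hω = G.convL hω' := fun hω hω' h => by
    subst h; exact ⟨rfl, rfl⟩
  obtain ⟨e1, e2⟩ := aux (hρ.average hσ) (hσ.average hρ) hc
  exact G.conv_eq_of_absorbing hσ hρ hh (fun a => by rw [← e1, h1]) fun a => by rw [← e2, h2]

/-- The fixed points of `id ⊗ Δ` are the elements `b ⊗ 1`. -/
lemma exists_eq_left {B : Type u} [CStarAlgebra B] {x : MinTensor B A}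
    (hx : MinTensor₃.assocR B A A (MinTensor.map (StarAlgHom.id ℂ B) G.comul x) =
      MinTensor₃.assocL B A A (MinTensor.left (MinTensor B A) A x)) :
    ∃ b, x = MinTensor.left B A b := by
  have := G.nontrivial
  obtain ⟨ρ, hρ, -⟩ := exists_isState_norm (1 : A)
  -- It suffices that all slices of `x` by states coincide, since the slices of `b ⊗ 1` all equal
  -- `b`.
  refine ⟨sliceR B hρ x, eq_of_sliceR fun σ hσ => ?_⟩
  rw [sliceR_left]
  refine eq_of_isState fun ψ hψ => ?_
  obtain ⟨h, hh, h1, h2⟩ := G.exists_common_absorbing_state hρ hσ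
  -- Evaluate `ψ ⊗ φ ⊗ h` on `x ⊗ 1 = (id ⊗ Δ)(x)`: the left side loses `h`, and the right side
  -- turns `φ` into `φ * h`. For `φ = ρ` and `φ = σ` the latter is `h`.
  have key : ∀ {φ : A →ₗ[ℂ] ℂ} (hφ : IsState φ), ψ (sliceR B hφ x) =
      G.conv φ hh (sliceL A hψ x) := fun hφ => by
    have h3 := assoc_slice hφ hψ hh hx.symm
    rw [sliceR_left, sliceL_map] at h3
    exact h3
  rw [key hσ, key hρ, h1, h2]

end CompactQuantumGroup
end Convolution

/-! ### Matrix coefficients, the map `(T ⊗ id) ∘ δ_u`, and cancellation by unitarity -/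

section Coefficients
variable {A : Type u} [CStarAlgebra A] {G : CompactQuantumGroup A}

lemma coeff_amp {V : Type*} [NormedAddCommGroup V] [InnerProductSpace ℂ V]
    [FiniteDimensional ℂ V] {A' : Type u} [CStarAlgebra A'] (f : A →⋆ₐ[ℂ] A')
    (x : Module.End ℂ V ⊗[ℂ] A) (ξ η : V) : coeff (amp V f x) ξ η = f (coeff x ξ η) := by
  induction x using TensorProduct.induction_on with
  | zero => simp only [map_zero, coeff_zero]
  | add x y hx hy => simp only [map_add, coeff_add, hx, hy]
  | tmul x a => rw [amp_tmul, coeff_tmul, coeff_tmul, map_smul]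

/-- `Δ(u_{ξη}) = ∑ u_{ξk} ⊗ u_{kη}` -/
lemma FinRep.comul_coeff (u : FinRep G) {ι : Type*} [Fintype ι] (e : OrthonormalBasis ι ℂ u.H)
    (ξ η : u.H) : G.comul (coeff u.elt ξ η) =
      ∑ k, MinTensor.of A A (coeff u.elt ξ (e k) ⊗ₜ coeff u.elt (e k) η) := by
  rw [← coeff_amp, u.comul, coeff_mul e]
  refine Finset.sum_congr rfl fun k _ => ?_
  rw [coeff_amp, coeff_amp]
  change MinTensor.of A A (_ ⊗ₜ 1) * MinTensor.of A A (1 ⊗ₜ _) = _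
  rw [← map_mul, Algebra.TensorProduct.tmul_mul_tmul, mul_one, one_mul]

lemma leg12_mul_leg3 {B C D : Type u} [CStarAlgebra B] [CStarAlgebra C] [CStarAlgebra D] (b : B)
    (c : C) (d : D) : MinTensor₃.leg12 B C D (MinTensor.of B C (b ⊗ₜ c)) * MinTensor₃.leg3 B C D d =
      MinTensor₃.of B C D ((b ⊗ₜ c) ⊗ₜ d) := by
  rw [MinTensor₃.leg12_of, MinTensor₃.leg3_apply, ← map_mul, Algebra.TensorProduct.tmul_mul_tmul,
    mul_one, one_mul]

lemma leg1_mul_leg23 {B C D : Type u} [CStarAlgebra B] [CStarAlgebra C] [CStarAlgebra D] (b : B)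
    (c : C) (d : D) : MinTensor₃.leg1 B C D b * MinTensor₃.leg23 B C D (MinTensor.of C D (c ⊗ₜ d)) =
      MinTensor₃.of B C D ((b ⊗ₜ c) ⊗ₜ d) := by
  rw [MinTensor₃.leg23_of, MinTensor₃.leg1_apply, ← map_mul, Algebra.TensorProduct.tmul_mul_tmul,
    Algebra.TensorProduct.tmul_mul_tmul, mul_one, one_mul, one_mul]

lemma assocL_left {B C D : Type u} [CStarAlgebra B] [CStarAlgebra C] [CStarAlgebra D]
    (x : MinTensor B C) : MinTensor₃.assocL B C D (MinTensor.left (MinTensor B C) D x) =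
      MinTensor₃.leg12 B C D x := by
  refine (MinTensor₃.assocL_of x 1).trans ?_
  rw [map_one, mul_one]

/-- A state of `D` in the third leg recovers every `(ψ ⊗ φ)(x)` from `x ⊗ 1`, and product states
separate the points of `B ⊗ C`. -/
lemma leg12_injective {B C D : Type u} [CStarAlgebra B] [CStarAlgebra C] [CStarAlgebra D]
    [Nontrivial D] : Function.Injective (MinTensor₃.leg12 B C D) := fun x y h => by
  obtain ⟨χ, hχ, -⟩ := exists_isState_norm (1 : D)
  refine eq_of_sliceR fun φ hφ => eq_of_isState fun ψ hψ => ?_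
  obtain ⟨Φ, h1, -⟩ := exists_tripleFunctional hφ hψ hχ
  have h2 : ∀ x, ψ (sliceR B hφ x) = Φ (MinTensor₃.leg12 B C D x) := fun x => by
    rw [← assocL_left, h1, sliceR_left]
  rw [h2, h2, h]

variable {B C : Type u} [CStarAlgebra B] [CStarAlgebra C] (u : FinRep G)

/-- The map `(T ⊗ id) ∘ δ_u : H_u → B ⊗ C(𝔾)`. -/
def toTensor (T : u.H →ₗ[ℂ] B) : u.H →ₗ[ℂ] MinTensor B A :=
  (MinTensor.of B A).toAlgHom.toLinearMap ∘ₗ LinearMap.rTensor A T ∘ₗ u.δ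

lemma toTensor_apply (T : u.H →ₗ[ℂ] B) (ξ : u.H) :
    toTensor u T ξ = MinTensor.of B A (LinearMap.rTensor A T (u.δ ξ)) := rfl

section
variable {u} {ι : Type*} [Fintype ι] (e : OrthonormalBasis ι ℂ u.H)

lemma rTensor_δ {S : Type*} [AddCommGroup S] [Module ℂ S] (T : u.H →ₗ[ℂ] S) (ξ : u.H) :
    LinearMap.rTensor A T (u.δ ξ) = ∑ k, T (e k) ⊗ₜ coeff u.elt (e k) ξ := by
  conv_lhs => rw [← slice_expand e (u.δ ξ), map_sum]
  rfl

lemma toTensor_eq_sum (T : u.H →ₗ[ℂ] B) (ξ : u.H) :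
    toTensor u T ξ = ∑ k, MinTensor.of B A (T (e k) ⊗ₜ coeff u.elt (e k) ξ) := by
  rw [toTensor_apply, rTensor_δ e, map_sum]

/-- Stated for a general `f` so as to serve twice: with `f = Δ` for equivariance under `𝔾`, and with
`f = (π ⊗ id)Δ` for the condition defining `Ind(B)`. -/
lemma assocR_map_toTensor (T : u.H →ₗ[ℂ] B) {f : A →⋆ₐ[ℂ] MinTensor C A} {w : u.H → u.H → C}
    (hf : ∀ ξ η, f (coeff u.elt ξ η) =
      ∑ k, MinTensor.of C A (w ξ (e k) ⊗ₜ coeff u.elt (e k) η)) (ξ : u.H) :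
    MinTensor₃.assocR B C A (MinTensor.map (StarAlgHom.id ℂ B) f (toTensor u T ξ)) =
      ∑ k, MinTensor₃.leg12 B C A (∑ l, MinTensor.of B C (T (e l) ⊗ₜ w (e l) (e k))) *
        MinTensor₃.leg3 B C A (coeff u.elt (e k) ξ) := by
  rw [toTensor_eq_sum e, map_sum, map_sum]
  simp only [map_sum, Finset.sum_mul, leg12_mul_leg3]
  rw [Finset.sum_comm]
  refine Finset.sum_congr rfl fun l _ => ?_
  rw [MinTensor.map_of, starMap_tmul, MinTensor₃.assocR_of, hf, map_sum, Finset.mul_sum]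
  simp only [leg1_mul_leg23]
  rfl

lemma assocL_map_toTensor {D : Type u} [CStarAlgebra D] (T : u.H →ₗ[ℂ] B)
    (f : B →⋆ₐ[ℂ] MinTensor D C) (ξ : u.H) :
    MinTensor₃.assocL D C A (MinTensor.map f (StarAlgHom.id ℂ A) (toTensor u T ξ)) =
      ∑ k, MinTensor₃.leg12 D C A (f (T (e k))) * MinTensor₃.leg3 D C A (coeff u.elt (e k) ξ) := by
  rw [toTensor_eq_sum e, map_sum, map_sum]
  refine Finset.sum_congr rfl fun l _ => ?_
  rw [MinTensor.map_of, starMap_tmul, MinTensor₃.assocL_of]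
  rfl

/-- The relation `u u^* = 1` in coefficients: multiplication by the adjoint coefficients on the
right recovers `d` from the sums `∑ d(e_k) u_{kξ}`. The homomorphism `f` places the coefficients in
whichever leg is needed. -/
lemma sum_coeff_mul_conj_smul {S : Type*} [CStarAlgebra S] (f : A →⋆ₐ[ℂ] S) (d : u.H →ₗ[ℂ] S)
    (η : u.H) : ∑ j, (∑ k, d (e k) * f (coeff u.elt (e k) (e j))) *
      f (star (coeff u.elt η (e j))) = d η := by
  calc _ = ∑ k, d (e k) * f (∑ j, coeff u.elt (e k) (e j) * star (coeff u.elt η (e j))) := by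
        simp only [Finset.sum_mul, map_sum, Finset.mul_sum, map_mul, mul_assoc]
        exact Finset.sum_comm
    _ = ∑ k, inner ℂ (e k) η • d (e k) := by
        refine Finset.sum_congr rfl fun k _ => ?_
        rw [u.coeff_mul_conj e, map_smul, map_one, mul_smul_comm, mul_one]
    _ = d η := by
        conv_rhs => rw [← e.sum_repr' η, map_sum]
        simp only [map_smul]

/-- A linear map `d` is determined by `∑ d(e_k) ⊗ u_{kξ}`. -/
lemma eq_of_sum_leg12 [Nontrivial A] {d d' : u.H →ₗ[ℂ] MinTensor B C}
    (h : ∀ ξ, ∑ k, MinTensor₃.leg12 B C A (d (e k)) * MinTensor₃.leg3 B C A (coeff u.elt (e k) ξ) =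
      ∑ k, MinTensor₃.leg12 B C A (d' (e k)) * MinTensor₃.leg3 B C A (coeff u.elt (e k) ξ)) :
    d = d' := by
  refine LinearMap.ext fun η => leg12_injective (D := A) ?_
  have h1 := fun d : u.H →ₗ[ℂ] MinTensor B C => sum_coeff_mul_conj_smul e (MinTensor₃.leg3 B C A)
    ((MinTensor₃.leg12 B C A).toAlgHom.toLinearMap ∘ₗ d) η
  refine (h1 d).symm.trans (Eq.trans ?_ (h1 d'))
  refine Finset.sum_congr rfl fun j _ => ?_
  congr 1
  exact h (e j)

/-- Multiplying by `1 ⊗ u^*` recovers `T(η) ⊗ 1`, and `b ↦ b ⊗ 1` is injective. -/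
lemma toTensor_injective [Nontrivial A] : Function.Injective (toTensor (B := B) u) :=
    fun T T' h => by
  let e := stdOrthonormalBasis ℂ u.H
  refine LinearMap.ext fun η => left_injective (A := A) ?_
  have h1 := fun T : u.H →ₗ[ℂ] B => sum_coeff_mul_conj_smul e (MinTensor.right B A)
    ((MinTensor.left B A).toAlgHom.toLinearMap ∘ₗ T) η
  have h2 : ∀ (T : u.H →ₗ[ℂ] B) ξ, ∑ k, ((MinTensor.left B A).toAlgHom.toLinearMap ∘ₗ T) (e k) *
      MinTensor.right B A (coeff u.elt (e k) ξ) = toTensor u T ξ := fun T ξ => by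
    rw [toTensor_eq_sum e]
    refine Finset.sum_congr rfl fun k _ => ?_
    change MinTensor.of B A (_ ⊗ₜ 1) * MinTensor.of B A (1 ⊗ₜ _) = _
    rw [← map_mul, Algebra.TensorProduct.tmul_mul_tmul, mul_one, one_mul]
  refine (h1 T).symm.trans (Eq.trans ?_ (h1 T'))
  simp only [h2, h]

/-- `η ↦ ∑ S(e_j) (1 ⊗ u_{ηj}^*)` -/
def untwist (e : OrthonormalBasis ι ℂ u.H) (S : u.H →ₗ[ℂ] MinTensor B A) :
    u.H →ₗ[ℂ] MinTensor B A where
  toFun η := ∑ j, S (e j) * MinTensor.right B A (star (coeff u.elt η (e j)))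
  -- Coefficients are conjugate-linear in their first vector, and the adjoint in the formula makes
  -- the dependence on `η` linear.
  map_add' η η' := by
    have : ∀ ζ, coeff u.elt (η + η') ζ = coeff u.elt η ζ + coeff u.elt η' ζ := fun ζ => by
      rw [u.coeff_sum_left e (η + η'), u.coeff_sum_left e η, u.coeff_sum_left e η',
        ← Finset.sum_add_distrib]
      simp only [inner_add_left, add_smul]
    simp only [this, star_add, map_add, mul_add, Finset.sum_add_distrib]
  map_smul' c η := by
    have : ∀ ζ, coeff u.elt (c • η) ζ = star c • coeff u.elt η ζ := fun ζ => by
      rw [u.coeff_sum_left e (c • η), u.coeff_sum_left e η, Finset.smul_sum]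
      simp only [inner_smul_left, smul_smul]
      rfl
    simp only [this, star_smul, star_star, map_smul, mul_smul_comm, Finset.smul_sum,
      RingHom.id_apply]

lemma untwist_apply (S : u.H →ₗ[ℂ] MinTensor B A) (η : u.H) : untwist e S η =
    ∑ j, S (e j) * MinTensor.right B A (star (coeff u.elt η (e j))) := rfl

/-- The other half of unitarity, `u^* u = 1`: twisting back returns `S`. -/
lemma sum_untwist (S : u.H →ₗ[ℂ] MinTensor B A) (ξ : u.H) :
    ∑ k, untwist e S (e k) * MinTensor.right B A (coeff u.elt (e k) ξ) = S ξ := by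
  calc _ = ∑ j, S (e j) * MinTensor.right B A
          (∑ k, star (coeff u.elt (e k) (e j)) * coeff u.elt (e k) ξ) := by
        simp only [untwist_apply, Finset.sum_mul, map_sum, Finset.mul_sum, map_mul, mul_assoc]
        exact Finset.sum_comm
    _ = ∑ j, inner ℂ (e j) ξ • S (e j) := by
        refine Finset.sum_congr rfl fun j _ => ?_
        rw [u.coeff_conj_mul e, map_smul, map_one, mul_smul_comm, mul_one]
    _ = S ξ := by
        conv_rhs => rw [← e.sum_repr' ξ, map_sum]
        simp only [map_smul]

lemma leg23_eq {B C D : Type u} [CStarAlgebra B] [CStarAlgebra C] [CStarAlgebra D] (c : C) (d : D) :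
    MinTensor₃.leg23 B C D (MinTensor.of C D (c ⊗ₜ d)) =
      MinTensor₃.leg12 B C D (MinTensor.right B C c) * MinTensor₃.leg3 B C D d := by
  have h := leg12_mul_leg3 (1 : B) c d
  have h1 := leg1_mul_leg23 (1 : B) c d
  rw [map_one, one_mul] at h1
  exact h1.trans h.symm

lemma assocR_right {B C D E : Type u} [CStarAlgebra B] [CStarAlgebra C] [CStarAlgebra D]
    [CStarAlgebra E] (f : E →⋆ₐ[ℂ] MinTensor C D) (a : E) :
    MinTensor₃.assocR B C D (MinTensor.map (StarAlgHom.id ℂ B) f (MinTensor.right B E a)) =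
      MinTensor₃.leg23 B C D (f a) := by
  change MinTensor₃.assocR B C D (MinTensor.map _ f (MinTensor.of B E (1 ⊗ₜ a))) = _
  rw [MinTensor.map_of, starMap_tmul, MinTensor₃.assocR_of, map_one, map_one, one_mul]

lemma leg23_comul_star_coeff (η ξ : u.H) :
    MinTensor₃.leg23 B A A (G.comul (star (coeff u.elt η ξ))) =
      ∑ m, MinTensor₃.leg12 B A A (MinTensor.right B A (star (coeff u.elt η (e m)))) *
        MinTensor₃.leg3 B A A (star (coeff u.elt (e m) ξ)) := by
  rw [map_star, u.comul_coeff e, star_sum, map_sum]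
  refine Finset.sum_congr rfl fun m _ => ?_
  rw [← map_star, TensorProduct.star_tmul, leg23_eq]

/-- Equivariance gives `(id ⊗ Δ)(S(e_j)) = ∑ S(e_l) ⊗ u_{lj}`, and `Δ(u_{ηj}^*) = ∑ u_{ηm}^* ⊗
u_{mj}^*`. In the third leg the sum over `j` of `u_{lj} u_{mj}^*` is `δ_{lm}`, which leaves `1`
there. -/
lemma untwist_fixed {S : u.H →ₗ[ℂ] MinTensor B A}
    (hS : ∀ ξ, MinTensor₃.assocR B A A (MinTensor.map (StarAlgHom.id ℂ B) G.comul (S ξ)) =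
      ∑ k, MinTensor₃.leg12 B A A (S (e k)) * MinTensor₃.leg3 B A A (coeff u.elt (e k) ξ))
    (η : u.H) :
    MinTensor₃.assocR B A A (MinTensor.map (StarAlgHom.id ℂ B) G.comul (untwist e S η)) =
      MinTensor₃.assocL B A A (MinTensor.left (MinTensor B A) A (untwist e S η)) := by
  rw [assocL_left]
  let w : u.H →ₗ[ℂ] MinTensor₃ B A A := (MinTensor₃.leg12 B A A).toAlgHom.toLinearMap ∘ₗ S
  have comm := MinTensor₃.commute_leg12_leg3 (A := B) (B := A) (C := A)
  calc MinTensor₃.assocR B A A (MinTensor.map (StarAlgHom.id ℂ B) G.comul (untwist e S η))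
      = ∑ j, (∑ l, MinTensor₃.leg12 B A A (S (e l)) *
          MinTensor₃.leg3 B A A (coeff u.elt (e l) (e j))) *
        ∑ m, MinTensor₃.leg12 B A A (MinTensor.right B A (star (coeff u.elt η (e m)))) *
        MinTensor₃.leg3 B A A (star (coeff u.elt (e m) (e j))) := by
        rw [untwist_apply, map_sum, map_sum]
        refine Finset.sum_congr rfl fun j _ => ?_
        rw [map_mul, map_mul, hS, assocR_right, leg23_comul_star_coeff e]
    _ = ∑ m, (∑ j, (∑ l, w (e l) * MinTensor₃.leg3 B A A (coeff u.elt (e l) (e j))) *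
          MinTensor₃.leg3 B A A (star (coeff u.elt (e m) (e j)))) *
        MinTensor₃.leg12 B A A (MinTensor.right B A (star (coeff u.elt η (e m)))) := by
        simp only [Finset.mul_sum _ _ (∑ l, _)]
        rw [Finset.sum_comm]
        refine Finset.sum_congr rfl fun m _ => ?_
        rw [Finset.sum_mul]
        refine Finset.sum_congr rfl fun j _ => ?_
        -- The third leg commutes with the first two, so the factors `u_{lj}` and `u_{mj}^*` can be
        -- brought next to each other.
        rw [(comm _ _).eq, ← mul_assoc]
        rfl
    _ = ∑ m, w (e m) *
        MinTensor₃.leg12 B A A (MinTensor.right B A (star (coeff u.elt η (e m)))) := by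
        refine Finset.sum_congr rfl fun m _ => ?_
        rw [sum_coeff_mul_conj_smul e]
    _ = _ := by
        rw [untwist_apply, map_sum]
        simp only [map_mul]
        rfl

/-- The untwisted map takes values in `B ⊗ 1` by the fixed-point lemma, so it is a linear map into
`B`, and retwisting it gives `S`. The argument takes place in `B ⊗ C(𝔾)` and does not involve
`Ind(B)`. -/
lemma exists_toTensor_eq {S : u.H →ₗ[ℂ] MinTensor B A}
    (hS : ∀ ξ, MinTensor₃.assocR B A A (MinTensor.map (StarAlgHom.id ℂ B) G.comul (S ξ)) =
      ∑ k, MinTensor₃.leg12 B A A (S (e k)) * MinTensor₃.leg3 B A A (coeff u.elt (e k) ξ)) :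
    ∃ T : u.H →ₗ[ℂ] B, toTensor u T = S := by
  have := G.nontrivial
  obtain ⟨φ, hφ, -⟩ := exists_isState_norm (1 : A)
  -- Any state reads off `b` from `b ⊗ 1`; using a slice map makes the dependence on `η` visibly
  -- linear.
  refine ⟨(sliceR B hφ).toLinearMap ∘ₗ untwist e S, LinearMap.ext fun ξ => ?_⟩
  rw [toTensor_eq_sum e, ← sum_untwist e S ξ]
  refine Finset.sum_congr rfl fun k _ => ?_
  obtain ⟨b, hb⟩ := G.exists_eq_left (untwist_fixed e hS (e k))
  have h1 : ((sliceR B hφ).toLinearMap ∘ₗ untwist e S) (e k) = b := by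
    change sliceR B hφ (untwist e S (e k)) = b
    rw [hb, sliceR_left]
  rw [h1, hb]
  change _ = MinTensor.of B A (_ ⊗ₜ 1) * MinTensor.of B A (1 ⊗ₜ _)
  rw [← map_mul, Algebra.TensorProduct.tmul_mul_tmul, mul_one, one_mul]

/-- Again `u u^* = 1`: the sum over `i` of `u_{ki} u_{li}^*` is `δ_{kl}`, and only the diagonal
terms, with `1` in the second leg, remain. -/
lemma sum_toTensor_mul_star (T R : u.H →ₗ[ℂ] B) :
    ∑ i, toTensor u T (e i) * star (toTensor u R (e i)) =
      MinTensor.left B A (∑ k, T (e k) * star (R (e k))) := by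
  classical
  calc _ = ∑ i, ∑ k, ∑ l, MinTensor.of B A ((T (e k) * star (R (e l))) ⊗ₜ
          (coeff u.elt (e k) (e i) * star (coeff u.elt (e l) (e i)))) := by
        refine Finset.sum_congr rfl fun i _ => ?_
        rw [toTensor_eq_sum e, toTensor_eq_sum e, star_sum, Finset.sum_mul_sum]
        refine Finset.sum_congr rfl fun k _ => Finset.sum_congr rfl fun l _ => ?_
        rw [← map_star, ← map_mul, TensorProduct.star_tmul, Algebra.TensorProduct.tmul_mul_tmul]
    _ = ∑ k, ∑ l, MinTensor.of B A ((T (e k) * star (R (e l))) ⊗ₜ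
          (∑ i, coeff u.elt (e k) (e i) * star (coeff u.elt (e l) (e i)))) := by
        rw [Finset.sum_comm]
        refine Finset.sum_congr rfl fun k _ => ?_
        rw [Finset.sum_comm]
        simp only [TensorProduct.tmul_sum, map_sum]
    _ = ∑ k, MinTensor.of B A ((T (e k) * star (R (e k))) ⊗ₜ 1) := by
        refine Finset.sum_congr rfl fun k _ => ?_
        simp only [u.coeff_mul_conj e, orthonormal_iff_ite.1 e.orthonormal]
        rw [Finset.sum_eq_single k]
        · simp
        · intro l _ hl
          simp [hl.symm]
        · simp
    _ = _ := by rw [map_sum]; rfl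

end
end Coefficients

/-! ### The bijection between spectral subspaces, ergodicity, and the isomorphism of functors -/

section InducedSpectral
variable {A A' B : Type u} [CStarAlgebra A] [CStarAlgebra A'] [CStarAlgebra B]
  {G : CompactQuantumGroup A} {H : CompactQuantumGroup A'} {P : QuantumSubgroup G H}
  {α : Action H B} {u : FinRep G}

lemma toTensor_add (u : FinRep G) (T R : u.H →ₗ[ℂ] B) (ξ : u.H) :
    toTensor u (T + R) ξ = toTensor u T ξ + toTensor u R ξ := by
  rw [toTensor_apply, LinearMap.rTensor_add, LinearMap.add_apply, map_add]
  rfl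

lemma toTensor_smul (u : FinRep G) (c : ℂ) (T : u.H →ₗ[ℂ] B) (ξ : u.H) :
    toTensor u (c • T) ξ = c • toTensor u T ξ := by
  rw [toTensor_apply, LinearMap.rTensor_smul, LinearMap.smul_apply, map_smul]
  rfl

lemma toTensor_comp {v : FinRep G} (T : u.H →ₗ[ℂ] B) (R : FinRep.Mor v u) (ξ : v.H) :
    toTensor v (T ∘ₗ R.1) ξ = toTensor u T (R.1 ξ) := by
  rw [toTensor_apply, toTensor_apply, FinRep.Mor.δ_apply, LinearMap.rTensor_comp_apply]

lemma rTensor_δ_res (P : QuantumSubgroup G H) {ι : Type*} [Fintype ι]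
    (e : OrthonormalBasis ι ℂ u.H) (T : u.H →ₗ[ℂ] B) (ξ : u.H) :
    LinearMap.rTensor A' T ((u.res P).δ ξ) = ∑ k, T (e k) ⊗ₜ P.π (coeff u.elt (e k) ξ) := by
  have h : (u.res P).δ ξ = LinearMap.lTensor u.H P.π.toAlgHom.toLinearMap (u.δ ξ) :=
    LinearMap.congr_fun (FinRep.δ_res P u) ξ
  rw [h, ← slice_expand e (u.δ ξ), map_sum, map_sum]
  rfl

/-- The linear map `η ↦ ∑ T(e_l) ⊗ π(u_{lη})`. -/
def resTensorMap (P : QuantumSubgroup G H) (T : u.H →ₗ[ℂ] B) : u.H →ₗ[ℂ] MinTensor B A' :=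
  (MinTensor.of B A').toAlgHom.toLinearMap ∘ₗ LinearMap.rTensor A' T ∘ₗ (u.res P).δ

lemma resTensorMap_eq_sum (P : QuantumSubgroup G H) {ι : Type*} [Fintype ι]
    (e : OrthonormalBasis ι ℂ u.H) (T : u.H →ₗ[ℂ] B) (ξ : u.H) :
    resTensorMap P T ξ = ∑ k, MinTensor.of B A' (T (e k) ⊗ₜ P.π (coeff u.elt (e k) ξ)) := by
  change MinTensor.of B A' (LinearMap.rTensor A' T ((u.res P).δ ξ)) = _
  rw [rTensor_δ_res P e, map_sum]

lemma indR_toTensor {ι : Type*} [Fintype ι] (e : OrthonormalBasis ι ℂ u.H) (T : u.H →ₗ[ℂ] B)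
    (ξ : u.H) : indR P B (toTensor u T ξ) = ∑ k, MinTensor₃.leg12 B A' A (resTensorMap P T (e k)) *
      MinTensor₃.leg3 B A' A (coeff u.elt (e k) ξ) := by
  simp only [resTensorMap_eq_sum P e]
  refine assocR_map_toTensor e T (w := fun ξ η => P.π (coeff u.elt ξ η)) (fun ξ η => ?_) ξ
  rw [StarAlgHom.comp_apply, u.comul_coeff e, map_sum]
  refine Finset.sum_congr rfl fun k _ => ?_
  rw [MinTensor.map_of, starMap_tmul]
  rfl

lemma indL_toTensor {ι : Type*} [Fintype ι] (e : OrthonormalBasis ι ℂ u.H) (T : u.H →ₗ[ℂ] B)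
    (ξ : u.H) : indL A α (toTensor u T ξ) = ∑ k, MinTensor₃.leg12 B A' A (α.hom (T (e k))) *
      MinTensor₃.leg3 B A' A (coeff u.elt (e k) ξ) := assocL_map_toTensor e T α.hom ξ

lemma mem_specMor_res {T : u.H →ₗ[ℂ] B} :
    T ∈ SpecMor (u.res P) α.coaction ↔ ∀ ξ, α.hom (T ξ) = resTensorMap P T ξ := Iff.rfl

/-- `(T ⊗ id) ∘ δ_u` takes values in `Ind(B)` if and only if `T` is equivariant. -/
lemma toTensor_mem_ind_iff {T : u.H →ₗ[ℂ] B} : (∀ ξ, toTensor u T ξ ∈ Ind P α) ↔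
    T ∈ SpecMor (u.res P) α.coaction := by
  have := G.nontrivial
  let e := stdOrthonormalBasis ℂ u.H
  have h0 : ∀ ξ, toTensor u T ξ ∈ Ind P α ↔
    indL A α (toTensor u T ξ) = indR P B (toTensor u T ξ) := fun ξ => Iff.rfl
  rw [mem_specMor_res]
  simp only [h0, indL_toTensor e, indR_toTensor e]
  refine ⟨fun h => ?_, fun h ξ => by simp only [h]⟩
  -- Membership in `Ind(B)` equates two sums `∑ d(e_k) ⊗ u_{kξ}`, with `d = α ∘ T` and `d = (T ⊗ id)
  -- ∘ δ_{Res(u)}`; cancelling `u` gives the equivariance of `T`.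
  have h1 := eq_of_sum_leg12 (d := α.hom.toAlgHom.toLinearMap ∘ₗ T) (d' := resTensorMap P T) e h
  exact fun ξ => LinearMap.congr_fun h1 ξ

lemma indAction_emb_sum {ι : Type*} [Fintype ι] (e : OrthonormalBasis ι ℂ u.H)
    (S : u.H →ₗ[ℂ] Ind P α) (ξ : u.H) :
    (indAction P α).emb (LinearMap.rTensor A S (u.δ ξ)) =
      ∑ k, MinTensor₃.leg12 B A A (S (e k)) * MinTensor₃.leg3 B A A (coeff u.elt (e k) ξ) := by
  rw [rTensor_δ e, map_sum]
  refine Finset.sum_congr rfl fun k _ => ?_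
  change MinTensor₃.assocL B A A (MinTensor.map (Ind P α).subtype (StarAlgHom.id ℂ A)
    (MinTensor.of _ A (S (e k) ⊗ₜ _))) = _
  rw [MinTensor.map_of, starMap_tmul, MinTensor₃.assocL_of]
  rfl

/-- Puts equivariance inside `B ⊗ C(𝔾) ⊗ C(𝔾)`, in the form used by the untwisting argument. -/
lemma mem_specMor_ind {ι : Type*} [Fintype ι] (e : OrthonormalBasis ι ℂ u.H)
    {S : u.H →ₗ[ℂ] Ind P α} : S ∈ SpecMor u (indAction P α) ↔ ∀ ξ,
      MinTensor₃.assocR B A A (MinTensor.map (StarAlgHom.id ℂ B) G.comul (S ξ)) =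
      ∑ k, MinTensor₃.leg12 B A A (S (e k)) * MinTensor₃.leg3 B A A (coeff u.elt (e k) ξ) := by
  simp only [← indAction_emb_sum e]
  rfl

lemma assocR_comul_toTensor {ι : Type*} [Fintype ι] (e : OrthonormalBasis ι ℂ u.H)
    (T : u.H →ₗ[ℂ] B) (ξ : u.H) :
    MinTensor₃.assocR B A A (MinTensor.map (StarAlgHom.id ℂ B) G.comul (toTensor u T ξ)) =
      ∑ k, MinTensor₃.leg12 B A A (toTensor u T (e k)) *
        MinTensor₃.leg3 B A A (coeff u.elt (e k) ξ) := by
  simp only [toTensor_eq_sum e T (e _)]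
  exact assocR_map_toTensor e T (u.comul_coeff e) ξ

/-- The bijection `T ↦ (T ⊗ id) ∘ δ_u` as a function. -/
def inducedMor (T : SpecMor (u.res P) α.coaction) : SpecMor u (indAction P α) :=
  ⟨LinearMap.codRestrict (Subalgebra.toSubmodule (Ind P α).toSubalgebra) (toTensor u T.1)
    (toTensor_mem_ind_iff.2 T.2),
    (mem_specMor_ind (stdOrthonormalBasis ℂ u.H)).2
      fun ξ => assocR_comul_toTensor (stdOrthonormalBasis ℂ u.H) T.1 ξ⟩

lemma coe_inducedMor (T : SpecMor (u.res P) α.coaction) (ξ : u.H) :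
    ((inducedMor T).1 ξ : MinTensor B A) = toTensor u T.1 ξ := rfl

lemma inducedMor_injective :
    Function.Injective (inducedMor (P := P) (α := α) (u := u)) := fun T R h => by
  have := G.nontrivial
  refine Subtype.ext (toTensor_injective (u := u) (LinearMap.ext fun ξ => ?_))
  rw [← coe_inducedMor, h, coe_inducedMor]

/-- The untwisting argument produces `T` for `S` viewed in `B ⊗ C(𝔾)`. Because the values of `S` lie
in `Ind(B)`, the membership criterion makes `T` equivariant under `ℍ`. -/
lemma inducedMor_surjective :
    Function.Surjective (inducedMor (P := P) (α := α) (u := u)) := fun S => by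
  obtain ⟨T, hT⟩ := exists_toTensor_eq (stdOrthonormalBasis ℂ u.H)
    (S := (Ind P α).subtype.toAlgHom.toLinearMap ∘ₗ S.1) ((mem_specMor_ind _).1 S.2)
  refine ⟨⟨T, toTensor_mem_ind_iff.1 fun ξ => ?_⟩, Subtype.ext (LinearMap.ext fun ξ =>
    Subtype.ext (LinearMap.congr_fun hT ξ))⟩
  rw [hT]
  exact (S.1 ξ).2

lemma inducedMor_add (T R : SpecMor (u.res P) α.coaction) :
    inducedMor (T + R) = inducedMor T + inducedMor R :=
  Subtype.ext (LinearMap.ext fun ξ => Subtype.ext (toTensor_add u T.1 R.1 ξ))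

lemma inducedMor_smul (c : ℂ) (T : SpecMor (u.res P) α.coaction) :
    inducedMor (c • T) = c • inducedMor T :=
  Subtype.ext (LinearMap.ext fun ξ => Subtype.ext (toTensor_smul u c T.1 ξ))

/-- The linear bijection `Mor(Res(u), α) → Mor(u, Ind(α))`, `T ↦ (T ⊗ id) ∘ δ_u`. -/
def inducedEquiv (P : QuantumSubgroup G H) (α : Action H B) (u : FinRep G) :
    SpecMor (u.res P) α.coaction ≃ₗ[ℂ] SpecMor u (indAction P α) where
  __ := Equiv.ofBijective inducedMor ⟨inducedMor_injective, inducedMor_surjective⟩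
  map_add' := inducedMor_add
  map_smul' := inducedMor_smul

lemma inducedEquiv_comp {v : FinRep G} (V : FinRep.Mor u v) (T : SpecMor (u.res P) α.coaction) :
    inducedEquiv P α v (SpecMor.comp T (FinRep.Mor.adj (FinRep.Mor.res P V))) =
      SpecMor.comp (inducedEquiv P α u T) (FinRep.Mor.adj V) := by
  refine Subtype.ext (LinearMap.ext fun ξ => Subtype.ext ?_)
  let T' : u.H →ₗ[ℂ] B := T.1
  change toTensor v (T' ∘ₗ (FinRep.Mor.adj V).1) ξ = toTensor u T' ((FinRep.Mor.adj V).1 ξ)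
  exact toTensor_comp T' (FinRep.Mor.adj V) ξ

/-- The identifications of `Res(u) ⊠ Res(v)` with `Res(u ⊠ v)` and of `1` with `Res(1)` are identity
maps that enter through their adjoints; this removes them. -/
lemma comp_adj_id {V : Type*} [NormedAddCommGroup V] [InnerProductSpace ℂ V]
    [FiniteDimensional ℂ V] (T : V →ₗ[ℂ] B) :
    T ∘ₗ LinearMap.adjoint (LinearMap.id : V →ₗ[ℂ] V) = T := by
  rw [LinearMap.adjoint_id, LinearMap.comp_id]

/-- Multiplicativity is that of `B ⊗ C(𝔾)`, since `δ_{u ⊠ v}(ξ ⊗ η)` is the product of `δ_u(ξ)` and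
`δ_v(η)` in the last leg. -/
lemma inducedEquiv_mul {v : FinRep G} (T : SpecMor (u.res P) α.coaction)
    (R : SpecMor (v.res P) α.coaction) :
    inducedEquiv P α (u.tensor v) (SpecMor.comp (SpecMor.mul T R)
      (FinRep.Mor.adj (FinRep.Mor.resTensor P u v))) =
      SpecMor.mul (inducedEquiv P α u T) (inducedEquiv P α v R) := by
  let T' : u.H →ₗ[ℂ] B := T.1
  let R' : v.H →ₗ[ℂ] B := R.1
  refine Subtype.ext (TensorProduct.ext' fun ξ η => Subtype.ext ?_)
  have h := comp_adj_id (LinearMap.mul' ℂ B ∘ₗ TensorProduct.map T' R')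
  change MinTensor.of B A (LinearMap.rTensor A ((LinearMap.mul' ℂ B ∘ₗ TensorProduct.map T' R') ∘ₗ
    LinearMap.adjoint (LinearMap.id : u.H ⊗[ℂ] v.H →ₗ[ℂ] u.H ⊗[ℂ] v.H))
      ((u.tensor v).δ (ξ ⊗ₜ[ℂ] η))) =
    MinTensor.of B A (LinearMap.rTensor A T' (u.δ ξ)) *
      MinTensor.of B A (LinearMap.rTensor A R' (v.δ η))
  rw [h, ← map_mul, ← rTensor_pairing, ← FinRep.δ_tensor]

lemma inducedEquiv_unit (c : ℂ) :
    inducedEquiv P α (FinRep.triv G) (SpecMor.comp (SpecMor.unit H α.coaction c)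
      (FinRep.Mor.adj (FinRep.Mor.resTriv P))) = SpecMor.unit G (indAction P α) c := by
  refine Subtype.ext (LinearMap.ext fun (z : ℂ) => Subtype.ext ?_)
  have h := comp_adj_id (LinearMap.toSpanSingleton ℂ B (c • 1))
  have h1 : (FinRep.triv G).δ z = z ⊗ₜ[ℂ] (1 : A) := FinRep.δ_triv z
  change MinTensor.of B A (LinearMap.rTensor A (LinearMap.toSpanSingleton ℂ B (c • 1) ∘ₗ
    LinearMap.adjoint (LinearMap.id : ℂ →ₗ[ℂ] ℂ)) ((FinRep.triv G).δ z)) =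
      z • (c • (1 : MinTensor B A))
  have h2 : LinearMap.rTensor A (LinearMap.toSpanSingleton ℂ B (c • 1)) (z ⊗ₜ[ℂ] (1 : A)) =
      z • (c • (1 : B ⊗[ℂ] A)) := by
    rw [LinearMap.rTensor_tmul, LinearMap.toSpanSingleton_apply, ← TensorProduct.smul_tmul',
      ← TensorProduct.smul_tmul']
    rfl
  rw [h, h1]
  exact (congrArg _ h2).trans (by rw [map_smul, map_smul, map_one])

lemma coe_ip_inducedEquiv (T R : SpecMor (u.res P) α.coaction) :
    ((SpecMor.ip (inducedEquiv P α u T) (inducedEquiv P α u R) : Ind P α) : MinTensor B A) =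
      MinTensor.left B A (SpecMor.ip T R) := by
  refine Eq.trans ?_ (sum_toTensor_mul_star (stdOrthonormalBasis ℂ u.H) (T.1 : u.H →ₗ[ℂ] B) R.1)
  exact map_sum (Ind P α).subtype _ _

/-- The induced action of an ergodic action is ergodic. -/
lemma isErgodic_indAction (hα : α.coaction.IsErgodic) : (indAction P α).IsErgodic where
  nontrivial := by
    have := G.nontrivial
    have := hα.nontrivial
    refine nontrivial_of_ne 1 0 fun h => one_ne_zero (α := B) (left_injective (A := A) ?_)
    rw [map_one, map_zero]
    exact congrArg Subtype.val h
  fixed x hx := by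
    have := G.nontrivial
    have h1 : (indAction P α).emb (x ⊗ₜ[ℂ] (1 : A)) =
        MinTensor₃.assocL B A A (MinTensor.left (MinTensor B A) A x.1) := by
      change MinTensor₃.assocL B A A (MinTensor.map (Ind P α).subtype (StarAlgHom.id ℂ A)
        (MinTensor.of _ A (x ⊗ₜ 1))) = _
      rw [MinTensor.map_of, starMap_tmul]
      rfl
    -- The fixed-point lemma gives `x = b ⊗ 1`. The condition defining `Ind(B)` then reads `α(b) ⊗ 1
    -- = b ⊗ 1 ⊗ 1`, and injectivity of the embedding of the first two legs makes `b` a fixed point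
    -- of `α`.
    obtain ⟨b, hb⟩ := G.exists_eq_left (hx.trans h1)
    have h2 : indL A α (MinTensor.left B A b) = indR P B (MinTensor.left B A b) := by
      rw [← hb]
      exact x.2
    have h3 : indL A α (MinTensor.left B A b) = MinTensor₃.leg12 B A' A (α.hom b) := by
      change MinTensor₃.assocL B A' A (MinTensor.map α.hom (StarAlgHom.id ℂ A)
        (MinTensor.of B A (b ⊗ₜ 1))) = _
      rw [MinTensor.map_of, starMap_tmul]
      exact assocL_left (α.hom b)
    have h4 : indR P B (MinTensor.left B A b) =
        MinTensor₃.leg12 B A' A (MinTensor.left B A' b) := by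
      change MinTensor₃.assocR B A' A (MinTensor.map (StarAlgHom.id ℂ B) _
        (MinTensor.of B A (b ⊗ₜ 1))) = MinTensor₃.leg12 B A' A (MinTensor.of B A' (b ⊗ₜ 1))
      rw [MinTensor.map_of, starMap_tmul, MinTensor₃.assocR_of, map_one, map_one, mul_one,
        MinTensor₃.leg12_of]
      rfl
    obtain ⟨c, hc⟩ := hα.fixed b (leg12_injective (h3.symm.trans (h2.trans h4)))
    refine ⟨c, Subtype.ext ?_⟩
    refine hb.trans ?_
    rw [hc, map_smul, map_one]
    rfl

/-- The unitary `φ_α(Res(u)) → φ_{Ind(α)}(u)`. -/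
def inducedUnitary (P : QuantumSubgroup G H) (hα : α.coaction.IsErgodic)
    (hI : (indAction P α).IsErgodic) (u : FinRep G) :
    Spectral (u.res P) α.coaction hα ≃ₗᵢ[ℂ] Spectral u (indAction P α) hI :=
  LinearEquiv.isometryOfInner
    { toFun := fun T => toSpectral hI (inducedEquiv P α u ((toSpectral hα).symm T))
      invFun := fun T => toSpectral hα ((inducedEquiv P α u).symm ((toSpectral hI).symm T))
      map_add' := fun T R => by rw [map_add, map_add, map_add]
      -- Scalars act by their conjugates on both spaces, so the two conjugations cancel.
      map_smul' := fun c T => by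
        rw [symm_smul, map_smul, toSpectral_smul, star_star, RingHom.id_apply]
      left_inv := fun T => by simp
      right_inv := fun T => by simp } fun T R => inner_eq hI (Subtype.ext (by
        refine (coe_ip_inducedEquiv _ _).trans ?_
        rw [SpecMor.scalarIp_smul_one hα, map_smul, map_one]
        rfl))

lemma inducedUnitary_toSpectral (hα : α.coaction.IsErgodic) (hI : (indAction P α).IsErgodic)
    (T : SpecMor (u.res P) α.coaction) : inducedUnitary P hα hI u (toSpectral hα T) =
      toSpectral hI (inducedEquiv P α u T) := rfl

/-- The natural unitary monoidal isomorphism `φ_α ∘ Res → φ_{Ind(α)}`. -/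
def inducedIso (P : QuantumSubgroup G H) (hα : α.coaction.IsErgodic)
    (hI : (indAction P α).IsErgodic) :
    NatUnitaryMonoidalIso ((spectralFunctor H α.coaction hα).compRes P)
      (spectralFunctor G (indAction P α) hI) where
  app := inducedUnitary P hα hI
  natural V x := congrArg (toSpectral hI) (inducedEquiv_comp V ((toSpectral hα).symm x))
  monoidal u v x y := by
    refine Eq.trans ?_ ((congrArg (toSpectral hI) (inducedEquiv_mul ((toSpectral hα).symm x)
      ((toSpectral hα).symm y))).trans (Spectral.ι_tmul hI u v (inducedUnitary P hα hI u x)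
        (inducedUnitary P hα hI v y)).symm)
    exact congrArg (fun z => inducedUnitary P hα hI (u.tensor v)
      (Spectral.map hα (FinRep.Mor.resTensor P u v) z)) (Spectral.ι_tmul hα _ _ x y)
  -- The conjugate appears because `φ(1)` carries the conjugate scalar multiplication, under which
  -- `z` corresponds to `w ↦ w z̄ 1`.
  unit z := congrArg (toSpectral hI) (inducedEquiv_unit (star z))

end InducedSpectral

end QG

end

theorem mainTheorem8 {A A' B : Type u} [CStarAlgebra A] [CStarAlgebra A'] [CStarAlgebra B]
    (G : QG.CompactQuantumGroup A) (H : QG.CompactQuantumGroup A') (P : QG.QuantumSubgroup G H)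
    (α : QG.Action H B) :
    ∃ ψ : ∀ u : QG.FinRep G,
        QG.SpecMor (u.res P) α.coaction ≃ₗ[ℂ] QG.SpecMor u (QG.indAction P α),
      (∀ (u v : QG.FinRep G) (V : QG.FinRep.Mor u v) (T : QG.SpecMor (u.res P) α.coaction),
        ψ v (QG.SpecMor.comp T (QG.FinRep.Mor.adj (QG.FinRep.Mor.res P V))) =
          QG.SpecMor.comp (ψ u T) (QG.FinRep.Mor.adj V)) ∧
      (∀ (u v : QG.FinRep G) (T : QG.SpecMor (u.res P) α.coaction)
          (R : QG.SpecMor (v.res P) α.coaction),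
        ψ (u.tensor v) (QG.SpecMor.comp (QG.SpecMor.mul T R)
            (QG.FinRep.Mor.adj (QG.FinRep.Mor.resTensor P u v))) =
          QG.SpecMor.mul (ψ u T) (ψ v R)) ∧
      (∀ c : ℂ,
        ψ (QG.FinRep.triv G) (QG.SpecMor.comp (QG.SpecMor.unit H α.coaction c)
            (QG.FinRep.Mor.adj (QG.FinRep.Mor.resTriv P))) =
          QG.SpecMor.unit G (QG.indAction P α) c) ∧
      (∀ (u : QG.FinRep G) (T R : QG.SpecMor (u.res P) α.coaction),
        ((QG.SpecMor.ip (ψ u T) (ψ u R) : QG.Ind P α) : QG.MinTensor B A) =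
          QG.MinTensor.left B A (QG.SpecMor.ip T R)) ∧
      ∀ hα : α.coaction.IsErgodic, ∃ hI : (QG.indAction P α).IsErgodic,
        ∃ Ψ : QG.NatUnitaryMonoidalIso
            ((QG.spectralFunctor H α.coaction hα).compRes P)
            (QG.spectralFunctor G (QG.indAction P α) hI),
          ∀ (u : QG.FinRep G) (T : QG.SpecMor (u.res P) α.coaction),
            Ψ.app u (QG.toSpectral hα T) = QG.toSpectral hI (ψ u T) := by
  refine ⟨QG.inducedEquiv P α, fun u v V T => QG.inducedEquiv_comp V T,
    fun u v T R => QG.inducedEquiv_mul T R, QG.inducedEquiv_unit,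
    fun u T R => QG.coe_ip_inducedEquiv T R, fun hα => ?_⟩
  exact ⟨QG.isErgodic_indAction hα, QG.inducedIso P hα (QG.isErgodic_indAction hα),
    fun u T => QG.inducedUnitary_toSpectral hα (QG.isErgodic_indAction hα) T⟩
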